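/- **Setting.** Let $1\le b<n_1$, $n_2\ge 1$, $n=n_1+n_2$. The path graph with one branch has vertices $1,\dots,n$; its main branch is the path $1-2-\cdots-n_1$, its side branch is the path $(n_1+1)-\cdots-n$, and the vertex $n_1+1$ is joined to the vertex $b$. Every edge is numbered by its larger endpoint $j\in\{2,\dots,n\}$, and $D\in\mathbb R^{(n-1)\times n}$ is the incidence matrix, so $(Df)_j=f_j-f_{j-1}$ for $j\ne n_1+1$ and $(Df)_{n_1+1}=f_{n_1+1}-f_b$. Write $\|v\|_n^2=\frac1n\sum_i v_i^2$. Let $f^0\in\mathbb R^n$, $\sigma>0$, $Y=f^0+\epsilon$ with $\epsilon\sim\mathcal N_n(0,\sigma^2 I_n)$, and $$\widehat f=\arg\min_{f\in\mathbb R^n}\{\|Y-f\|_n^2+2\lambda\|Df\|_1\},\qquad \lambda=\gamma\sigma\sqrt{2\log(4(n-s-1)/\delta)/n},$$ with $\gamma>1$, $\delta\in(0,1)$. Let $S\subseteq\{2,\dots,n\}$, $s=|S|$, and suppose that $S_1=S\cap\{2,\dots,b\}$, $S_2=S\cap\{b+1,\dots,n_1\}$, $S_3=S\cap\{n_1+1,\dots,n\}$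 are non-empty, with cardinalities $s_1,s_2,s_3$. Put $$\beta_1=b-\max S_1+1,\quad \beta_2=\min S_2-b-1,\quad \beta_3=\min S_3-n_1-1,\quad b^*=\beta_1+\beta_2+\beta_3 .$$ For $i=1,2,3$ let $d^i_2,\dots,d^i_{s_i}$ be the differences of consecutive elements of $S_i$, let $d^1_1=\min S_1-1$, $d^2_{s_2+1}=n_1-\max S_2+1$, $d^3_{s_3+1}=n-\max S_3+1$. Decompose the tree, by deleting two edges not in $S$, into three path graphs of which the $i$-th contains the edges numbered by $S_i$. Let $d^1_{s_1+1}$ be the number of vertices of the first path after its last edge in $S$, and let $d^2_1,d^3_1$ be the numbers of vertices of the second and third path before their first edge in $S$. (So $d^1_{s_1+1}+d^2_1+d^3_1=b^*$; the decomposition is otherwise arbitrary.) Assume $d^1_{s_1+1},d^2_1,d^3_1\ge2$, and $d^i_j\ge4$ for all $i$ and $2\le j\le s_i$. Let $$\Delta^i=(d^i_1,\lfloor d^i_2/2\rfloor,\lceil d^i_2/2\rceil,\dots,\lfloor d^i_{s_i}/2\rfloor,\lceil d^i_{s_i}/2\rceil,d^i_{s_i+1})\in\mathbb R^{2s_i},$$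 and let $\bar\Delta_h$ be the harmonic mean of the entries of $\Delta=(\Delta^1,\Delta^2,\Delta^3)\in\mathbb R^{2s}$. **Corollary 5.4 (sharp oracle inequality for the branched path graph).** Assume moreover $d^1_1,\,d^2_{s_2+1},\,d^3_{s_3+1}\ge4$. Then, with probability at least $1-\delta$, $$\begin{aligned}\|\widehat f-f^0\|_n^2\le{}&\inf_{f\in\mathbb R^n}\Big\{\|f-f^0\|_n^2+4\lambda\|(Df)_{-S}\|_1\Big\}+\frac{8\log(2/\delta)\sigma^2}{n}+4\sigma^2\,\frac{s+1}{n}\\&+8\sigma^2\log\!\big(4(n-s-1)/\delta\big)\left(\frac{2\gamma^2s}{\bar\Delta_h}+\frac{5(2s+3)}{2n}\log\Big(\frac{n+1}{2s+3}\Big)+\frac{\zeta}{n}\right),\end{aligned}$$ where 1. $\zeta=0$ if $\beta_1,\beta_2,\beta_3\ge2$; 2. $\zeta=b^*/2$ if $\beta_2=0$ or $\beta_3=0$; 3. if $\beta_1=1$: (a) $\zeta=3$ if $\min(\beta_2,\beta_3)=2$, (b) $\zeta=b^*/4$ if $\min(\beta_2,\beta_3)\ge3$; 4. $\zeta=b^*/4$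 if $\beta_2=1$ or $\beta_3=1$. (Under the assumptions exactly one of these cases occurs.) Furthermore, for all $\sigma>0$, $\gamma>1$, $\delta\in(0,1)$ there is a constant $C>0$, depending only on $\sigma,\gamma,\delta$, such that, whenever the above assumptions hold for $S=S_0:=\{j:(Df^0)_j\ne0\}$, $s_0=|S_0|$, and $\lambda$ is chosen as above with $s=s_0$, with probability at least $1-\delta$ $$\|\widehat f-f^0\|_n^2\le C\left(\frac{\log(n)\,s_0}{\bar\Delta_h}+\frac{\log(n)\log(n/s_0)\,s_0}{n}+\frac{\log(n)\,\zeta}{n}\right).$$ -/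

import Mathlib

open MeasureTheory ProbabilityTheory
open scoped Matrix

namespace BranchedPath

/-! The path graph with one branch: the vertices are `1, …, n₁ + n₂`; the main branch is
`1 — 2 — ⋯ — n₁`, the side branch is `n₁+1 — ⋯ — n₁+n₂`, and the vertex `n₁+1` is joined to the
vertex `b < n₁`.  The edges are numbered by their endpoint `j ∈ {2, …, n}` away from the root `1`. -/

/-- The vertices `1, …, n`. -/
abbrev Vertex (n : ℕ) := ↥(Finset.Icc 1 n)

/-- The edges of a tree on `1, …, n`: the number `j ∈ {2, …, n}` stands for the edge between `j` and
the neighbour of `j` on the way to the root `1`. -/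
abbrev Edge (n : ℕ) := ↥(Finset.Icc 2 n)

/-- The neighbour of the vertex `j ≥ 2` on the way to the root. -/
def parent (n₁ b j : ℕ) : ℕ := if j = n₁ + 1 then b else j - 1

/-- The incidence matrix: the row of an edge has `-1` at its smaller and `+1` at its larger
endpoint. -/
def D (n₁ n₂ b : ℕ) : Matrix (Edge (n₁ + n₂)) (Vertex (n₁ + n₂)) ℝ :=
  fun e v => if (v : ℕ) = e then 1 else if (v : ℕ) = parent n₁ b e then -1 else 0

/-- `‖v‖_n² = (1/n) ∑ v_i²`. -/
noncomputable def normSq {n : ℕ} (v : Vertex n → ℝ) : ℝ := (1 / (n : ℝ)) * ∑ i, v i ^ 2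

/-- The total variation `‖D f‖₁`. -/
noncomputable def tv (n₁ n₂ b : ℕ) (f : Vertex (n₁ + n₂) → ℝ) : ℝ :=
  ∑ e : Edge (n₁ + n₂), |(D n₁ n₂ b *ᵥ f) e|

/-- `‖(D f)_{-S}‖₁`, the total variation over the edges outside `S`. -/
noncomputable def tvOff (n₁ n₂ b : ℕ) (S : Finset ℕ) (f : Vertex (n₁ + n₂) → ℝ) : ℝ :=
  ∑ e ∈ Finset.univ.filter (fun e : Edge (n₁ + n₂) => (e : ℕ) ∉ S), |(D n₁ n₂ b *ᵥ f) e|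

/-- `fhat` minimises `f ↦ ‖y - f‖_n² + 2 lam ‖D f‖₁`. -/
def IsTVEstimator (n₁ n₂ b : ℕ) (lam : ℝ) (y fhat : Vertex (n₁ + n₂) → ℝ) : Prop :=
  ∀ f : Vertex (n₁ + n₂) → ℝ,
    normSq (y - fhat) + 2 * lam * tv n₁ n₂ b fhat ≤ normSq (y - f) + 2 * lam * tv n₁ n₂ b f

/-- The tuning parameter `γ σ √(2 log(4 (n - s - 1) / δ) / n)`. -/
noncomputable def tuning (n s : ℕ) (σ γ δ : ℝ) : ℝ :=
  γ * σ * √(2 * Real.log (4 * ((n : ℝ) - s - 1) / δ) / n)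

/-- The active edges on the main branch up to the branching point. -/
def S₁ (b : ℕ) (S : Finset ℕ) : Finset ℕ := S.filter (· ≤ b)

/-- The active edges on the main branch after the branching point. -/
def S₂ (n₁ b : ℕ) (S : Finset ℕ) : Finset ℕ := S.filter fun j => b < j ∧ j ≤ n₁

/-- The active edges on the side branch, including the edge that attaches it. -/
def S₃ (n₁ : ℕ) (S : Finset ℕ) : Finset ℕ := S.filter (n₁ < ·)

/-- The smallest element (`0` for the empty set, which does not occur below). -/
def first (T : Finset ℕ) : ℕ := if h : T.Nonempty then T.min' h else 0

/-- The largest element (`0` for the empty set, which does not occur below). -/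
def last (T : Finset ℕ) : ℕ := if h : T.Nonempty then T.max' h else 0

/-- The differences of consecutive elements, in increasing order of the elements. -/
def gaps (T : Finset ℕ) : List ℕ :=
  List.zipWith (fun x y => y - x) (T.sort (· ≤ ·)) (T.sort (· ≤ ·)).tail

/-- `b_{s₁+1}`: the number of vertices from the last active edge before the branching point up to
the branching point (included). -/
def β₁ (b : ℕ) (S : Finset ℕ) : ℕ := b - last (S₁ b S) + 1

/-- `b_{s₁+2}`: the number of vertices of the main branch after the branching point and before the
first active edge. -/
def β₂ (n₁ b : ℕ) (S : Finset ℕ) : ℕ := first (S₂ n₁ b S) - b - 1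

/-- `b_{s₁+s₂+3}`: the number of vertices of the side branch before the first active edge. -/
def β₃ (n₁ : ℕ) (S : Finset ℕ) : ℕ := first (S₃ n₁ S) - n₁ - 1

/-- `b^*`: the number of vertices that no active edge separates from the branching point. -/
def βstar (n₁ b : ℕ) (S : Finset ℕ) : ℕ := β₁ b S + β₂ n₁ b S + β₃ n₁ S

/-- The numbers of vertices on the three legs that leave the branching point `b`, from `b`
(excluded) to the first active edge met: towards the root, along the main branch, along the side
branch. -/
def leg (n₁ b : ℕ) (S : Finset ℕ) : Fin 3 → ℕ := ![β₁ b S - 1, β₂ n₁ b S, β₃ n₁ S]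

/-- A decomposition of the tree into three path graphs, the `i`-th of which contains the active
edges of the `i`-th group together with their endpoints, is obtained by deleting two non-active
edges on the legs around `b`. One path, number `i`, then contains `b`; it consists, around `b`, of
leg `i`, of `b`, and of the first `k ≥ 0` vertices of one other leg `j`. Path `j` keeps the rest of
leg `j`, and path `l` is left with leg `l`.  Here `d 0`, `d 1`, `d 2` are the numbers
`d¹_{s₁+1}`, `d²₁`, `d³₁` of vertices which the three paths have between `b` and their active edge
next to `b`; all three are required to be at least two. -/
def IsSplit (n₁ b : ℕ) (S : Finset ℕ) (d : Fin 3 → ℕ) : Prop :=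
  (∀ i, 2 ≤ d i) ∧
    ∃ i j l : Fin 3, i ≠ j ∧ i ≠ l ∧ j ≠ l ∧ ∃ k : ℕ, k ≤ leg n₁ b S j ∧
      d i = leg n₁ b S i + 1 + k ∧ d j = leg n₁ b S j - k ∧ d l = leg n₁ b S l

/-- `d¹₁`, the number of vertices before the first active edge. -/
def dStart (b : ℕ) (S : Finset ℕ) : ℕ := first (S₁ b S) - 1

/-- `d²_{s₂+1}`, the number of vertices after the last active edge of the main branch. -/
def dEnd₂ (n₁ b : ℕ) (S : Finset ℕ) : ℕ := n₁ - last (S₂ n₁ b S) + 1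

/-- `d³_{s₃+1}`, the number of vertices after the last active edge of the side branch. -/
def dEnd₃ (n₁ n₂ : ℕ) (S : Finset ℕ) : ℕ := n₁ + n₂ - last (S₃ n₁ S) + 1

/-- The list `⌊g₁/2⌋, ⌈g₁/2⌉, ⌊g₂/2⌋, ⌈g₂/2⌉, …`. -/
def halves (l : List ℕ) : List ℕ := l.flatMap fun g => [g / 2, (g + 1) / 2]

/-- The vector `Δ = (Δ¹, Δ², Δ³)`, with `2s` entries. -/
def Δ (n₁ n₂ b : ℕ) (S : Finset ℕ) (d : Fin 3 → ℕ) : List ℕ :=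
  ([dStart b S] ++ halves (gaps (S₁ b S)) ++ [d 0]) ++
  ([d 1] ++ halves (gaps (S₂ n₁ b S)) ++ [dEnd₂ n₁ b S]) ++
  ([d 2] ++ halves (gaps (S₃ n₁ S)) ++ [dEnd₃ n₁ n₂ S])

/-- The harmonic mean. -/
noncomputable def harmonicMean (l : List ℕ) : ℝ :=
  (l.length : ℝ) / (l.map fun x => 1 / (x : ℝ)).sum

/-- The standing assumptions: the branched path graph, a set `S` of active edges that meets each of
the three parts of the graph, and a decomposition into three paths in which at least four vertices
lie between consecutive active edges of the same path, and at least two next to the branching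
point. -/
structure Setting (n₁ n₂ b : ℕ) (S : Finset ℕ) (d : Fin 3 → ℕ) : Prop where
  b_pos : 1 ≤ b
  b_lt : b < n₁
  n₂_pos : 1 ≤ n₂
  subset : S ⊆ Finset.Icc 2 (n₁ + n₂)
  nonempty₁ : (S₁ b S).Nonempty
  nonempty₂ : (S₂ n₁ b S).Nonempty
  nonempty₃ : (S₃ n₁ S).Nonempty
  gaps₁ : ∀ g ∈ gaps (S₁ b S), 4 ≤ g
  gaps₂ : ∀ g ∈ gaps (S₂ n₁ b S), 4 ≤ g
  gaps₃ : ∀ g ∈ gaps (S₃ n₁ S), 4 ≤ g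
  split : IsSplit n₁ b S d

/-- The constant `ζ`. In a `Setting` the branches below exclude each other (their order is
irrelevant), the alternative to `min = 2` is `min ≥ 3`, and the last one is the case where all three
numbers are at least two. -/
noncomputable def ζ (n₁ b : ℕ) (S : Finset ℕ) : ℝ :=
  if β₂ n₁ b S = 0 ∨ β₃ n₁ S = 0 then (βstar n₁ b S : ℝ) / 2
  else if β₁ b S = 1 then
    if min (β₂ n₁ b S) (β₃ n₁ S) = 2 then 3 else (βstar n₁ b S : ℝ) / 4
  else if β₂ n₁ b S = 1 ∨ β₃ n₁ S = 1 then (βstar n₁ b S : ℝ) / 4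
  else 0

/-- The law `N_n(0, σ² I_n)`. -/
noncomputable def noiseLaw (n : ℕ) (σ : ℝ) : Measure (Vertex n → ℝ) :=
  Measure.pi fun _ => gaussianReal 0 (Real.toNNReal (σ ^ 2))

end BranchedPath

/-! The proof rests on the standard argument for total variation denoising on a tree, with an
explicit interpolating vector.

Deleting the edges of `S` leaves `s + 1` components; let `Π` be the projection on the vectors that
are constant on each of them. Off the range of `Π` the noise is a combination of the rows of `D`
outside `S`: in `residual_decomposition`, the coefficient of the edge `e ∉ S` is the pairing of the
noise with `r_e`, the indicator of the part of the component of `e` beyond `e`, recentred on that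
component. If `e` splits its component into `x` and `y` vertices, then
`‖r_e‖² = x y / (x + y) =: n w_e²`. With probability `1 - δ` (`gaussian_good_event`), the squared
length of `Π ε` is at most `σ² (2 (s + 1) + 4 log (2 / δ))`, and `|⟨r_e, ε⟩| ≤ n λ w_e / γ` for all
`e ∉ S`. On this event everything is deterministic (`oracle_inequality`): the variational inequality
of the minimiser, compared with an arbitrary `f`, bounds the loss, as soon as for every choice of
signs `z` on `S` there is a vector `q` on the edges with `q = z` on `S`, `|q_e| ≤ 1 - w_e / γ` off
`S`, and a small energy `‖Dᵀ q‖²`.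

The vector `q` (`exists_interpolating_vector`) is the linear interpolation of the signs along the
tree, truncated at `± (1 - w / γ)`. The increments of a truncated sequence are at most the maximum
of the increments of the sequence and of the bound (`sq_clip_sub_clip_le`), so the energy is at most
the sum of two terms. Linear interpolation over a gap `g` costs at most
`4 / g ≤ 1 / ⌊g / 2⌋ + 1 / ⌈g / 2⌉`, and all parts together cost at most twice the sum of the
reciprocals of `Δ`, that is, `4 s / Δ̄_h`. The increments of `w` over a component with `B` vertices cost `O(log B) / n`, and by
concavity of the logarithm these terms add up to the multiple of `(2 s + 3) log ((n + 1) / (2 s + 3))`.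

At the branching point three legs meet, and the flow `q` obeys no constraint there but the cost of
its divergence (`exists_star_values`). The path of the decomposition that contains the branching
point consists of a leg `i` and of `k` vertices of a leg `j`. If `k` is at most the length of leg `i`
plus one, the interpolation runs along that path, down to a value on leg `j`, and leg `l` ends with
the value `0`. Otherwise leg `i` keeps the largest admissible flow, and this flow is shared out
between the legs `j` and `l`, whatever the signs at their far ends; this is affordable because
`1 / d_i + 1 / d_j ≥ 1 / (2 k) + 1 / (a_j - k) ≥ 11 / (4 a_j)` for the lengths `a` of the legs and
`d` of the decomposition. In either case the cost is at most `2 (1 / d_i + 1 / d_j + 1 / d_l)`. Hence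
the inequality holds without the term `ζ / n`, and `ζ ≥ 0` gives the assertion in all cases. The rate is the inequality at `f = f⁰` (`remainder_le_rate`). -/

/-! ### Gaussian tail bounds -/

namespace BranchedPath

open scoped ENNReal NNReal

/-- For independent factors the Lebesgue integral of a product of functions of the single
coordinates factorises. -/
theorem lintegral_pi_prod {ι : Type*} [Fintype ι] (m : ι → Measure ℝ)
    [∀ i, IsProbabilityMeasure (m i)] (F : ι → ℝ → ℝ≥0∞) (hF : ∀ i, Measurable (F i)) :
    ∫⁻ x, ∏ i, F i (x i) ∂(Measure.pi m) = ∏ i, ∫⁻ t, F i t ∂(m i) := by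
  have hind : iIndepFun (fun i (x : ι → ℝ) => F i (x i)) (Measure.pi m) :=
    iIndepFun_pi (X := F) fun i => (hF i).aemeasurable
  rw [lintegral_prod_eq_prod_lintegral_of_indepFun Finset.univ _ hind
    fun i => (hF i).comp (measurable_pi_apply i)]
  refine Finset.prod_congr rfl fun i _ => ?_
  rw [← (measurePreserving_eval m i).lintegral_comp (hF i)]

theorem lintegral_exp_mul_gaussianReal (v : ℝ≥0) (c : ℝ) :
    ∫⁻ t, ENNReal.ofReal (Real.exp (c * t)) ∂(gaussianReal 0 v)
      = ENNReal.ofReal (Real.exp (v * c ^ 2 / 2)) := by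
  rw [← ofReal_integral_eq_lintegral_ofReal (integrable_exp_mul_gaussianReal c)
    (Filter.Eventually.of_forall fun x => (Real.exp_pos _).le)]
  have h := congrFun (mgf_fun_id_gaussianReal (μ := 0) (v := v)) c
  simp only [mgf, zero_mul, zero_add] at h
  rw [h]

theorem ofReal_exp_sum {ι : Type*} (s : Finset ι) (f : ι → ℝ) :
    ENNReal.ofReal (Real.exp (∑ i ∈ s, f i)) = ∏ i ∈ s, ENNReal.ofReal (Real.exp (f i)) := by
  rw [Real.exp_sum, ENNReal.ofReal_prod_of_nonneg fun i _ => (Real.exp_pos _).le]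

theorem lintegral_exp_linear {ι : Type*} [Fintype ι] (v : ℝ≥0) (c : ι → ℝ) :
    ∫⁻ x, ENNReal.ofReal (Real.exp (∑ i, c i * x i)) ∂(Measure.pi fun _ : ι => gaussianReal 0 v)
      = ENNReal.ofReal (Real.exp (v * (∑ i, c i ^ 2) / 2)) := by
  simp_rw [ofReal_exp_sum]
  rw [lintegral_pi_prod (fun _ : ι => gaussianReal 0 v)
    (fun i t => ENNReal.ofReal (Real.exp (c i * t))) fun i => by fun_prop]
  simp_rw [lintegral_exp_mul_gaussianReal]
  rw [← ofReal_exp_sum, Finset.mul_sum, Finset.sum_div]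

/-- Chernoff's bound for a linear functional of Gaussian noise. -/
theorem gaussian_linear_tail {ι : Type*} [Fintype ι] {σ τ L : ℝ} (hσ : 0 < σ) (hτ : 0 < τ)
    (hL : 0 ≤ L) (c : ι → ℝ) (hc : ∑ i, c i ^ 2 ≤ τ ^ 2) :
    (Measure.pi fun _ : ι => gaussianReal 0 (Real.toNNReal (σ ^ 2)))
      {x | σ * τ * √(2 * L) ≤ ∑ i, c i * x i} ≤ ENNReal.ofReal (Real.exp (-L)) := by
  set μ := (Measure.pi fun _ : ι => gaussianReal 0 (Real.toNNReal (σ ^ 2)))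
  set t : ℝ := √(2 * L) / (σ * τ) with ht
  have hst : 0 < σ * τ := mul_pos hσ hτ
  have ht0 : 0 ≤ t := by positivity
  have hsq : √(2 * L) ^ 2 = 2 * L := Real.sq_sqrt (by linarith)
  have hmeas : Measurable fun x : ι → ℝ => ENNReal.ofReal (Real.exp (∑ i, t * c i * x i)) := by
    fun_prop
  have hMarkov := mul_meas_ge_le_lintegral₀ (μ := μ) hmeas.aemeasurable
    (ENNReal.ofReal (Real.exp (2 * L)))
  rw [lintegral_exp_linear] at hMarkov
  have hsub : {x : ι → ℝ | σ * τ * √(2 * L) ≤ ∑ i, c i * x i} ⊆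
      {x | ENNReal.ofReal (Real.exp (2 * L)) ≤
        ENNReal.ofReal (Real.exp (∑ i, t * c i * x i))} := by
    intro x hx
    simp only [Set.mem_ofPred_eq] at hx ⊢
    refine ENNReal.ofReal_le_ofReal (Real.exp_le_exp.mpr ?_)
    have h1 : ∑ i, t * c i * x i = t * ∑ i, c i * x i := by
      rw [Finset.mul_sum]; exact Finset.sum_congr rfl fun i _ => by ring
    rw [h1]
    calc 2 * L = t * (σ * τ * √(2 * L)) := by
          rw [ht]; field_simp; exact hsq.symm
      _ ≤ _ := mul_le_mul_of_nonneg_left hx ht0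
  have hexp : (Real.toNNReal (σ ^ 2) : ℝ) * (∑ i, (t * c i) ^ 2) / 2 ≤ L := by
    rw [Real.coe_toNNReal _ (sq_nonneg σ)]
    have h1 : ∑ i, (t * c i) ^ 2 = t ^ 2 * ∑ i, c i ^ 2 := by
      rw [Finset.mul_sum]; exact Finset.sum_congr rfl fun i _ => by ring
    rw [h1]
    calc σ ^ 2 * (t ^ 2 * ∑ i, c i ^ 2) / 2 ≤ σ ^ 2 * (t ^ 2 * τ ^ 2) / 2 := by gcongr
      _ = √(2 * L) ^ 2 / 2 := by rw [ht]; field_simp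
      _ = L := by rw [hsq]; ring
  have h2 : ENNReal.ofReal (Real.exp (2 * L)) * μ {x | σ * τ * √(2 * L) ≤ ∑ i, c i * x i} ≤
      ENNReal.ofReal (Real.exp L) :=
    (mul_le_mul_right (measure_mono hsub) _).trans (hMarkov.trans
      (ENNReal.ofReal_le_ofReal (Real.exp_le_exp.mpr hexp)))
  have h3 : ENNReal.ofReal (Real.exp (-L)) =
      ENNReal.ofReal (Real.exp L) / ENNReal.ofReal (Real.exp (2 * L)) := by
    rw [← ENNReal.ofReal_div_of_pos (Real.exp_pos _), ← Real.exp_sub]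
    congr 2; ring
  rw [h3, ENNReal.le_div_iff_mul_le (Or.inl (by simp [Real.exp_pos])) (Or.inl (by simp)), mul_comm]
  exact h2

theorem lintegral_exp_sq_gaussianReal :
    ∫⁻ t, ENNReal.ofReal (Real.exp (t ^ 2 / 4)) ∂(gaussianReal 0 1) = ENNReal.ofReal (√2) := by
  rw [gaussianReal_of_var_ne_zero _ one_ne_zero, lintegral_withDensity_eq_lintegral_mul _
    (measurable_gaussianPDF _ _) (by fun_prop)]
  have h : ∀ t : ℝ, (gaussianPDF 0 1 * fun t => ENNReal.ofReal (Real.exp (t ^ 2 / 4))) t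
      = ENNReal.ofReal ((√(2 * Real.pi))⁻¹ * Real.exp (-(1 / 4) * t ^ 2)) := by
    intro t
    simp only [Pi.mul_apply, gaussianPDF, gaussianPDFReal]
    rw [← ENNReal.ofReal_mul (by positivity), mul_assoc, ← Real.exp_add]
    congr 3
    · simp
    · push_cast; ring_nf
  simp_rw [h]
  rw [← ofReal_integral_eq_lintegral_ofReal
    ((integrable_exp_neg_mul_sq (by norm_num)).const_mul _)
    (Filter.Eventually.of_forall fun x => by positivity), integral_const_mul, integral_gaussian]
  congr 1
  rw [inv_mul_eq_iff_eq_mul₀ (by positivity), ← Real.sqrt_mul (by positivity)]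
  congr 1; ring

/-- The exponential moment of a chi-square variable at `1/4`, for the squared norm of the
projection of Gaussian noise on the span of an orthonormal family. The square in the exponent is
linearised by an auxiliary independent Gaussian vector `ξ`, so that only exponential moments of
linear functionals are needed. -/
theorem lintegral_exp_chiSq {ι κ : Type*} [Fintype ι] [Fintype κ] [DecidableEq κ] {σ : ℝ}
    (hσ : 0 < σ)
    (u : κ → ι → ℝ) (hu : ∀ k l, ∑ i, u k i * u l i = if k = l then 1 else 0) :
    ∫⁻ x, ENNReal.ofReal (Real.exp ((∑ k, (∑ i, u k i * x i) ^ 2) / (4 * σ ^ 2)))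
        ∂(Measure.pi fun _ : ι => gaussianReal 0 (Real.toNNReal (σ ^ 2)))
      = ENNReal.ofReal (√2) ^ Fintype.card κ := by
  set μ := (Measure.pi fun _ : ι => gaussianReal 0 (Real.toNNReal (σ ^ 2)))
  set ν := (Measure.pi fun _ : κ => gaussianReal 0 1)
  have hs2 : (√2 : ℝ) ^ 2 = 2 := Real.sq_sqrt (by norm_num)
  have hs0 : (0 : ℝ) < √2 := by positivity
  have h1 : ∀ x : ι → ℝ,
      ENNReal.ofReal (Real.exp ((∑ k, (∑ i, u k i * x i) ^ 2) / (4 * σ ^ 2))) =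
      ∫⁻ ξ, ENNReal.ofReal (Real.exp (∑ k, ((∑ i, u k i * x i) / (√2 * σ)) * ξ k)) ∂ν := by
    intro x
    rw [lintegral_exp_linear]
    congr 2
    simp_rw [div_pow, mul_pow, hs2]
    rw [← Finset.sum_div]
    push_cast
    field_simp
    norm_num
  simp_rw [h1]
  rw [lintegral_lintegral_swap (by fun_prop)]
  have h2 : ∀ ξ : κ → ℝ,
      ∫⁻ x, ENNReal.ofReal (Real.exp (∑ k, ((∑ i, u k i * x i) / (√2 * σ)) * ξ k)) ∂μ
      = ∏ k, ENNReal.ofReal (Real.exp (ξ k ^ 2 / 4)) := by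
    intro ξ
    have h3 : ∀ x : ι → ℝ, ∑ k, ((∑ i, u k i * x i) / (√2 * σ)) * ξ k
        = ∑ i, ((∑ k, u k i * ξ k) / (√2 * σ)) * x i := by
      intro x
      simp_rw [Finset.sum_div, Finset.sum_mul]
      rw [Finset.sum_comm]
      exact Finset.sum_congr rfl fun i _ => Finset.sum_congr rfl fun k _ => by ring
    simp_rw [h3]
    rw [lintegral_exp_linear, ← ofReal_exp_sum]
    congr 2
    have h4 : ∑ i, (∑ k, u k i * ξ k) ^ 2 = ∑ k, ξ k ^ 2 := by
      have : ∀ i, (∑ k, u k i * ξ k) ^ 2 = ∑ k, ∑ l, ξ k * ξ l * (u k i * u l i) := by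
        intro i
        rw [sq, Finset.sum_mul_sum]
        exact Finset.sum_congr rfl fun k _ => Finset.sum_congr rfl fun l _ => by ring
      simp_rw [this]
      rw [Finset.sum_comm]
      refine Finset.sum_congr rfl fun k _ => ?_
      rw [Finset.sum_comm]
      simp_rw [← Finset.mul_sum, hu]
      simp [sq]
    simp_rw [div_pow, mul_pow, hs2]
    rw [← Finset.sum_div, h4, Real.coe_toNNReal _ (sq_nonneg σ), ← Finset.sum_div]
    field_simp
    norm_num
  simp_rw [h2]
  rw [lintegral_pi_prod (fun _ : κ => gaussianReal 0 1)
    (fun _ t => ENNReal.ofReal (Real.exp (t ^ 2 / 4))) fun i => by fun_prop]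
  simp_rw [lintegral_exp_sq_gaussianReal]
  simp

theorem gaussian_chiSq_tail {ι κ : Type*} [Fintype ι] [Fintype κ] [DecidableEq κ] {σ : ℝ}
    (hσ : 0 < σ) (u : κ → ι → ℝ) (hu : ∀ k l, ∑ i, u k i * u l i = if k = l then 1 else 0)
    (t : ℝ) :
    (Measure.pi fun _ : ι => gaussianReal 0 (Real.toNNReal (σ ^ 2)))
      {x | σ ^ 2 * (2 * Fintype.card κ + 4 * t) ≤ ∑ k, (∑ i, u k i * x i) ^ 2}
      ≤ ENNReal.ofReal (Real.exp (-t)) := by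
  set μ := (Measure.pi fun _ : ι => gaussianReal 0 (Real.toNNReal (σ ^ 2)))
  set N := Fintype.card κ
  have hmeas : Measurable fun x : ι → ℝ =>
      ENNReal.ofReal (Real.exp ((∑ k, (∑ i, u k i * x i) ^ 2) / (4 * σ ^ 2))) := by fun_prop
  have hMarkov := mul_meas_ge_le_lintegral₀ (μ := μ) hmeas.aemeasurable
    (ENNReal.ofReal (Real.exp (N / 2 + t)))
  rw [lintegral_exp_chiSq hσ u hu] at hMarkov
  have hsub : {x : ι → ℝ | σ ^ 2 * (2 * N + 4 * t) ≤ ∑ k, (∑ i, u k i * x i) ^ 2} ⊆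
      {x | ENNReal.ofReal (Real.exp (N / 2 + t)) ≤
        ENNReal.ofReal (Real.exp ((∑ k, (∑ i, u k i * x i) ^ 2) / (4 * σ ^ 2)))} := by
    intro x hx
    simp only [Set.mem_ofPred_eq] at hx ⊢
    refine ENNReal.ofReal_le_ofReal (Real.exp_le_exp.mpr ?_)
    rw [le_div_iff₀ (by positivity)]
    linarith
  -- `√2 ≤ √e` bounds the moment by `exp (N / 2)`
  have hsqrt : √2 ≤ Real.exp (1 / 2) := by
    rw [Real.sqrt_le_left (Real.exp_pos _).le, ← Real.exp_nat_mul]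
    have := Real.add_one_le_exp (1 : ℝ)
    norm_num at this ⊢
    linarith
  have hpow : ENNReal.ofReal (√2) ^ N ≤ ENNReal.ofReal (Real.exp (N / 2)) := by
    rw [← ENNReal.ofReal_pow (Real.sqrt_nonneg _)]
    refine ENNReal.ofReal_le_ofReal ((pow_le_pow_left₀ (Real.sqrt_nonneg _) hsqrt N).trans ?_)
    rw [← Real.exp_nat_mul]
    exact le_of_eq (by ring_nf)
  have h3 : ENNReal.ofReal (Real.exp (-t)) =
      ENNReal.ofReal (Real.exp (N / 2)) / ENNReal.ofReal (Real.exp (N / 2 + t)) := by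
    rw [← ENNReal.ofReal_div_of_pos (Real.exp_pos _), ← Real.exp_sub]
    congr 2; ring
  rw [h3, ENNReal.le_div_iff_mul_le (Or.inl (by simp [Real.exp_pos])) (Or.inl (by simp)), mul_comm]
  exact (mul_le_mul_right (measure_mono hsub) _).trans (hMarkov.trans hpow)

/-- The event on which the oracle inequality holds: the projection of the noise is controlled by
a chi-square bound, and the finitely many functionals `r e` by Chernoff's bound. -/
theorem gaussian_good_event {ι κ η : Type*} [Fintype ι] [Fintype κ] [DecidableEq κ]
    {σ L δ : ℝ} (hσ : 0 < σ) (hL : 0 ≤ L) (hδ : 0 < δ)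
    (u : κ → ι → ℝ) (hu : ∀ k l, ∑ i, u k i * u l i = if k = l then 1 else 0)
    (A : Finset η) (hA : 4 * (A.card : ℝ) * Real.exp (-L) ≤ δ)
    (r : η → ι → ℝ) (τ : η → ℝ) (hτ : ∀ e ∈ A, 0 < τ e)
    (hr : ∀ e ∈ A, ∑ i, r e i ^ 2 ≤ τ e ^ 2) :
    ENNReal.ofReal (1 - δ) ≤ (Measure.pi fun _ : ι => gaussianReal 0 (Real.toNNReal (σ ^ 2)))
      {x | ∑ k, (∑ i, u k i * x i) ^ 2 ≤
          σ ^ 2 * (2 * Fintype.card κ + 4 * Real.log (2 / δ)) ∧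
        ∀ e ∈ A, |∑ i, r e i * x i| ≤ σ * τ e * √(2 * L)} := by
  set μ := (Measure.pi fun _ : ι => gaussianReal 0 (Real.toNNReal (σ ^ 2)))
  set G := {x : ι → ℝ | ∑ k, (∑ i, u k i * x i) ^ 2 ≤
          σ ^ 2 * (2 * Fintype.card κ + 4 * Real.log (2 / δ)) ∧
        ∀ e ∈ A, |∑ i, r e i * x i| ≤ σ * τ e * √(2 * L)} with hG
  have hGm : MeasurableSet G := by
    have : G = {x : ι → ℝ | ∑ k, (∑ i, u k i * x i) ^ 2 ≤
          σ ^ 2 * (2 * Fintype.card κ + 4 * Real.log (2 / δ))} ∩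
        ⋂ e ∈ A, {x | |∑ i, r e i * x i| ≤ σ * τ e * √(2 * L)} := by
      ext x; simp [hG]
    rw [this]
    refine (measurableSet_le (by fun_prop) measurable_const).inter
      (Finset.measurableSet_biInter _ fun e _ => measurableSet_le ?_ measurable_const)
    have : Measurable fun x : ι → ℝ => ∑ i, r e i * x i := by fun_prop
    exact this.abs
  have hcompl : Gᶜ ⊆ {x | σ ^ 2 * (2 * Fintype.card κ + 4 * Real.log (2 / δ)) ≤
        ∑ k, (∑ i, u k i * x i) ^ 2} ∪
      ⋃ e ∈ A, ({x | σ * τ e * √(2 * L) ≤ ∑ i, r e i * x i} ∪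
        {x | σ * τ e * √(2 * L) ≤ ∑ i, (-r e i) * x i}) := by
    intro x hx
    by_contra hcon
    simp only [Set.mem_union, Set.mem_iUnion, Set.mem_ofPred_eq, not_or, not_exists, not_le] at hcon
    refine hx ⟨hcon.1.le, fun e he => ?_⟩
    obtain ⟨h1, h2⟩ := hcon.2 e he
    simp only [neg_mul, Finset.sum_neg_distrib] at h2
    exact abs_le.mpr ⟨by linarith, h1.le⟩
  have hlog : Real.exp (-Real.log (2 / δ)) = δ / 2 := by
    rw [Real.exp_neg, Real.exp_log (by positivity), inv_div]
  have hbound : μ Gᶜ ≤ ENNReal.ofReal δ := by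
    calc μ Gᶜ ≤ _ := measure_mono hcompl
      _ ≤ _ := measure_union_le _ _
      _ ≤ ENNReal.ofReal (δ / 2) + ∑ e ∈ A, (ENNReal.ofReal (Real.exp (-L)) +
            ENNReal.ofReal (Real.exp (-L))) := by
          refine add_le_add ?_ ((measure_biUnion_finset_le _ _).trans
            (Finset.sum_le_sum fun e he => (measure_union_le _ _).trans (add_le_add ?_ ?_)))
          · rw [← hlog]; exact gaussian_chiSq_tail hσ u hu _
          · exact gaussian_linear_tail hσ (hτ e he) hL _ (hr e he)
          · exact gaussian_linear_tail hσ (hτ e he) hL _ (by simpa using hr e he)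
      _ = ENNReal.ofReal (δ / 2 + A.card * (Real.exp (-L) + Real.exp (-L))) := by
          rw [Finset.sum_const, nsmul_eq_mul, ENNReal.ofReal_add (p := δ / 2) (by positivity)
            (by positivity), ENNReal.ofReal_mul (by positivity), ENNReal.ofReal_natCast,
            ENNReal.ofReal_add (Real.exp_pos _).le (Real.exp_pos _).le]
      _ ≤ ENNReal.ofReal δ := ENNReal.ofReal_le_ofReal (by linarith)
  rw [measure_compl hGm (measure_ne_top _ _), measure_univ] at hbound
  rw [ENNReal.ofReal_sub _ hδ.le, ENNReal.ofReal_one]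
  exact tsub_le_iff_left.mpr (tsub_le_iff_right.mp hbound)

end BranchedPath

/-! ### The deterministic oracle inequality -/

namespace BranchedPath

section Deterministic

variable {V E : Type*} [Fintype V] [Fintype E] (D : Matrix E V ℝ)

/-- The variational inequality of a penalised least squares estimator, with the gain in convexity
that makes the oracle inequality sharp. -/
theorem minimizer_variational {Λ : ℝ} (hΛ : 0 ≤ Λ) (y fhat : V → ℝ)
    (hmin : ∀ f : V → ℝ, ∑ v, (y v - fhat v) ^ 2 + 2 * Λ * ∑ e, |(D *ᵥ fhat) e| ≤
      ∑ v, (y v - f v) ^ 2 + 2 * Λ * ∑ e, |(D *ᵥ f) e|) (f : V → ℝ) :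
    ∑ v, (y v - fhat v) * (f v - fhat v) ≤
      Λ * (∑ e, |(D *ᵥ f) e| - ∑ e, |(D *ᵥ fhat) e|) := by
  set A := ∑ v, (y v - fhat v) * (f v - fhat v)
  set B := ∑ v, (f v - fhat v) ^ 2
  set T := ∑ e, |(D *ᵥ f) e|
  set T' := ∑ e, |(D *ᵥ fhat) e|
  have key : ∀ t : ℝ, 0 < t → t ≤ 1 → 2 * A - 2 * Λ * (T - T') ≤ t * B := by
    intro t ht ht1
    have h := hmin (fun v => fhat v + t * (f v - fhat v))
    have h1 : ∑ v, (y v - (fhat v + t * (f v - fhat v))) ^ 2 =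
        ∑ v, (y v - fhat v) ^ 2 - 2 * t * A + t ^ 2 * B := by
      simp only [A, B, Finset.mul_sum]
      rw [← Finset.sum_sub_distrib, ← Finset.sum_add_distrib]
      exact Finset.sum_congr rfl fun v _ => by ring
    have h2 : ∑ e, |(D *ᵥ fun v => fhat v + t * (f v - fhat v)) e| ≤ (1 - t) * T' + t * T := by
      simp only [T, T', Finset.mul_sum]
      rw [← Finset.sum_add_distrib]
      refine Finset.sum_le_sum fun e _ => ?_
      have h3 : (D *ᵥ fun v => fhat v + t * (f v - fhat v)) e =
          (1 - t) * (D *ᵥ fhat) e + t * (D *ᵥ f) e := by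
        simp only [Matrix.mulVec, dotProduct, Finset.mul_sum]
        rw [← Finset.sum_add_distrib]
        exact Finset.sum_congr rfl fun v _ => by ring
      rw [h3]
      refine (abs_add_le _ _).trans ?_
      rw [abs_mul, abs_mul, abs_of_pos ht, abs_of_nonneg (by linarith : 0 ≤ 1 - t)]
    have h4 := mul_le_mul_of_nonneg_left h2 (by linarith : 0 ≤ 2 * Λ)
    rw [h1] at h
    have h5 : t * (2 * A - 2 * Λ * (T - T')) ≤ t * (t * B) := by nlinarith
    exact le_of_mul_le_mul_left h5 ht
  have hB : 0 ≤ B := Finset.sum_nonneg fun v _ => sq_nonneg _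
  by_contra hcon
  push Not at hcon
  set c := 2 * A - 2 * Λ * (T - T') with hc
  have hc0 : 0 < c := by simp only [hc]; nlinarith
  have h1 := key (min 1 (c / (2 * (B + 1)))) (lt_min one_pos (by positivity)) (min_le_left _ _)
  have h2 : min 1 (c / (2 * (B + 1))) * B ≤ c / (2 * (B + 1)) * B :=
    mul_le_mul_of_nonneg_right (min_le_right _ _) hB
  have h3 : c / (2 * (B + 1)) * B < c := by
    rw [div_mul_eq_mul_div, div_lt_iff₀ (by positivity)]
    nlinarith
  linarith

/-- The sharp oracle inequality on the event where the projected noise and the functionals `r e` are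
bounded. An interpolating vector `q` of the signs on the active edges plays the role of a
compatibility condition. -/
theorem oracle_inequality {κ : Type*} [Fintype κ] [DecidableEq E]
    {Λ M Q : ℝ} (hΛ : 0 ≤ Λ) (A : Finset E)
    (u : κ → V → ℝ) (hu : ∀ g : V → ℝ, ∑ k, (∑ v, u k v * g v) ^ 2 ≤ ∑ v, g v ^ 2)
    (r : E → V → ℝ)
    (hdec : ∀ x g : V → ℝ, ∑ v, x v * g v = ∑ k, (∑ v, u k v * x v) * (∑ v, u k v * g v) +
      ∑ e ∈ Aᶜ, (∑ v, r e v * x v) * (D *ᵥ g) e)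
    (w : E → ℝ)
    (hq : ∀ z : E → ℝ, (∀ e, |z e| = 1) → ∃ q : E → ℝ, (∀ e ∈ A, q e = z e) ∧
      (∀ e ∉ A, |q e| ≤ 1 - w e) ∧ ∑ v, (∑ e, D e v * q e) ^ 2 ≤ Q)
    (f₀ ε fhat : V → ℝ)
    (hmin : ∀ f : V → ℝ, ∑ v, (f₀ v + ε v - fhat v) ^ 2 + 2 * Λ * ∑ e, |(D *ᵥ fhat) e| ≤
      ∑ v, (f₀ v + ε v - f v) ^ 2 + 2 * Λ * ∑ e, |(D *ᵥ f) e|)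
    (hM : ∑ k, (∑ v, u k v * ε v) ^ 2 ≤ M)
    (hr : ∀ e ∉ A, |∑ v, r e v * ε v| ≤ Λ * w e) (f : V → ℝ) :
    ∑ v, (fhat v - f₀ v) ^ 2 ≤ ∑ v, (f v - f₀ v) ^ 2 + 4 * Λ * ∑ e ∈ Aᶜ, |(D *ᵥ f) e| +
      2 * M + 2 * Λ ^ 2 * Q := by
  set g : V → ℝ := fun v => fhat v - f v with hg
  set G := ∑ v, g v ^ 2 with hGdef
  have hDg : ∀ e, (D *ᵥ g) e = (D *ᵥ fhat) e - (D *ᵥ f) e := by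
    intro e
    have : g = fhat - f := rfl
    rw [this, Matrix.mulVec_sub, Pi.sub_apply]
  have hvar := minimizer_variational D hΛ (fun v => f₀ v + ε v) fhat hmin f
  -- the polarisation of the three squared distances
  have hpol : ∑ v, (f₀ v + ε v - fhat v) * (f v - fhat v) =
      (∑ v, (fhat v - f₀ v) ^ 2 + G - ∑ v, (f v - f₀ v) ^ 2) / 2 - ∑ v, ε v * g v := by
    rw [hGdef, ← Finset.sum_add_distrib, ← Finset.sum_sub_distrib, Finset.sum_div,
      ← Finset.sum_sub_distrib]
    exact Finset.sum_congr rfl fun v _ => by simp only [hg]; ring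
  rw [hpol] at hvar
  have hP : ∑ k, (∑ v, u k v * ε v) * (∑ v, u k v * g v) ≤ M + G / 4 := by
    have h1 : ∑ k, (∑ v, u k v * ε v) * (∑ v, u k v * g v) ≤
        ∑ k, ((∑ v, u k v * ε v) ^ 2 + (∑ v, u k v * g v) ^ 2 / 4) :=
      Finset.sum_le_sum fun k _ => by
        nlinarith [sq_nonneg ((∑ v, u k v * ε v) - (∑ v, u k v * g v) / 2)]
    rw [Finset.sum_add_distrib, ← Finset.sum_div] at h1
    have h2 := hu g
    linarith
  have hR : ∑ e ∈ Aᶜ, (∑ v, r e v * ε v) * (D *ᵥ g) e ≤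
      Λ * ∑ e ∈ Aᶜ, w e * |(D *ᵥ g) e| := by
    rw [Finset.mul_sum]
    refine Finset.sum_le_sum fun e he => ?_
    have h1 := hr e (Finset.mem_compl.mp he)
    calc _ ≤ |(∑ v, r e v * ε v) * (D *ᵥ g) e| := le_abs_self _
      _ = |∑ v, r e v * ε v| * |(D *ᵥ g) e| := abs_mul _ _
      _ ≤ Λ * w e * |(D *ᵥ g) e| := mul_le_mul_of_nonneg_right h1 (abs_nonneg _)
      _ = _ := by ring
  have hTV : ∑ e, |(D *ᵥ f) e| - ∑ e, |(D *ᵥ fhat) e| ≤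
      ∑ e ∈ A, |(D *ᵥ g) e| - ∑ e ∈ Aᶜ, |(D *ᵥ g) e| + 2 * ∑ e ∈ Aᶜ, |(D *ᵥ f) e| := by
    rw [← Finset.sum_add_sum_compl A, ← Finset.sum_add_sum_compl A]
    have h1 : ∑ e ∈ A, |(D *ᵥ f) e| ≤ ∑ e ∈ A, |(D *ᵥ g) e| + ∑ e ∈ A, |(D *ᵥ fhat) e| := by
      rw [← Finset.sum_add_distrib]
      refine Finset.sum_le_sum fun e _ => ?_
      have := abs_sub_abs_le_abs_sub ((D *ᵥ f) e) ((D *ᵥ fhat) e)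
      rw [hDg, abs_sub_comm ((D *ᵥ fhat) e)]; linarith
    have h2 : ∑ e ∈ Aᶜ, |(D *ᵥ g) e| ≤ ∑ e ∈ Aᶜ, |(D *ᵥ f) e| + ∑ e ∈ Aᶜ, |(D *ᵥ fhat) e| := by
      rw [← Finset.sum_add_distrib]
      refine Finset.sum_le_sum fun e _ => ?_
      rw [hDg, add_comm]
      exact abs_sub _ _
    linarith
  -- pairing with the interpolating vector bounds the loss on the active edges
  obtain ⟨q, hqA, hqC, hqQ⟩ := hq (fun e => if 0 ≤ (D *ᵥ g) e then 1 else -1) fun e => by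
    split_ifs <;> simp
  have hpair : ∑ e ∈ A, |(D *ᵥ g) e| - ∑ e ∈ Aᶜ, (1 - w e) * |(D *ᵥ g) e| ≤
      ∑ v, (∑ e, D e v * q e) * g v := by
    have h1 : ∑ v, (∑ e, D e v * q e) * g v = ∑ e, q e * (D *ᵥ g) e := by
      simp only [Matrix.mulVec, dotProduct, Finset.sum_mul, Finset.mul_sum]
      rw [Finset.sum_comm]
      exact Finset.sum_congr rfl fun e _ => Finset.sum_congr rfl fun v _ => by ring
    rw [h1, ← Finset.sum_add_sum_compl A, sub_eq_add_neg, ← Finset.sum_neg_distrib]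
    refine add_le_add (Finset.sum_le_sum fun e he => ?_) (Finset.sum_le_sum fun e he => ?_)
    · rw [hqA e he]
      split_ifs with h
      · rw [one_mul, abs_of_nonneg h]
      · rw [abs_of_neg (not_le.mp h)]; linarith
    · have h2 := mul_le_mul_of_nonneg_right (hqC e (Finset.mem_compl.mp he))
        (abs_nonneg ((D *ᵥ g) e))
      rw [← abs_mul] at h2
      linarith [neg_abs_le (q e * (D *ᵥ g) e)]
  have hCS : Λ * ∑ v, (∑ e, D e v * q e) * g v ≤ Λ ^ 2 * Q + G / 4 := by
    have h1 : Λ * ∑ v, (∑ e, D e v * q e) * g v ≤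
        ∑ v, (Λ ^ 2 * (∑ e, D e v * q e) ^ 2 + g v ^ 2 / 4) := by
      rw [Finset.mul_sum]
      refine Finset.sum_le_sum fun v _ => ?_
      nlinarith [sq_nonneg (Λ * (∑ e, D e v * q e) - g v / 2)]
    rw [Finset.sum_add_distrib, ← Finset.mul_sum, ← Finset.sum_div] at h1
    have h2 := mul_le_mul_of_nonneg_left hqQ (sq_nonneg Λ)
    linarith
  have hsplit : ∑ e ∈ Aᶜ, (1 - w e) * |(D *ᵥ g) e| =
      ∑ e ∈ Aᶜ, |(D *ᵥ g) e| - ∑ e ∈ Aᶜ, w e * |(D *ᵥ g) e| := by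
    rw [← Finset.sum_sub_distrib]
    exact Finset.sum_congr rfl fun e _ => by ring
  have h1 := mul_le_mul_of_nonneg_left hTV hΛ
  have h2 := mul_le_mul_of_nonneg_left hpair hΛ
  rw [hsplit] at h2
  have h3 := hdec ε g
  nlinarith

end Deterministic

/-! ### Projections on the components of a partition -/

section Components

variable {V E K : Type*} [Fintype V] [Fintype E] [DecidableEq K] [DecidableEq E]

/-- The number of elements of the cell `k` of the partition of `V` into the fibres of `c`. -/
def cellCard (c : V → K) (k : K) : ℕ := (Finset.univ.filter fun v => c v = k).card

/-- The normalised indicator vector of the cell `k`. -/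
noncomputable def cellVec (c : V → K) (k : K) (v : V) : ℝ :=
  if c v = k then 1 / √(cellCard c k) else 0

theorem cellCard_pos (c : V → K) (v : V) : 0 < cellCard c (c v) :=
  Finset.card_pos.mpr ⟨v, by simp⟩

theorem cellVec_orthonormal (c : V → K) (hc : Function.Surjective c) (k l : K) :
    ∑ v, cellVec c k v * cellVec c l v = if k = l then 1 else 0 := by
  split_ifs with h
  · subst h
    obtain ⟨v₀, rfl⟩ := hc k
    have hpos : (0 : ℝ) < cellCard c (c v₀) := by exact_mod_cast cellCard_pos c v₀
    have h1 : ∀ v, cellVec c (c v₀) v * cellVec c (c v₀) v =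
        if c v = c v₀ then 1 / (cellCard c (c v₀) : ℝ) else 0 := by
      intro v
      unfold cellVec
      split_ifs
      · rw [div_mul_div_comm, one_mul, Real.mul_self_sqrt hpos.le]
      · simp
    simp_rw [h1]
    rw [← Finset.sum_filter, Finset.sum_const, nsmul_eq_mul]
    change (cellCard c (c v₀) : ℝ) * _ = 1
    field_simp
  · refine Finset.sum_eq_zero fun v _ => ?_
    unfold cellVec
    split_ifs with h1 h2
    · exact absurd (h1.symm.trans h2) h
    all_goals simp

/-- Bessel's inequality for a finite orthonormal family. -/
theorem bessel [Fintype K] {u : K → V → ℝ} (hu : ∀ k l, ∑ v, u k v * u l v = if k = l then 1 else 0)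
    (g : V → ℝ) : ∑ k, (∑ v, u k v * g v) ^ 2 ≤ ∑ v, g v ^ 2 := by
  set a : K → ℝ := fun k => ∑ v, u k v * g v with ha
  have h : 0 ≤ ∑ v, (g v - ∑ k, a k * u k v) ^ 2 := Finset.sum_nonneg fun v _ => sq_nonneg _
  have h1 : ∑ v, g v * ∑ k, a k * u k v = ∑ k, a k ^ 2 := by
    simp_rw [Finset.mul_sum]
    rw [Finset.sum_comm]
    refine Finset.sum_congr rfl fun k _ => ?_
    rw [sq]
    nth_rw 3 [ha]
    rw [Finset.mul_sum]
    exact Finset.sum_congr rfl fun v _ => by ring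
  have h2 : ∑ v, (∑ k, a k * u k v) ^ 2 = ∑ k, a k ^ 2 := by
    have : ∀ v, (∑ k, a k * u k v) ^ 2 = ∑ k, ∑ l, a k * a l * (u k v * u l v) := by
      intro v
      rw [sq, Finset.sum_mul_sum]
      exact Finset.sum_congr rfl fun k _ => Finset.sum_congr rfl fun l _ => by ring
    simp_rw [this]
    rw [Finset.sum_comm]
    refine Finset.sum_congr rfl fun k _ => ?_
    rw [Finset.sum_comm]
    simp_rw [← Finset.mul_sum, hu]
    simp [sq]
  have h3 : ∑ v, (g v - ∑ k, a k * u k v) ^ 2 =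
      ∑ v, g v ^ 2 - 2 * ∑ v, g v * ∑ k, a k * u k v + ∑ v, (∑ k, a k * u k v) ^ 2 := by
    rw [Finset.mul_sum, ← Finset.sum_sub_distrib, ← Finset.sum_add_distrib]
    exact Finset.sum_congr rfl fun v _ => by ring
  rw [h3, h1, h2] at h
  linarith

/-- The residual, after projection on the indicators of the cells, of the indicator of a part `a` of
the cell `k`. -/
noncomputable def residual (c : V → K) (a : V → Prop) [DecidablePred a] (k : K) (v : V) : ℝ :=
  (if a v then 1 else 0) -
    if c v = k then ((Finset.univ.filter a).card : ℝ) / cellCard c k else 0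

theorem sum_residual_sq (c : V → K) (a : V → Prop) [DecidablePred a] (k : K)
    (ha : ∀ v, a v → c v = k) (hk : 0 < cellCard c k) {x y : ℕ}
    (hx : (Finset.univ.filter a).card ≤ x)
    (hy : (Finset.univ.filter fun v => c v = k ∧ ¬ a v).card ≤ y) :
    ∑ v, residual c a k v ^ 2 ≤ (x : ℝ) * y / (x + y) := by
  set α := (Finset.univ.filter a).card
  set β := (Finset.univ.filter fun v => c v = k ∧ ¬ a v).card
  have hC : cellCard c k = α + β := by
    unfold cellCard
    rw [← Finset.card_filter_add_card_filter_not (p := a), Finset.filter_filter,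
      Finset.filter_filter]
    congr 2
    ext v
    simp only [Finset.mem_filter, Finset.mem_univ, true_and]
    exact ⟨fun h => h.2, fun h => ⟨ha v h, h⟩⟩
  have hpos : (0 : ℝ) < α + β := by exact_mod_cast hC ▸ hk
  have h1 : ∀ v, residual c a k v ^ 2 =
      (if a v then (1 - (α : ℝ) / (α + β)) ^ 2 else 0) +
        if c v = k ∧ ¬ a v then ((α : ℝ) / (α + β)) ^ 2 else 0 := by
    intro v
    unfold residual
    rw [hC]
    push_cast
    by_cases hv : a v
    · simp [hv, ha v hv, α]
    · by_cases hk : c v = k <;> simp [hv, hk, α]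
  simp_rw [h1]
  rw [Finset.sum_add_distrib, ← Finset.sum_filter, ← Finset.sum_filter, Finset.sum_const,
    Finset.sum_const, nsmul_eq_mul, nsmul_eq_mul]
  have h2 : (α : ℝ) * (1 - (α : ℝ) / (α + β)) ^ 2 + β * ((α : ℝ) / (α + β)) ^ 2 =
      α * β / (α + β) := by field_simp; ring
  change (α : ℝ) * _ + (β : ℝ) * _ ≤ _
  rw [h2]
  have hα : (α : ℝ) ≤ x := by exact_mod_cast hx
  have hβ : (β : ℝ) ≤ y := by exact_mod_cast hy
  have hα0 : (0 : ℝ) ≤ α := by positivity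
  have hβ0 : (0 : ℝ) ≤ β := by positivity
  rw [div_le_div_iff₀ hpos (by linarith)]
  nlinarith [mul_nonneg hα0 (mul_nonneg (hα0.trans hα) (sub_nonneg.mpr hβ)),
    mul_nonneg hβ0 (mul_nonneg (hβ0.trans hβ) (sub_nonneg.mpr hα))]

/-- If the increments of `g` along the edges `e` with `a e v` telescope to the increment from a
representative of the cell of `v` to `v`, then a vector splits into its projection on the
indicators of the cells and a combination of increments. -/
theorem residual_decomposition [Fintype K] (D : Matrix E V ℝ) (A : Finset E) (c : V → K)
    (hc : Function.Surjective c) (rep : K → V)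
    (a : E → V → Prop) [∀ e, DecidablePred (a e)] (k : E → K)
    (hak : ∀ e ∉ A, ∀ v, a e v → c v = k e)
    (htel : ∀ (g : V → ℝ) (v : V), (∑ e ∈ Aᶜ, if a e v then (D *ᵥ g) e else 0) =
      g v - g (rep (c v))) (x g : V → ℝ) :
    ∑ v, x v * g v =
      ∑ l, (∑ v, cellVec c l v * x v) * (∑ v, cellVec c l v * g v) +
      ∑ e ∈ Aᶜ, (∑ v, residual c (a e) (k e) v * x v) * (D *ᵥ g) e := by
  set m : K → ℝ := fun l => (∑ v, if c v = l then x v else 0) / cellCard c l with hm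
  have hcard : ∀ l, (0 : ℝ) < cellCard c l := by
    intro l
    obtain ⟨v, rfl⟩ := hc l
    exact_mod_cast cellCard_pos c v
  have h1 : ∀ e ∈ Aᶜ, ∑ v, residual c (a e) (k e) v * x v =
      ∑ v, if a e v then x v - m (c v) else 0 := by
    intro e he
    have h2 : ∀ v, (if a e v then x v - m (c v) else 0) =
        (if a e v then x v else 0) - if a e v then m (k e) else 0 := by
      intro v
      split_ifs with h
      · rw [hak e (Finset.mem_compl.mp he) v h]
      · simp
    have h3 : ∀ v, residual c (a e) (k e) v * x v = (if a e v then x v else 0) -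
        ((Finset.univ.filter (a e)).card : ℝ) / cellCard c (k e) *
          (if c v = k e then x v else 0) := by
      intro v
      unfold residual
      split_ifs <;> ring
    simp_rw [h2, h3]
    rw [Finset.sum_sub_distrib, Finset.sum_sub_distrib, ← Finset.mul_sum,
      ← Finset.sum_filter (fun v => a e v) (fun _ => m (k e)), Finset.sum_const, nsmul_eq_mul]
    simp only [hm]
    ring
  have h4 : ∑ e ∈ Aᶜ, (∑ v, residual c (a e) (k e) v * x v) * (D *ᵥ g) e =
      ∑ v, (x v - m (c v)) * (g v - g (rep (c v))) := by
    rw [Finset.sum_congr rfl fun e he => by rw [h1 e he]]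
    simp_rw [← htel, Finset.mul_sum, Finset.sum_mul]
    rw [Finset.sum_comm]
    refine Finset.sum_congr rfl fun v _ => Finset.sum_congr rfl fun e _ => ?_
    split_ifs <;> simp
  have hfib : ∀ F : V → ℝ, ∑ v, F v = ∑ l, ∑ v, if c v = l then F v else 0 := by
    intro F
    rw [Finset.sum_comm]
    exact Finset.sum_congr rfl fun v _ => by simp
  have h5 : ∑ v, (x v - m (c v)) * g (rep (c v)) = 0 := by
    rw [hfib]
    refine Finset.sum_eq_zero fun l _ => ?_
    have h6 : ∀ v, (if c v = l then (x v - m (c v)) * g (rep (c v)) else 0) =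
        ((if c v = l then x v else 0) - if c v = l then m l else 0) * g (rep l) := by
      intro v
      split_ifs with h
      · rw [h]
      · simp
    simp_rw [h6]
    rw [← Finset.sum_mul, Finset.sum_sub_distrib, ← Finset.sum_filter (fun v => c v = l)
      (fun _ => m l), Finset.sum_const, nsmul_eq_mul]
    change (_ - (cellCard c l : ℝ) * _) * _ = 0
    have := (hcard l).ne'
    simp only [hm]
    field_simp
    ring
  have h7 : ∑ l, (∑ v, cellVec c l v * x v) * (∑ v, cellVec c l v * g v) =
      ∑ v, m (c v) * g v := by
    rw [hfib fun v => m (c v) * g v]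
    refine Finset.sum_congr rfl fun l _ => ?_
    have h8 : ∀ (F : V → ℝ), ∑ v, cellVec c l v * F v =
        (∑ v, if c v = l then F v else 0) / √(cellCard c l) := by
      intro F
      rw [Finset.sum_div]
      refine Finset.sum_congr rfl fun v _ => ?_
      unfold cellVec
      split_ifs
      · ring
      · simp
    have h9 : (∑ v, if c v = l then m (c v) * g v else 0) =
        m l * ∑ v, if c v = l then g v else 0 := by
      rw [Finset.mul_sum]
      refine Finset.sum_congr rfl fun v _ => ?_
      split_ifs with h
      · rw [h]
      · simp
    rw [h8, h8, h9, div_mul_div_comm, Real.mul_self_sqrt (hcard l).le]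
    simp only [hm]
    ring
  rw [h4, h7]
  have h10 : ∑ v, (x v - m (c v)) * (g v - g (rep (c v))) =
      ∑ v, x v * g v - ∑ v, m (c v) * g v - ∑ v, (x v - m (c v)) * g (rep (c v)) := by
    rw [← Finset.sum_sub_distrib, ← Finset.sum_sub_distrib]
    exact Finset.sum_congr rfl fun v _ => by ring
  rw [h10, h5]
  ring

end Components

end BranchedPath

/-! ### Clipped linear interpolation on a path -/

namespace BranchedPath

/-- `y (B - y) / B`: the squared length of the residual of the indicator of `y` among `B` vertices
after projection on constants. -/
noncomputable def profile (B y : ℕ) : ℝ := (y : ℝ) * (B - y) / B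

theorem profile_nonneg {B y : ℕ} (h : y ≤ B) : 0 ≤ profile B y := by
  have : (y : ℝ) ≤ B := by exact_mod_cast h
  unfold profile
  exact div_nonneg (mul_nonneg (by positivity) (by linarith)) (by positivity)

theorem profile_le_quarter (B y : ℕ) : profile B y ≤ B / 4 := by
  unfold profile
  rcases Nat.eq_zero_or_pos B with rfl | hB
  · simp
  · have : (0 : ℝ) < B := by exact_mod_cast hB
    rw [div_le_div_iff₀ this (by norm_num)]
    nlinarith [sq_nonneg ((B : ℝ) - 2 * y)]

@[simp] theorem profile_zero (B : ℕ) : profile B 0 = 0 := by simp [profile]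

@[simp] theorem profile_self (B : ℕ) : profile B B = 0 := by simp [profile]

theorem profile_symm {B y : ℕ} (h : y ≤ B) : profile B (B - y) = profile B y := by
  unfold profile
  rw [Nat.cast_sub h]
  ring

theorem sq_sqrt_succ_sub_le (y : ℕ) : (√((y : ℝ) + 2) - √((y : ℝ) + 1)) ^ 2 ≤ 1 / (4 * (y + 1)) := by
  have h1 : √((y : ℝ) + 2) ^ 2 = y + 2 := Real.sq_sqrt (by positivity)
  have h2 : √((y : ℝ) + 1) ^ 2 = y + 1 := Real.sq_sqrt (by positivity)
  have h3 : √((y : ℝ) + 1) ≤ √((y : ℝ) + 2) := Real.sqrt_le_sqrt (by linarith)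
  have h4 : 0 < √((y : ℝ) + 1) := Real.sqrt_pos.mpr (by positivity)
  set p := √((y : ℝ) + 2)
  set q := √((y : ℝ) + 1)
  rw [← h2, le_div_iff₀ (by positivity)]
  have h5 : (p - q) * (p + q) = 1 := by linear_combination h1 - h2
  have h6 : (p - q) * (2 * q) ≤ 1 := by nlinarith
  have h7 : 0 ≤ (p - q) * (2 * q) := mul_nonneg (by linarith) (by linarith)
  nlinarith

theorem sum_sq_sqrt_succ_sub_le {B : ℕ} (hB : 1 ≤ B) :
    ∑ y ∈ Finset.range B, (√((y : ℝ) + 1) - √(y : ℝ)) ^ 2 ≤ 5 / 4 + Real.log B / 4 := by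
  have key : ∀ N : ℕ, ∑ y ∈ Finset.range (N + 1), (√((y : ℝ) + 1) - √(y : ℝ)) ^ 2 ≤
      1 + ((harmonic N : ℚ) : ℝ) / 4 := by
    intro N
    induction N with
    | zero => simp
    | succ N ih =>
      rw [Finset.sum_range_succ, harmonic_succ]
      have h := sq_sqrt_succ_sub_le N
      push_cast
      have h2 : (N : ℝ) + 1 + 1 = N + 2 := by ring
      rw [h2]
      have h3 : (1 : ℝ) / (4 * (N + 1)) = ((N : ℝ) + 1)⁻¹ / 4 := by field_simp
      linarith
  obtain ⟨N, rfl⟩ := Nat.exists_eq_add_of_le' hB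
  have h1 := harmonic_le_one_add_log N
  have h2 : Real.log N ≤ Real.log ((N + 1 : ℕ) : ℝ) := by
    rcases Nat.eq_zero_or_pos N with rfl | hN
    · simp
    · exact Real.log_le_log (by exact_mod_cast hN) (by push_cast; linarith)
  linarith [key N]

/-- On its increasing part the profile has smaller square root increments than the identity. -/
theorem sqrt_profile_succ_sub {B y : ℕ} (h : 2 * y + 1 ≤ B) :
    0 ≤ √(profile B (y + 1)) - √(profile B y) ∧
      √(profile B (y + 1)) - √(profile B y) ≤ √((y : ℝ) + 1) - √(y : ℝ) := by
  have hB : (0 : ℝ) < B := by exact_mod_cast (by omega : 0 < B)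
  have hyB : 2 * (y : ℝ) + 1 ≤ B := by exact_mod_cast h
  constructor
  · refine sub_nonneg.mpr (Real.sqrt_le_sqrt ?_)
    unfold profile
    refine div_le_div_of_nonneg_right ?_ hB.le
    push_cast
    nlinarith
  · -- both square roots carry the decreasing factor `√(1 - y / B) ≤ 1`
    have e1 : profile B (y + 1) = ((y : ℝ) + 1) * ((B - (y + 1)) / B) := by
      unfold profile; push_cast; ring
    have e2 : profile B y = (y : ℝ) * ((B - y) / B) := by unfold profile; ring
    rw [e1, e2, Real.sqrt_mul (by positivity), Real.sqrt_mul (by positivity)]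
    have h1 : √(((B : ℝ) - (y + 1)) / B) ≤ √(((B : ℝ) - y) / B) :=
      Real.sqrt_le_sqrt (div_le_div_of_nonneg_right (by linarith) hB.le)
    have h2 : √(((B : ℝ) - y) / B) ≤ 1 := by
      refine Real.sqrt_le_one.mpr ((div_le_one hB).mpr ?_)
      have : (0 : ℝ) ≤ y := by positivity
      linarith
    have h3 : √(y : ℝ) ≤ √((y : ℝ) + 1) := Real.sqrt_le_sqrt (by linarith)
    have h4 : 0 ≤ √((y : ℝ) + 1) := Real.sqrt_nonneg _
    nlinarith

/-- The profile is symmetric, and on its increasing half `sqrt_profile_succ_sub` compares it with the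
identity, so the sum is at most twice the sum of the squared increments of the square root. -/
theorem sum_sq_sqrt_profile_le {B m : ℕ} (hB : 1 ≤ B) (hm : m ≤ B) :
    ∑ y ∈ Finset.range m, (√(profile B (y + 1)) - √(profile B y)) ^ 2 ≤
      5 / 2 + Real.log B / 2 := by
  set F : ℕ → ℝ := fun y => (√((y : ℝ) + 1) - √(y : ℝ)) ^ 2 with hF
  have hF0 : ∀ y, 0 ≤ F y := fun y => sq_nonneg _
  have hterm : ∀ y ∈ Finset.range B,
      (√(profile B (y + 1)) - √(profile B y)) ^ 2 ≤ F y + F (B - 1 - y) := by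
    intro y hy
    have hyB := Finset.mem_range.mp hy
    rcases le_or_gt (2 * y + 1) B with h | h
    · obtain ⟨h1, h2⟩ := sqrt_profile_succ_sub h
      have := pow_le_pow_left₀ h1 h2 2
      simp only [hF] at *
      linarith [hF0 (B - 1 - y)]
    · obtain ⟨h1, h2⟩ := sqrt_profile_succ_sub (B := B) (y := B - 1 - y) (by omega)
      have e1 : profile B (B - 1 - y + 1) = profile B y := by
        rw [← profile_symm (by omega : y ≤ B)]; congr 1; omega
      have e2 : profile B (B - 1 - y) = profile B (y + 1) := by
        rw [← profile_symm (by omega : y + 1 ≤ B)]; congr 1; omega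
      rw [e1, e2] at h1 h2
      have := pow_le_pow_left₀ h1 h2 2
      have h3 : (√(profile B (y + 1)) - √(profile B y)) ^ 2 =
          (√(profile B y) - √(profile B (y + 1))) ^ 2 := by ring
      simp only [hF] at *
      linarith [hF0 y]
  calc ∑ y ∈ Finset.range m, (√(profile B (y + 1)) - √(profile B y)) ^ 2
      ≤ ∑ y ∈ Finset.range B, (√(profile B (y + 1)) - √(profile B y)) ^ 2 :=
        Finset.sum_le_sum_of_subset_of_nonneg (Finset.range_mono hm) fun _ _ _ => sq_nonneg _
    _ ≤ ∑ y ∈ Finset.range B, (F y + F (B - 1 - y)) := Finset.sum_le_sum hterm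
    _ = 2 * ∑ y ∈ Finset.range B, F y := by
        rw [Finset.sum_add_distrib, Finset.sum_range_reflect]; ring
    _ ≤ _ := by
        have := sum_sq_sqrt_succ_sub_le hB
        simp only [hF]
        linarith

/-- The logarithm in the energy of the profile is replaced by its tangent at `a`. -/
theorem sum_sq_sqrt_profile_le_linear {B m : ℕ} (hB : 1 ≤ B) (hm : m ≤ B) {a : ℝ} (ha : 0 < a) :
    ∑ y ∈ Finset.range m, (√(profile B (y + 1)) - √(profile B y)) ^ 2 ≤
      2 + Real.log a / 2 + B / (2 * a) := by
  have h := sum_sq_sqrt_profile_le hB hm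
  have hB0 : (0 : ℝ) < B := by exact_mod_cast hB
  have h1 := Real.log_le_sub_one_of_pos (div_pos hB0 ha)
  rw [Real.log_div hB0.ne' ha.ne'] at h1
  have h2 : (B : ℝ) / (2 * a) = B / a / 2 := by field_simp
  linarith

/-- Truncation of `x` to the interval `[-v, v]`. -/
noncomputable def clip (v x : ℝ) : ℝ := max (-v) (min v x)

theorem abs_clip_le {v : ℝ} (hv : 0 ≤ v) (x : ℝ) : |clip v x| ≤ v :=
  abs_le.mpr ⟨le_max_left _ _, max_le (by linarith) (min_le_left _ _)⟩

theorem clip_of_abs_le {v x : ℝ} (h : |x| ≤ v) : clip v x = x := by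
  obtain ⟨h1, h2⟩ := abs_le.mp h
  rw [clip, min_eq_right h2, max_eq_right h1]

theorem clip_of_le {v x : ℝ} (hv : 0 ≤ v) (h : v ≤ x) : clip v x = v := by
  rw [clip, min_eq_left h, max_eq_right (by linarith)]

theorem clip_neg {v : ℝ} (hv : 0 ≤ v) (x : ℝ) : clip v (-x) = -clip v x := by
  unfold clip
  rcases le_total v x with h | h <;> rcases le_total (-v) x with h' | h' <;>
    simp only [min_def, max_def] <;> split_ifs <;> linarith

/-- An increment of a truncated sequence is at most the larger one of the increments of the sequence
and of the bound. -/
theorem sq_clip_sub_clip_le (v v' x x' : ℝ) :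
    (clip v x - clip v' x') ^ 2 ≤ (x - x') ^ 2 + (v - v') ^ 2 := by
  have h : |clip v x - clip v' x'| ≤ max |v - v'| |x - x'| := by
    refine (abs_max_sub_max_le_max _ _ _ _).trans (max_le ?_ (abs_min_sub_min_le_max _ _ _ _))
    rw [← abs_neg (v - v')]
    exact le_trans (le_of_eq (by ring_nf)) (le_max_left _ _)
  rw [← sq_abs, ← sq_abs (x - x'), ← sq_abs (v - v')]
  have h0 := abs_nonneg (clip v x - clip v' x')
  rcases max_cases |v - v'| |x - x'| with ⟨h1, _⟩ | ⟨h1, _⟩ <;> rw [h1] at h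
  · nlinarith [pow_le_pow_left₀ h0 h 2, sq_nonneg |x - x'|]
  · nlinarith [pow_le_pow_left₀ h0 h 2, sq_nonneg |v - v'|]

/-- The largest admissible absolute value of an interpolating vector at an edge that splits a
component of `B` vertices into `y` and `B - y` vertices. -/
noncomputable def margin (n : ℕ) (γ : ℝ) (B y : ℕ) : ℝ := 1 - √(profile B y / n) / γ

theorem margin_le_one {n B y : ℕ} {γ : ℝ} (hγ : 1 < γ) : margin n γ B y ≤ 1 := by
  unfold margin
  have : 0 ≤ √(profile B y / n) / γ := by positivity
  linarith

theorem sqrt_profile_div_le_half {n B : ℕ} (hn : 0 < n) (hBn : B ≤ n) (y : ℕ) :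
    √(profile B y / n) ≤ 1 / 2 := by
  have hn' : (0 : ℝ) < n := by exact_mod_cast hn
  have hBn' : (B : ℝ) ≤ n := by exact_mod_cast hBn
  rw [Real.sqrt_le_left (by norm_num), div_le_iff₀ hn']
  linarith [profile_le_quarter B y]

theorem half_le_margin {n B : ℕ} {γ : ℝ} (hγ : 1 < γ) (hn : 0 < n) (hBn : B ≤ n) (y : ℕ) :
    1 / 2 ≤ margin n γ B y := by
  have h := sqrt_profile_div_le_half hn hBn y
  have h2 : √(profile B y / n) / γ ≤ √(profile B y / n) :=
    div_le_self (Real.sqrt_nonneg _) hγ.le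
  unfold margin
  linarith

@[simp] theorem margin_zero (n : ℕ) (γ : ℝ) (B : ℕ) : margin n γ B 0 = 1 := by simp [margin]

@[simp] theorem margin_self (n : ℕ) (γ : ℝ) (B : ℕ) : margin n γ B B = 1 := by simp [margin]

/-- The linear interpolation from `z` to `p` in `m` steps, truncated to the admissible values along
a component of `B` vertices. -/
noncomputable def seg (n : ℕ) (γ : ℝ) (B m : ℕ) (z p : ℝ) (y : ℕ) : ℝ :=
  clip (margin n γ B y) (z + (p - z) * (y / m))

theorem abs_seg_le {n B : ℕ} {γ : ℝ} (hγ : 1 < γ) (hn : 0 < n) (hBn : B ≤ n) (m : ℕ) (z p : ℝ)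
    (y : ℕ) : |seg n γ B m z p y| ≤ margin n γ B y :=
  abs_clip_le (by linarith [half_le_margin hγ hn hBn y]) _

theorem seg_zero {n B m : ℕ} {γ z p : ℝ} (hz : |z| ≤ 1) : seg n γ B m z p 0 = z := by
  unfold seg
  simp only [margin_zero, Nat.cast_zero, zero_div, mul_zero, add_zero]
  exact clip_of_abs_le hz

theorem seg_end {n B m : ℕ} {γ z p : ℝ} (h : m = 0 → p = z) :
    seg n γ B m z p m = clip (margin n γ B m) p := by
  unfold seg
  rcases Nat.eq_zero_or_pos m with rfl | hm
  · simp [h rfl]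
  · have : (m : ℝ) ≠ 0 := by exact_mod_cast hm.ne'
    rw [div_self this]
    ring_nf

theorem seg_self {n B : ℕ} {γ z p : ℝ} (hB : 1 ≤ B) (hp : |p| ≤ 1) :
    seg n γ B B z p B = p := by
  rw [seg_end (by omega), margin_self]
  exact clip_of_abs_le hp

theorem sum_sq_seg_le {n B m : ℕ} {γ a : ℝ} (hγ : 1 < γ) (hB : 1 ≤ B)
    (hm : m ≤ B) (ha : 0 < a) (z p : ℝ) :
    ∑ y ∈ Finset.range m, (seg n γ B m z p (y + 1) - seg n γ B m z p y) ^ 2 ≤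
      (p - z) ^ 2 / m + (2 + Real.log a / 2 + B / (2 * a)) / (n * γ ^ 2) := by
  have hγ0 : γ ≠ 0 := by linarith
  have h1 : ∀ y ∈ Finset.range m, (seg n γ B m z p (y + 1) - seg n γ B m z p y) ^ 2 ≤
      ((p - z) / m) ^ 2 +
        (√(profile B (y + 1)) - √(profile B y)) ^ 2 / (n * γ ^ 2) := by
    intro y hy
    have hm' : (m : ℝ) ≠ 0 := by
      have := Finset.mem_range.mp hy
      exact_mod_cast (by omega : m ≠ 0)
    refine (sq_clip_sub_clip_le _ _ _ _).trans (le_of_eq ?_)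
    congr 1
    · congr 1; push_cast; field_simp; ring
    · have h2 : margin n γ B (y + 1) - margin n γ B y =
          -((√(profile B (y + 1)) - √(profile B y)) / (√n * γ)) := by
        unfold margin
        rw [Real.sqrt_div' _ (by positivity), Real.sqrt_div' _ (by positivity), ← div_div,
          sub_div, sub_div]
        ring
      rw [h2, neg_sq, div_pow, mul_pow, Real.sq_sqrt (by positivity)]
  refine (Finset.sum_le_sum h1).trans ?_
  rw [Finset.sum_add_distrib, ← Finset.sum_div, Finset.sum_const, Finset.card_range, nsmul_eq_mul]
  refine add_le_add (le_of_eq ?_)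
    (div_le_div_of_nonneg_right (sum_sq_sqrt_profile_le_linear hB hm ha) (by positivity))
  rcases Nat.eq_zero_or_pos m with rfl | hm0
  · simp
  · have : (m : ℝ) ≠ 0 := by exact_mod_cast hm0.ne'
    field_simp

end BranchedPath

/-! ### The values around the branching point -/

namespace BranchedPath

/-- Of the three legs that meet at the branching point, leg `i` sends its unit of flow to the legs
`j` and `l`, in the proportion `1 - α` to `α`. The value that leg `j` receives is admissible for
one of the two proportions used, because `w_j² ≤ w_i² + (1 + a_l) / n` and `w_j ≤ 1 / 2`, where
`w²` stands for `profile / n`. -/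
theorem exists_branching_ratio {n B ai aj al : ℕ} {γ : ℝ} (hγ : 1 < γ) (hn : 18 ≤ n)
    (hB : B = ai + 1 + aj + al) (hBn : B ≤ n) (hal : 0 < al) (haj : 0 < aj) :
    ∃ α : ℝ, 0 ≤ α ∧ α ≤ 1 / 2 ∧ (1 - α) * margin n γ B ai ≤ margin n γ B aj ∧
      (2 - α) ^ 2 / aj + (1 + α) ^ 2 / al ≤ 11 / 2 / aj + 2 / (al : ℝ) := by
  have hn0 : 0 < n := by omega
  have hnR : (18 : ℝ) ≤ n := by exact_mod_cast hn
  have halR : (0 : ℝ) < al := by exact_mod_cast hal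
  have hajR : (0 : ℝ) < aj := by exact_mod_cast haj
  by_cases h13 : aj ≤ 13 * al
  · refine ⟨1 / 2, by norm_num, le_refl _, ?_, ?_⟩
    · have h1 := half_le_margin hγ hn0 hBn aj
      have h2 := margin_le_one (n := n) (B := B) (y := ai) hγ
      linarith
    · have h13R : (aj : ℝ) ≤ 13 * al := by exact_mod_cast h13
      have h3 : 1 / 4 / (al : ℝ) ≤ 13 / 4 / aj := by
        rw [div_le_div_iff₀ halR hajR]; linarith
      have e1 : (2 - 1 / 2 : ℝ) ^ 2 / aj = 9 / 4 / aj := by norm_num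
      have e2 : (1 + 1 / 2 : ℝ) ^ 2 / al = 2 / (al : ℝ) + 1 / 4 / al := by rw [← add_div]; norm_num
      have e3 : (11 / 2 : ℝ) / aj = 9 / 4 / aj + 13 / 4 / aj := by rw [← add_div]; norm_num
      rw [e1, e2, e3]
      linarith
  · refine ⟨2 / 5, by norm_num, by norm_num, ?_, ?_⟩
    · set wi := √(profile B ai / n) with hwi
      set wj := √(profile B aj / n) with hwj
      have hwj2 : wj ≤ 1 / 2 := sqrt_profile_div_le_half hn0 hBn aj
      have hwi0 : 0 ≤ wi := Real.sqrt_nonneg _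
      -- both sides are affine in `1 / γ`, so the case `γ = 1` suffices
      have hkey : 3 / 5 * (1 - wi) ≤ 1 - wj := by
        rcases le_or_gt (1 / 6) wi with h | h
        · linarith
        · have hwi2 : wi ^ 2 = profile B ai / n :=
            Real.sq_sqrt (div_nonneg (profile_nonneg (by omega)) (by positivity))
          have hwj3 : wj ^ 2 = profile B aj / n :=
            Real.sq_sqrt (div_nonneg (profile_nonneg (by omega)) (by positivity))
          have hBR : (B : ℝ) = ai + 1 + aj + al := by rw [hB]; push_cast; ring
          have hB0 : (0 : ℝ) < B := by rw [hBR]; positivity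
          have hle : profile B aj ≤ profile B ai + (1 + al) := by
            unfold profile
            rw [div_add' _ _ _ hB0.ne', div_le_div_iff_of_pos_right hB0, hBR]
            have : (0 : ℝ) ≤ ai := by positivity
            nlinarith [mul_nonneg this halR.le]
          have hsmall : (1 + (al : ℝ)) / n ≤ 1 / 18 + 1 / 14 := by
            have h14 : 14 * al ≤ n := by omega
            have h14R : 14 * (al : ℝ) ≤ n := by exact_mod_cast h14
            rw [div_le_iff₀ (by linarith)]
            linarith
          have hwj4 : wj ^ 2 ≤ wi ^ 2 + (1 + al) / n := by
            rw [hwi2, hwj3, ← add_div]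
            exact div_le_div_of_nonneg_right hle (by positivity)
          have hwj5 : wj ≤ 2 / 5 := by
            by_contra hcon
            push Not at hcon
            nlinarith
          linarith
      have hγ1 : 1 / γ ≤ 1 := by rw [div_le_one (by linarith)]; exact hγ.le
      have hγ0 : 0 < 1 / γ := by positivity
      unfold margin
      rw [← hwi, ← hwj, div_eq_mul_one_div wi, div_eq_mul_one_div wj]
      nlinarith
    · have e1 : (2 - 2 / 5 : ℝ) ^ 2 / aj ≤ 11 / 2 / aj :=
        div_le_div_of_nonneg_right (by norm_num) hajR.le
      have e2 : (1 + 2 / 5 : ℝ) ^ 2 / al ≤ 2 / (al : ℝ) :=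
        div_le_div_of_nonneg_right (by norm_num) halR.le
      linarith

/-- The values at the branching point for the orientation in which the active edge of leg `i` has
the sign `1`. If the path through the branching point leaves it by at most `a_i + 1` vertices, the
linear interpolation along that path is admissible. Otherwise leg `i` keeps the largest admissible
values and its flow is divided between the other two legs. -/
theorem exists_star_values_aux {n B ai aj al k : ℕ} {γ : ℝ} (hγ : 1 < γ) (hn : 18 ≤ n)
    (hB : B = ai + 1 + aj + al) (hBn : B ≤ n) (hal : 2 ≤ al) (hk : k + 2 ≤ aj) :
    ∃ pi pj pl : ℝ, (0 ≤ pi ∧ pi ≤ 1) ∧ (0 ≤ pj ∧ pj ≤ 1) ∧ (0 ≤ pl ∧ pl ≤ 1) ∧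
      (ai = 0 → pi = 1) ∧
      (1 - pi) ^ 2 / ai + (1 + pj) ^ 2 / aj + (1 + pl) ^ 2 / al +
        (clip (margin n γ B ai) pi - clip (margin n γ B aj) pj - clip (margin n γ B al) pl) ^ 2 ≤
      2 * (1 / ((ai : ℝ) + 1 + k) + 1 / ((aj : ℝ) - k) + 1 / al) := by
  have hn0 : 0 < n := by omega
  have halR : (2 : ℝ) ≤ al := by exact_mod_cast hal
  have hkR : (k : ℝ) + 2 ≤ aj := by exact_mod_cast hk
  have hk0 : (0 : ℝ) ≤ k := by positivity
  have hai0 : (0 : ℝ) ≤ ai := by positivity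
  have hvi := half_le_margin hγ hn0 hBn ai
  have hvj := half_le_margin hγ hn0 hBn aj
  have hvl := half_le_margin hγ hn0 hBn al
  have hvi1 := margin_le_one (n := n) (B := B) (y := ai) hγ
  by_cases hcase : k ≤ ai + 1
  · have hcR : (k : ℝ) ≤ ai + 1 := by exact_mod_cast hcase
    set d : ℝ := (ai : ℝ) + 1 + k with hd
    have hd0 : 0 < d := by positivity
    have hpi1 : ((k : ℝ) + 1) / d ≤ 1 := by rw [div_le_one hd0]; linarith
    have hpj : (k : ℝ) / d ≤ 1 / 2 := by rw [div_le_div_iff₀ hd0 (by norm_num)]; linarith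
    have hpj0 : 0 ≤ (k : ℝ) / d := by positivity
    refine ⟨(k + 1) / d, k / d, 0, ⟨by positivity, hpi1⟩, ⟨hpj0, by linarith⟩,
      ⟨le_refl _, zero_le_one⟩, ?_, ?_⟩
    · intro h0
      rw [hd, h0, div_eq_one_iff_eq (by positivity)]
      push_cast; ring
    · have e1 : (1 - ((k : ℝ) + 1) / d) ^ 2 / ai = ai / d ^ 2 := by
        have : 1 - ((k : ℝ) + 1) / d = ai / d := by
          rw [eq_div_iff hd0.ne', sub_mul, div_mul_cancel₀ _ hd0.ne', hd]; ring
        rw [this, div_pow]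
        rcases Nat.eq_zero_or_pos ai with h | h
        · simp [h]
        · have : (ai : ℝ) ≠ 0 := by exact_mod_cast h.ne'
          field_simp
      have e2 : (1 + (k : ℝ) / d) ^ 2 / aj ≤ 1 / ((aj : ℝ) - k) + k / d ^ 2 := by
        set s : ℝ := (aj : ℝ) - k with hs
        have hs0 : 0 < s := by linarith
        have haj : (aj : ℝ) = s + k := by rw [hs]; ring
        rw [haj, div_add_div _ _ hs0.ne' (by positivity), div_le_div_iff₀ (by positivity)
          (by positivity)]
        have : 1 + (k : ℝ) / d = (d + k) / d := by field_simp
        rw [this, div_pow, div_mul_eq_mul_div, div_le_iff₀ (by positivity)]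
        have h2 : (1 * d ^ 2 + s * k) * (s + k) * d ^ 2 - (d + k) ^ 2 * (s * d ^ 2) =
            d ^ 2 * (k * (d - s) ^ 2) := by ring
        have h3 : 0 ≤ d ^ 2 * ((k : ℝ) * (d - s) ^ 2) := by positivity
        linarith
      have hclipj : clip (margin n γ B aj) ((k : ℝ) / d) = k / d :=
        clip_of_abs_le (by rw [abs_of_nonneg hpj0]; linarith)
      have hclipl : clip (margin n γ B al) 0 = 0 := clip_of_abs_le (by simp; linarith)
      have e3 : (clip (margin n γ B ai) ((k + 1) / d) - k / d - 0) ^ 2 ≤ 1 / d ^ 2 := by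
        have hstep : ((k : ℝ) + 1) / d = k / d + 1 / d := by rw [add_div]
        have h1d : 0 < 1 / d := by positivity
        have hlow : (k : ℝ) / d ≤ clip (margin n γ B ai) ((k + 1) / d) :=
          le_max_of_le_right (le_min (by linarith) (by linarith))
        have hup : clip (margin n γ B ai) ((k + 1) / d) ≤ (k + 1) / d :=
          max_le (by linarith) (min_le_right _ _)
        rw [sub_zero, ← one_div_pow]
        exact pow_le_pow_left₀ (by linarith) (by linarith) 2
      rw [hclipj, hclipl, e1]
      have e4 : (ai : ℝ) / d ^ 2 + k / d ^ 2 + 1 / d ^ 2 = 1 / d := by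
        rw [← add_div, ← add_div, div_eq_div_iff (by positivity) hd0.ne', hd]; ring
      have e5 : (1 + (0 : ℝ)) ^ 2 / al = 1 / al := by norm_num
      rw [e5]
      have h1 : 0 < 1 / d := by positivity
      have h2 : 0 < 1 / ((aj : ℝ) - k) := one_div_pos.mpr (by linarith)
      have h3 : 0 < 1 / (al : ℝ) := one_div_pos.mpr (by linarith)
      linarith
  · push Not at hcase
    have hcR : (ai : ℝ) + 2 ≤ k := by exact_mod_cast hcase
    obtain ⟨α, hα0, hα1, hαv, hαc⟩ := exists_branching_ratio (ai := ai) (aj := aj) (al := al)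
      hγ hn hB hBn (by omega) (by omega)
    set c := margin n γ B ai with hc
    have hj0 : 0 ≤ (1 - α) * c := mul_nonneg (by linarith) (by linarith)
    have hl0 : 0 ≤ α * c := mul_nonneg hα0 (by linarith)
    have hj1 : (1 - α) * c ≤ 1 - α := mul_le_of_le_one_right (by linarith) hvi1
    have hl1 : α * c ≤ α := mul_le_of_le_one_right hα0 hvi1
    refine ⟨1, (1 - α) * c, α * c, ⟨zero_le_one, le_refl _⟩, ⟨hj0, by linarith⟩,
      ⟨hl0, by linarith⟩, fun _ => rfl, ?_⟩
    rw [clip_of_le (by linarith) hvi1, clip_of_abs_le (by rw [abs_of_nonneg hj0]; exact hαv),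
      clip_of_abs_le (by rw [abs_of_nonneg hl0]; linarith)]
    have haj0 : (0 : ℝ) < aj := by linarith
    have hal0 : (0 : ℝ) < al := by linarith
    have e1 : (1 + (1 - α) * c) ^ 2 / aj ≤ (2 - α) ^ 2 / aj :=
      div_le_div_of_nonneg_right (pow_le_pow_left₀ (by linarith) (by linarith) 2) haj0.le
    have e2 : (1 + α * c) ^ 2 / al ≤ (1 + α) ^ 2 / al :=
      div_le_div_of_nonneg_right (pow_le_pow_left₀ (by linarith) (by linarith) 2) hal0.le
    have e3 : 1 / (2 * (k : ℝ)) ≤ 1 / ((ai : ℝ) + 1 + k) :=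
      one_div_le_one_div_of_le (by linarith) (by linarith)
    have e4 : 11 / 4 / (aj : ℝ) ≤ 1 / (2 * (k : ℝ)) + 1 / ((aj : ℝ) - k) := by
      have h1 : 0 < (aj : ℝ) - k := by linarith
      have h2 : 0 < 2 * (k : ℝ) := by linarith
      rw [div_add_div _ _ h2.ne' h1.ne', div_le_div_iff₀ haj0 (by positivity)]
      nlinarith [sq_nonneg ((aj : ℝ) - 9 / 4 * k), sq_nonneg (k : ℝ)]
    have e5 : (1 - (1 : ℝ)) ^ 2 / ai = 0 := by simp
    have e6 : (c - (1 - α) * c - α * c) ^ 2 = 0 := by ring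
    have e7 : 11 / 2 / (aj : ℝ) = 2 * (11 / 4 / aj) := by ring
    have e8 : 2 / (al : ℝ) = 2 * (1 / al) := by ring
    rw [e5, e6]
    linarith

theorem sum_fin_three_of_ne (f : Fin 3 → ℝ) {i j l : Fin 3} (hij : i ≠ j) (hil : i ≠ l)
    (hjl : j ≠ l) : ∑ m, f m = f i + f j + f l := by
  rw [Fin.sum_univ_three]
  fin_cases i <;> fin_cases j <;> fin_cases l <;> simp at hij hil hjl ⊢ <;> ring

/-- Values `p` of an interpolating vector on the three edges at the branching point, oriented
towards it, for given signs `z` on the active edges at the far ends of the legs `a`. The energy of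
the linear interpolations along the legs and the divergence at the branching point are together at
most twice the energy of the decomposition into three paths. -/
theorem exists_star_values {n B : ℕ} {a d : Fin 3 → ℕ} {γ : ℝ} (hγ : 1 < γ) (hn : 18 ≤ n)
    (hB : B = 1 + (a 0 + a 1 + a 2)) (hBn : B ≤ n) (hd : ∀ i, 2 ≤ d i)
    (hsplit : ∃ i j l : Fin 3, i ≠ j ∧ i ≠ l ∧ j ≠ l ∧ ∃ k : ℕ, k ≤ a j ∧
      d i = a i + 1 + k ∧ d j = a j - k ∧ d l = a l)
    (z : Fin 3 → ℝ) (hz : ∀ m, |z m| = 1) :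
    ∃ p : Fin 3 → ℝ, (∀ m, |p m| ≤ 1) ∧ (∀ m, a m = 0 → p m = z m) ∧
      ∑ m, (p m - z m) ^ 2 / a m + (∑ m, clip (margin n γ B (a m)) (p m)) ^ 2 ≤
        2 * ∑ m, 1 / (d m : ℝ) := by
  obtain ⟨i, j, l, hij, hil, hjl, k, hkj, hdi, hdj, hdl⟩ := hsplit
  have h2j := hd j
  have h2l := hd l
  have hsum : a 0 + a 1 + a 2 = a i + a j + a l := by
    have h := sum_fin_three_of_ne (fun m => (a m : ℝ)) hij hil hjl
    rw [Fin.sum_univ_three] at h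
    exact_mod_cast h
  obtain ⟨pi, pj, pl, ⟨hi0, hi1⟩, ⟨hj0, hj1⟩, ⟨hl0, hl1⟩, hi, hcost⟩ :=
    exists_star_values_aux (ai := a i) (aj := a j) (al := a l) (k := k) (B := B) hγ hn
      (by omega) hBn (by omega) (by omega)
  have hn0 : 0 < n := by omega
  have hzz : z i ^ 2 = 1 := by rw [← sq_abs, hz]; norm_num
  set p : Fin 3 → ℝ := fun m => if m = i then z i * pi else if m = j then -(z i * pj)
    else -(z i * pl) with hp
  have hpi : p i = z i * pi := by simp [hp]
  have hpj : p j = -(z i * pj) := by simp [hp, hij.symm]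
  have hpl : p l = -(z i * pl) := by simp [hp, hil.symm, hjl.symm]
  have hclip : ∀ (y : ℕ) (x : ℝ), clip (margin n γ B y) (z i * x) =
      z i * clip (margin n γ B y) x := by
    intro y x
    have hv := half_le_margin hγ hn0 hBn y
    rcases (abs_eq zero_le_one).mp (hz i) with h | h
    · rw [h, one_mul, one_mul]
    · rw [h, neg_one_mul, neg_one_mul, clip_neg (by linarith)]
  have hclipn : ∀ (y : ℕ) (x : ℝ), clip (margin n γ B y) (-(z i * x)) =
      -(z i * clip (margin n γ B y) x) := by
    intro y x
    rw [clip_neg (by linarith [half_le_margin hγ hn0 hBn y]), hclip]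
  -- an adverse sign at the far end costs at most `(1 + x)²`
  have hadv : ∀ (m : Fin 3) (x : ℝ), 0 ≤ x → (-(z i * x) - z m) ^ 2 ≤ (1 + x) ^ 2 := by
    intro m x hx
    rw [← sq_abs]
    refine pow_le_pow_left₀ (abs_nonneg _) ((abs_sub _ _).trans ?_) 2
    rw [abs_neg, abs_mul, hz, hz, abs_of_nonneg hx]
    linarith
  refine ⟨p, fun m => ?_, fun m hm => ?_, ?_⟩
  · simp only [hp]
    split_ifs
    · rw [abs_mul, hz, one_mul, abs_of_nonneg hi0]; exact hi1
    · rw [abs_neg, abs_mul, hz, one_mul, abs_of_nonneg hj0]; exact hj1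
    · rw [abs_neg, abs_mul, hz, one_mul, abs_of_nonneg hl0]; exact hl1
  · have hmi : m = i := by
      have hcov : m = i ∨ m = j ∨ m = l := by omega
      rcases hcov with h | h | h
      · exact h
      · rw [h] at hm; omega
      · rw [h] at hm; omega
    subst hmi
    rw [hpi, hi hm, mul_one]
  · rw [sum_fin_three_of_ne _ hij hil hjl, sum_fin_three_of_ne _ hij hil hjl,
      sum_fin_three_of_ne _ hij hil hjl, hpi, hpj, hpl, hclip, hclipn, hclipn, hdi, hdj, hdl,
      Nat.cast_sub hkj]
    have e1 : (z i * pi - z i) ^ 2 / (a i : ℝ) = (1 - pi) ^ 2 / a i := by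
      congr 1; linear_combination (1 - pi) ^ 2 * hzz
    have e2 : (-(z i * pj) - z j) ^ 2 / (a j : ℝ) ≤ (1 + pj) ^ 2 / a j :=
      div_le_div_of_nonneg_right (hadv j pj hj0) (by positivity)
    have e3 : (-(z i * pl) - z l) ^ 2 / (a l : ℝ) ≤ (1 + pl) ^ 2 / a l :=
      div_le_div_of_nonneg_right (hadv l pl hl0) (by positivity)
    set ci := clip (margin n γ B (a i)) pi
    set cj := clip (margin n γ B (a j)) pj
    set cl := clip (margin n γ B (a l)) pl
    have e4 : (z i * ci + -(z i * cj) + -(z i * cl)) ^ 2 = (ci - cj - cl) ^ 2 := by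
      linear_combination (ci - cj - cl) ^ 2 * hzz
    rw [e1, e4]
    push_cast
    linarith

end BranchedPath

/-! ### Interpolation between consecutive active edges -/

namespace BranchedPath

/-- The truncated linear interpolation of the values `z` between the consecutive positions of a
list. -/
noncomputable def chain (n : ℕ) (γ : ℝ) : List ℕ → (ℕ → ℝ) → ℕ → ℝ
  | x :: y :: l, z, v =>
      if v < y then seg n γ (y - x) (y - x) (z x) (z y) (v - x) else chain n γ (y :: l) z v
  | [_], z, v => z v
  | [], z, v => z v

/-- The energy of the linear interpolation of `z` between the consecutive positions of a list. -/
noncomputable def chainEnergy : List ℕ → (ℕ → ℝ) → ℝ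
  | x :: y :: l, z => (z y - z x) ^ 2 / ((y - x : ℕ) : ℝ) + chainEnergy (y :: l) z
  | [_], _ => 0
  | [], _ => 0

/-- The differences of consecutive entries. -/
def listGaps (l : List ℕ) : List ℕ := List.zipWith (fun x y => y - x) l l.tail

theorem listGaps_cons_cons (x y : ℕ) (l : List ℕ) :
    listGaps (x :: y :: l) = (y - x) :: listGaps (y :: l) := by
  simp [listGaps]

theorem chain_eq_of_mem {n : ℕ} {γ : ℝ} {z : ℕ → ℝ} {l : List ℕ} (hl : l.Pairwise (· < ·))
    (hz : ∀ t ∈ l, |z t| ≤ 1) {v : ℕ} (hv : v ∈ l) : chain n γ l z v = z v := by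
  induction l with
  | nil => simp at hv
  | cons x l ih =>
    cases l with
    | nil => rfl
    | cons y l =>
      rw [chain]
      split_ifs with h
      · have hvx : v = x := by
          rcases List.mem_cons.mp hv with h' | h'
          · exact h'
          · exfalso
            rcases List.mem_cons.mp h' with h'' | h''
            · omega
            · have := (List.pairwise_cons.mp (List.pairwise_cons.mp hl).2).1 v h''
              omega
        subst hvx
        rw [Nat.sub_self]
        exact seg_zero (hz v hv)
      · have hxy := (List.pairwise_cons.mp hl).1 y (by simp)
        refine ih (List.pairwise_cons.mp hl).2 (fun t ht => hz t (List.mem_cons_of_mem _ ht)) ?_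
        rcases List.mem_cons.mp hv with h' | h'
        · omega
        · exact h'

theorem chain_eq_seg {n : ℕ} {γ : ℝ} {z : ℕ → ℝ} {l : List ℕ} (hl : l.Pairwise (· < ·))
    {x y v : ℕ} (hx : x ∈ l) (hy : y ∈ l) (hxv : x ≤ v) (hvy : v < y)
    (hno : ∀ t ∈ l, x < t → y ≤ t) :
    chain n γ l z v = seg n γ (y - x) (y - x) (z x) (z y) (v - x) := by
  induction l with
  | nil => simp at hx
  | cons x₀ l ih =>
    cases l with
    | nil => simp at hx hy; omega
    | cons y₀ l =>
      have hl' := (List.pairwise_cons.mp hl).2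
      have h0 := (List.pairwise_cons.mp hl).1
      have hxy0 := h0 y₀ (by simp)
      have hmin : ∀ t ∈ y₀ :: l, y₀ ≤ t := by
        intro t ht
        rcases List.mem_cons.mp ht with h | h
        · omega
        · exact ((List.pairwise_cons.mp hl').1 t h).le
      rw [chain]
      split_ifs with h
      · have hxx : x = x₀ := by
          rcases List.mem_cons.mp hx with h' | h'
          · exact h'
          · have := hmin x h'; omega
        have hyy : y = y₀ := by
          have h1 := hno y₀ (by simp) (by omega)
          rcases List.mem_cons.mp hy with h' | h'
          · omega
          · have := hmin y h'; omega
        rw [hxx, hyy]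
      · have hx' : x ∈ y₀ :: l := by
          rcases List.mem_cons.mp hx with h' | h'
          · have := hno y₀ (by simp) (by omega); omega
          · exact h'
        have hy' : y ∈ y₀ :: l := by
          rcases List.mem_cons.mp hy with h' | h'
          · have := hmin x hx'; omega
          · exact h'
        exact ih hl' hx' hy' fun t ht => hno t (List.mem_cons_of_mem _ ht)

theorem head_le_getLast {x : ℕ} {l : List ℕ} (hl : (x :: l).Pairwise (· < ·)) :
    x ≤ (x :: l).getLast (by simp) := by
  rcases List.mem_cons.mp (List.getLast_mem (l := x :: l) (by simp)) with h | h
  · omega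
  · exact ((List.pairwise_cons.mp hl).1 _ h).le

theorem sum_sq_chain_le {n : ℕ} {γ a : ℝ} (hγ : 1 < γ) (ha : 0 < a) {z : ℕ → ℝ}
    {x : ℕ} {l : List ℕ} (hl : (x :: l).Pairwise (· < ·)) (hz : ∀ t ∈ x :: l, |z t| ≤ 1) :
    ∑ v ∈ Finset.Ico x ((x :: l).getLast (by simp)),
        (chain n γ (x :: l) z v - chain n γ (x :: l) z (v + 1)) ^ 2 ≤
      chainEnergy (x :: l) z +
        (l.length * (2 + Real.log a / 2) +
          (((x :: l).getLast (by simp) : ℕ) - x : ℝ) / (2 * a)) / (n * γ ^ 2) := by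
  induction l generalizing x with
  | nil => simp [chainEnergy]
  | cons y l ih =>
    have hl' := (List.pairwise_cons.mp hl).2
    have hxy : x < y := (List.pairwise_cons.mp hl).1 y (by simp)
    have hyl := head_le_getLast hl'
    have hz' : ∀ t ∈ y :: l, |z t| ≤ 1 := fun t ht => hz t (List.mem_cons_of_mem _ ht)
    have ih' := ih hl' hz'
    rw [List.getLast_cons (by simp)]
    set m := (y :: l).getLast (by simp)
    rw [← Finset.sum_Ico_consecutive _ hxy.le hyl]
    have h1 : ∑ v ∈ Finset.Ico y m,
        (chain n γ (x :: y :: l) z v - chain n γ (x :: y :: l) z (v + 1)) ^ 2 =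
        ∑ v ∈ Finset.Ico y m, (chain n γ (y :: l) z v - chain n γ (y :: l) z (v + 1)) ^ 2 := by
      refine Finset.sum_congr rfl fun v hv => ?_
      have := (Finset.mem_Ico.mp hv).1
      rw [chain, chain, if_neg (by omega), if_neg (by omega)]
    have h2 : ∑ v ∈ Finset.Ico x y,
        (chain n γ (x :: y :: l) z v - chain n γ (x :: y :: l) z (v + 1)) ^ 2 =
        ∑ t ∈ Finset.range (y - x), (seg n γ (y - x) (y - x) (z x) (z y) (t + 1) -
          seg n γ (y - x) (y - x) (z x) (z y) t) ^ 2 := by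
      rw [Finset.sum_Ico_eq_sum_range]
      refine Finset.sum_congr rfl fun t ht => ?_
      have ht' := Finset.mem_range.mp ht
      have e1 : chain n γ (x :: y :: l) z (x + t) =
          seg n γ (y - x) (y - x) (z x) (z y) t := by
        rw [chain, if_pos (by omega), Nat.add_sub_cancel_left]
      have e2 : chain n γ (x :: y :: l) z (x + t + 1) =
          seg n γ (y - x) (y - x) (z x) (z y) (t + 1) := by
        rw [chain]
        split_ifs with h
        · congr 1; omega
        · have hty : x + t + 1 = y := by omega
          have hty' : t + 1 = y - x := by omega
          rw [hty, hty', seg_self (by omega) (hz y (by simp))]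
          exact chain_eq_of_mem hl' hz' (by simp)
      rw [e1, e2]
      ring
    have h3 := sum_sq_seg_le (n := n) (γ := γ) (B := y - x) (m := y - x) hγ (by omega)
      le_rfl ha (z x) (z y)
    rw [h1, h2, chainEnergy]
    have hcast : ((y - x : ℕ) : ℝ) = y - x := Nat.cast_sub hxy.le
    have h4 : (((y :: l).length : ℝ) * (2 + Real.log a / 2) + ((m : ℝ) - x) / (2 * a)) /
        (n * γ ^ 2) =
        ((l.length : ℝ) * (2 + Real.log a / 2) + ((m : ℝ) - y) / (2 * a)) / (n * γ ^ 2) +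
        (2 + Real.log a / 2 + ((y - x : ℕ) : ℝ) / (2 * a)) / (n * γ ^ 2) := by
      rw [hcast, ← add_div, List.length_cons]
      push_cast
      ring
    rw [h4]
    linarith

theorem sum_listGaps {x : ℕ} {l : List ℕ} (hl : (x :: l).Pairwise (· < ·)) :
    (listGaps (x :: l)).sum + x = (x :: l).getLast (by simp) := by
  induction l generalizing x with
  | nil => simp [listGaps]
  | cons y l ih =>
    have hxy : x < y := (List.pairwise_cons.mp hl).1 y (by simp)
    have := ih (List.pairwise_cons.mp hl).2
    rw [listGaps_cons_cons, List.sum_cons, List.getLast_cons (by simp)]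
    omega

theorem length_listGaps (x : ℕ) (l : List ℕ) : (listGaps (x :: l)).length = l.length := by
  simp [listGaps]

/-- A full interpolation between opposite signs over `g` vertices costs `4 / g`, at most twice the
energy of the two halves. -/
theorem four_div_le_halves {g : ℕ} (hg : 2 ≤ g) :
    4 / (g : ℝ) ≤ 2 * (1 / ((g / 2 : ℕ) : ℝ) + 1 / (((g + 1) / 2 : ℕ) : ℝ)) := by
  have h1 : 1 ≤ g / 2 := by omega
  have h2 : 1 ≤ (g + 1) / 2 := by omega
  have h3 : (g : ℝ) = ((g / 2 : ℕ) : ℝ) + (((g + 1) / 2 : ℕ) : ℝ) := by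
    exact_mod_cast (by omega : g = g / 2 + (g + 1) / 2)
  have h4 : (1 : ℝ) ≤ ((g / 2 : ℕ) : ℝ) := by exact_mod_cast h1
  have h5 : (1 : ℝ) ≤ (((g + 1) / 2 : ℕ) : ℝ) := by exact_mod_cast h2
  rw [h3]
  set p : ℝ := ((g / 2 : ℕ) : ℝ)
  set r : ℝ := (((g + 1) / 2 : ℕ) : ℝ)
  have hp : 0 < p := by linarith
  have hr : 0 < r := by linarith
  have e : 2 * (1 / p + 1 / r) = 2 * (p + r) / (p * r) := by field_simp; ring
  rw [e, div_le_div_iff₀ (add_pos hp hr) (mul_pos hp hr)]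
  nlinarith [sq_nonneg (p - r)]

/-- The sum of the reciprocals. -/
noncomputable def recipSum (l : List ℕ) : ℝ := (l.map fun x => 1 / (x : ℝ)).sum

@[simp] theorem recipSum_nil : recipSum [] = 0 := rfl

@[simp] theorem recipSum_cons (x : ℕ) (l : List ℕ) :
    recipSum (x :: l) = 1 / (x : ℝ) + recipSum l := by simp [recipSum]

@[simp] theorem recipSum_append (l l' : List ℕ) :
    recipSum (l ++ l') = recipSum l + recipSum l' := by simp [recipSum]

theorem recipSum_nonneg (l : List ℕ) : 0 ≤ recipSum l := by
  induction l with
  | nil => simp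
  | cons x l ih => rw [recipSum_cons]; positivity

theorem halves_cons (g : ℕ) (l : List ℕ) : halves (g :: l) = g / 2 :: (g + 1) / 2 :: halves l := by
  simp [halves]

theorem length_halves (l : List ℕ) : (halves l).length = 2 * l.length := by
  induction l with
  | nil => rfl
  | cons g l ih => rw [halves_cons]; simp only [List.length_cons, ih]; ring

theorem chainEnergy_le {z : ℕ → ℝ} {x : ℕ} {l : List ℕ}
    (hz : ∀ t ∈ x :: l, |z t| = 1) (hg : ∀ g ∈ listGaps (x :: l), 4 ≤ g) :
    chainEnergy (x :: l) z ≤ 2 * recipSum (halves (listGaps (x :: l))) := by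
  induction l generalizing x with
  | nil => simp [chainEnergy, listGaps, halves]
  | cons y l ih =>
    rw [listGaps_cons_cons] at hg ⊢
    rw [halves_cons, chainEnergy]
    simp only [recipSum_cons]
    have h4 := hg (y - x) (by simp)
    have h1 := ih (x := y) (fun t ht => hz t (List.mem_cons_of_mem _ ht))
      fun g hgg => hg g (List.mem_cons_of_mem _ hgg)
    have h2 := four_div_le_halves (by omega : 2 ≤ y - x)
    have h3 : (z y - z x) ^ 2 ≤ 4 := by
      have h5 : |z y - z x| ≤ 2 := (abs_sub _ _).trans (by
        rw [hz y (by simp), hz x (by simp)]; norm_num)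
      rw [← sq_abs]
      nlinarith [abs_nonneg (z y - z x)]
    have h6 : (z y - z x) ^ 2 / ((y - x : ℕ) : ℝ) ≤ 4 / ((y - x : ℕ) : ℝ) :=
      div_le_div_of_nonneg_right h3 (by positivity)
    linarith

theorem chainEnergy_cons_cons_of_zero {z : ℕ → ℝ} {w x : ℕ} (l : List ℕ) (hw : z w = 0)
    (hx : |z x| = 1) :
    chainEnergy (w :: x :: l) z = 1 / ((x - w : ℕ) : ℝ) + chainEnergy (x :: l) z := by
  rw [chainEnergy, hw, sub_zero, ← sq_abs, hx, one_pow]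

theorem chainEnergy_append_of_zero {z : ℕ → ℝ} {x w : ℕ} (l : List ℕ) (hw : z w = 0)
    (hz : ∀ t ∈ x :: l, |z t| = 1) :
    chainEnergy (x :: l ++ [w]) z = chainEnergy (x :: l) z +
      1 / ((w - (x :: l).getLast (by simp) : ℕ) : ℝ) := by
  induction l generalizing x with
  | nil =>
    simp only [List.cons_append, List.nil_append, chainEnergy, hw, zero_sub, neg_sq,
      List.getLast_singleton]
    rw [← sq_abs, hz x (by simp), one_pow]
    ring
  | cons y l ih =>
    have := ih (x := y) fun t ht => hz t (List.mem_cons_of_mem _ ht)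
    simp only [List.cons_append, chainEnergy, List.getLast_cons (List.cons_ne_nil y l)] at this ⊢
    rw [this]
    ring

/-- The increasing enumeration of a nonempty finite set. -/
theorem exists_sort_eq_cons {T : Finset ℕ} (hT : T.Nonempty) :
    ∃ (x : ℕ) (l : List ℕ), T.sort (· ≤ ·) = x :: l ∧ (x :: l).Pairwise (· < ·) ∧
      (∀ t, t ∈ x :: l ↔ t ∈ T) ∧ first T = x ∧ last T = (x :: l).getLast (by simp) ∧
      gaps T = listGaps (x :: l) ∧ l.length + 1 = T.card := by
  have hlen : (T.sort (· ≤ ·)).length = T.card := Finset.length_sort _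
  have hpos := Finset.card_pos.mpr hT
  match hs : T.sort (· ≤ ·) with
  | [] => rw [hs] at hlen; simp at hlen; omega
  | x :: l =>
    have hmem : ∀ t, t ∈ x :: l ↔ t ∈ T := fun t => by rw [← hs]; exact Finset.mem_sort _
    have hpw : (x :: l).Pairwise (· < ·) := by
      rw [← hs]; exact (Finset.sortedLT_sort T).pairwise
    refine ⟨x, l, rfl, hpw, hmem, ?_, ?_, ?_, ?_⟩
    · rw [first, dif_pos hT]
      refine le_antisymm (Finset.min'_le _ _ ((hmem x).mp (by simp))) ?_
      rcases List.mem_cons.mp ((hmem _).mpr (Finset.min'_mem T hT)) with h | h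
      · exact h.ge
      · exact ((List.pairwise_cons.mp hpw).1 _ h).le
    · rw [last, dif_pos hT]
      refine le_antisymm ?_ (Finset.le_max' _ _ ((hmem _).mp (List.getLast_mem _)))
      have hm := (hmem _).mpr (Finset.max'_mem T hT)
      exact (hpw.imp le_of_lt).rel_getLast hm
    · rw [gaps, hs]; rfl
    · rw [← hlen, hs]; rfl

end BranchedPath

/-! ### The components of the tree without the active edges -/

namespace BranchedPath

theorem first_mem {T : Finset ℕ} (hT : T.Nonempty) : first T ∈ T := by
  rw [first, dif_pos hT]; exact Finset.min'_mem _ _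

theorem first_le {T : Finset ℕ} {t : ℕ} (ht : t ∈ T) : first T ≤ t := by
  rw [first, dif_pos ⟨t, ht⟩]; exact Finset.min'_le _ _ ht

theorem last_mem {T : Finset ℕ} (hT : T.Nonempty) : last T ∈ T := by
  rw [last, dif_pos hT]; exact Finset.max'_mem _ _

theorem le_last {T : Finset ℕ} {t : ℕ} (ht : t ∈ T) : t ≤ last T := by
  rw [last, dif_pos ⟨t, ht⟩]; exact Finset.le_max' _ _ ht

/-- The active edges `t₁`, `t₂`, `t₃` next to the branching point, on the way to the root, along the
main branch and along the side branch, in a branched path with `n` vertices. -/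
structure Frame (n₁ n b : ℕ) (S : Finset ℕ) (t₁ t₂ t₃ : ℕ) : Prop where
  two_le : ∀ t ∈ S, 2 ≤ t
  le_n : ∀ t ∈ S, t ≤ n
  mem₁ : t₁ ∈ S
  mem₂ : t₂ ∈ S
  mem₃ : t₃ ∈ S
  t₁_le : t₁ ≤ b
  lt_t₂ : b < t₂
  t₂_le : t₂ ≤ n₁
  lt_t₃ : n₁ < t₃
  le_t₁ : ∀ t ∈ S, t ≤ b → t ≤ t₁
  t₂_min : ∀ t ∈ S, b < t → t₂ ≤ t
  t₃_min : ∀ t ∈ S, n₁ < t → t₃ ≤ t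

theorem Setting.frame {n₁ n₂ b : ℕ} {S : Finset ℕ} {d : Fin 3 → ℕ} (h : Setting n₁ n₂ b S d) :
    Frame n₁ (n₁ + n₂) b S (last (S₁ b S)) (first (S₂ n₁ b S)) (first (S₃ n₁ S)) := by
  have h1 := last_mem h.nonempty₁
  have h2 := first_mem h.nonempty₂
  have h3 := first_mem h.nonempty₃
  simp only [S₁, S₂, S₃, Finset.mem_filter] at h1 h2 h3
  refine ⟨fun t ht => (Finset.mem_Icc.mp (h.subset ht)).1,
    fun t ht => (Finset.mem_Icc.mp (h.subset ht)).2, h1.1, h2.1, h3.1, h1.2, h2.2.1, h2.2.2, h3.2,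
    fun t ht hb => le_last (by simp [S₁, ht, hb]), fun t ht hb => ?_,
    fun t ht hb => first_le (by simp [S₃, ht, hb])⟩
  by_cases hn : t ≤ n₁
  · exact first_le (by simp [S₂, ht, hb, hn])
  · have := h2.2.2
    simp only [S₂] at this ⊢
    omega

/-- The last active edge, or the root, not after `v` in the numbering. -/
def prevActive (S : Finset ℕ) (v : ℕ) : ℕ := Nat.findGreatest (fun t => t = 1 ∨ t ∈ S) v

theorem prevActive_le (S : Finset ℕ) (v : ℕ) : prevActive S v ≤ v := Nat.findGreatest_le v

theorem prevActive_mem (S : Finset ℕ) {v : ℕ} (hv : 1 ≤ v) :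
    prevActive S v = 1 ∨ prevActive S v ∈ S :=
  Nat.findGreatest_spec (P := fun t => t = 1 ∨ t ∈ S) hv (Or.inl rfl)

theorem le_prevActive {S : Finset ℕ} {t v : ℕ} (ht : t = 1 ∨ t ∈ S) (h : t ≤ v) :
    t ≤ prevActive S v :=
  Nat.le_findGreatest h ht

theorem prevActive_eq {S : Finset ℕ} {x v : ℕ} (hx : x = 1 ∨ x ∈ S) (hx1 : 1 ≤ x) (hxv : x ≤ v)
    (h : ∀ t ∈ S, t ≤ v → t ≤ x) : prevActive S v = x := by
  refine le_antisymm ?_ (le_prevActive hx hxv)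
  rcases prevActive_mem S (hx1.trans hxv) with h' | h'
  · omega
  · exact h _ h' (prevActive_le S v)

/-- The vertex of the component of `v` that is closest to the root. A vertex of the side branch
before its first active edge belongs to the component of the branching point. -/
def top (n₁ b : ℕ) (S : Finset ℕ) (v : ℕ) : ℕ :=
  if n₁ < v ∧ prevActive S v ≤ n₁ then prevActive S b else prevActive S v

/-- The edge `e` lies on the path from `v` to the top of its component. -/
def OnPath (n₁ b : ℕ) (S : Finset ℕ) (e v : ℕ) : Prop :=
  if n₁ < v ∧ prevActive S v ≤ n₁ then (prevActive S b < e ∧ e ≤ b) ∨ (n₁ < e ∧ e ≤ v)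
  else prevActive S v < e ∧ e ≤ v

instance (n₁ b : ℕ) (S : Finset ℕ) (e : ℕ) : DecidablePred (OnPath n₁ b S e) := fun v => by
  unfold OnPath; infer_instance

theorem top_mem (n₁ : ℕ) {b : ℕ} (S : Finset ℕ) (hb : 1 ≤ b) {v : ℕ} (hv : 1 ≤ v) :
    top n₁ b S v = 1 ∨ top n₁ b S v ∈ S := by
  unfold top
  split_ifs
  · exact prevActive_mem S hb
  · exact prevActive_mem S hv

theorem top_of_mem {n₁ b : ℕ} {S : Finset ℕ} {k : ℕ} (hk : k = 1 ∨ k ∈ S) (hk1 : 1 ≤ k) :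
    top n₁ b S k = k := by
  have h := prevActive_eq hk hk1 le_rfl fun t _ h => h
  unfold top
  rw [h, if_neg (by omega)]

theorem not_onPath_of_mem {n₁ b : ℕ} {S : Finset ℕ} {e v : ℕ} (he : e ∈ S) :
    ¬ OnPath n₁ b S e v := by
  unfold OnPath
  split_ifs with h
  · rintro (⟨h1, h2⟩ | ⟨h1, h2⟩)
    · have := le_prevActive (Or.inr he) h2; omega
    · have := le_prevActive (Or.inr he) h2; omega
  · rintro ⟨h1, h2⟩
    have := le_prevActive (Or.inr he) h2; omega

theorem prevActive_eq_of_lt {S : Finset ℕ} {e v : ℕ} (hv : 1 ≤ v) (h1 : prevActive S v < e)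
    (h2 : e ≤ v) : prevActive S e = prevActive S v :=
  prevActive_eq (prevActive_mem S hv) (le_prevActive (Or.inl rfl) hv) h1.le
    fun _ ht hte => le_prevActive (Or.inr ht) (hte.trans h2)

theorem top_eq_of_onPath {n₁ b : ℕ} {S : Finset ℕ} (hb : 1 ≤ b) (hbn : b < n₁) {e v : ℕ}
    (hv : 1 ≤ v) (h : OnPath n₁ b S e v) : top n₁ b S v = top n₁ b S e := by
  unfold OnPath at h
  unfold top
  split_ifs at h with hang
  · rw [if_pos hang]
    rcases h with ⟨h1, h2⟩ | ⟨h1, h2⟩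
    · rw [if_neg (by omega), prevActive_eq_of_lt hb h1 h2]
    · rw [if_pos]
      rw [prevActive_eq_of_lt hv (by omega) h2]
      exact ⟨h1, hang.2⟩
  · obtain ⟨h1, h2⟩ := h
    rw [if_neg hang, prevActive_eq_of_lt hv h1 h2, if_neg]
    omega

theorem onPath_self {n₁ b : ℕ} {S : Finset ℕ} {e : ℕ} (he : 2 ≤ e) (heS : e ∉ S) :
    OnPath n₁ b S e e := by
  unfold OnPath
  split_ifs with h
  · exact Or.inr ⟨h.1, le_rfl⟩
  · refine ⟨lt_of_le_of_ne (prevActive_le S e) fun h' => ?_, le_rfl⟩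
    rcases prevActive_mem S (by omega : 1 ≤ e) with h1 | h1
    · omega
    · rw [h'] at h1; exact heS h1

theorem not_onPath_top {n₁ b : ℕ} {S : Finset ℕ} {e k : ℕ} (hk : k = 1 ∨ k ∈ S) (hk1 : 1 ≤ k) :
    ¬ OnPath n₁ b S e k := by
  have h := prevActive_eq hk hk1 le_rfl fun t _ h => h
  unfold OnPath
  rw [h, if_neg (by omega)]
  omega

/-- A vector on the vertices, extended by `0` to all natural numbers. -/
noncomputable def extend {n : ℕ} (g : Vertex n → ℝ) (j : ℕ) : ℝ :=
  if h : j ∈ Finset.Icc 1 n then g ⟨j, h⟩ else 0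

theorem extend_coe {n : ℕ} (g : Vertex n → ℝ) (v : Vertex n) : extend g v = g v := by
  rw [extend, dif_pos v.2]

theorem sum_vertex_eq {n : ℕ} (F : ℕ → ℝ) :
    ∑ v : Vertex n, F v = ∑ v ∈ Finset.Icc 1 n, F v :=
  Finset.sum_coe_sort (Finset.Icc 1 n) F

theorem sum_edge_eq {n : ℕ} (F : ℕ → ℝ) :
    ∑ e : Edge n, F e = ∑ e ∈ Finset.Icc 2 n, F e :=
  Finset.sum_coe_sort (Finset.Icc 2 n) F

theorem D_mulVec {n₁ n₂ b : ℕ} (hb : 1 ≤ b) (hbn : b < n₁) (g : Vertex (n₁ + n₂) → ℝ)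
    (e : Edge (n₁ + n₂)) :
    (D n₁ n₂ b *ᵥ g) e = extend g e - extend g (parent n₁ b e) := by
  have he := Finset.mem_Icc.mp e.2
  have hpar : parent n₁ b e ∈ Finset.Icc 1 (n₁ + n₂) ∧ parent n₁ b e ≠ e := by
    unfold parent
    rw [Finset.mem_Icc]
    split_ifs <;> omega
  have h1 : ∀ v : Vertex (n₁ + n₂), D n₁ n₂ b e v * g v =
      (fun j : ℕ => (if j = e then extend g j else 0) -
        if j = parent n₁ b e then extend g j else 0) v := by
    intro v
    simp only [extend_coe, D]
    have := hpar.2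
    split_ifs with h h'
    · omega
    · ring
    · ring
    · ring
  simp only [Matrix.mulVec, dotProduct]
  rw [Finset.sum_congr rfl fun v _ => h1 v]
  refine (sum_vertex_eq (n := n₁ + n₂) (fun j : ℕ => (if j = e then extend g j else 0) -
    if j = parent n₁ b e then extend g j else 0)).trans ?_
  rw [Finset.sum_sub_distrib, Finset.sum_ite_eq', Finset.sum_ite_eq', if_pos hpar.1,
    if_pos (Finset.mem_Icc.mpr ⟨by omega, he.2⟩)]

theorem sum_Ioc_sub (G : ℕ → ℝ) {x v : ℕ} (h : x ≤ v) :
    ∑ e ∈ Finset.Ioc x v, (G e - G (e - 1)) = G v - G x := by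
  induction v, h using Nat.le_induction with
  | base => simp
  | succ v hv ih => rw [Finset.sum_Ioc_succ_top (by omega), ih, Nat.add_sub_cancel]; ring

/-- The increments on the path from the top of the component of `v` to `v` telescope. -/
theorem sum_onPath {n₁ n₂ b : ℕ} {S : Finset ℕ} (hb : 1 ≤ b) (hbn : b < n₁) (G : ℕ → ℝ) {v : ℕ}
    (hv : 1 ≤ v) (hvn : v ≤ n₁ + n₂) :
    (∑ e ∈ Finset.Icc 2 (n₁ + n₂), if OnPath n₁ b S e v then G e - G (parent n₁ b e) else 0) =
      G v - G (top n₁ b S v) := by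
  have hP1 : 1 ≤ prevActive S v := le_prevActive (Or.inl rfl) hv
  have hPv := prevActive_le S v
  have hPb1 : 1 ≤ prevActive S b := le_prevActive (Or.inl rfl) hb
  have hPb := prevActive_le S b
  rw [← Finset.sum_filter]
  by_cases hang : n₁ < v ∧ prevActive S v ≤ n₁
  · have hset : (Finset.Icc 2 (n₁ + n₂)).filter (fun e => OnPath n₁ b S e v) =
        Finset.Ioc (prevActive S b) b ∪ insert (n₁ + 1) (Finset.Ioc (n₁ + 1) v) := by
      ext e
      simp only [Finset.mem_filter, Finset.mem_Icc, OnPath, if_pos hang, Finset.mem_union,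
        Finset.mem_insert, Finset.mem_Ioc]
      omega
    have hdisj : Disjoint (Finset.Ioc (prevActive S b) b)
        (insert (n₁ + 1) (Finset.Ioc (n₁ + 1) v)) := by
      rw [Finset.disjoint_left]
      intro e
      simp only [Finset.mem_insert, Finset.mem_Ioc]
      omega
    have htop : top n₁ b S v = prevActive S b := by rw [top, if_pos hang]
    rw [hset, Finset.sum_union hdisj, Finset.sum_insert (by simp), htop]
    have e1 : ∑ e ∈ Finset.Ioc (prevActive S b) b, (G e - G (parent n₁ b e)) =
        G b - G (prevActive S b) := by
      rw [← sum_Ioc_sub G hPb]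
      refine Finset.sum_congr rfl fun e he => ?_
      have := Finset.mem_Ioc.mp he
      rw [parent, if_neg (by omega)]
    have e2 : ∑ e ∈ Finset.Ioc (n₁ + 1) v, (G e - G (parent n₁ b e)) =
        G v - G (n₁ + 1) := by
      rw [← sum_Ioc_sub G (by omega : n₁ + 1 ≤ v)]
      refine Finset.sum_congr rfl fun e he => ?_
      have := Finset.mem_Ioc.mp he
      rw [parent, if_neg (by omega)]
    rw [e1, e2, parent, if_pos rfl]
    ring
  · have hset : (Finset.Icc 2 (n₁ + n₂)).filter (fun e => OnPath n₁ b S e v) =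
        Finset.Ioc (prevActive S v) v := by
      ext e
      simp only [Finset.mem_filter, Finset.mem_Icc, OnPath, if_neg hang, Finset.mem_Ioc]
      omega
    rw [hset, top, if_neg hang, ← sum_Ioc_sub G hPv]
    refine Finset.sum_congr rfl fun e he => ?_
    have := Finset.mem_Ioc.mp he
    rw [parent, if_neg (by omega)]

/-- The component of a vertex, labelled by its top. -/
def component (n₁ n₂ : ℕ) {b : ℕ} (S : Finset ℕ) (hb : 1 ≤ b) (v : Vertex (n₁ + n₂)) :
    ↥(insert 1 S) :=
  ⟨top n₁ b S v, by
    rw [Finset.mem_insert]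
    exact top_mem n₁ S hb (Finset.mem_Icc.mp v.2).1⟩

/-- The end of an edge away from the root. -/
def Edge.upper {n : ℕ} (e : Edge n) : Vertex n :=
  ⟨e, by have := Finset.mem_Icc.mp e.2; rw [Finset.mem_Icc]; omega⟩

/-- The active edges, as a set of edges. -/
def activeEdges (n : ℕ) (S : Finset ℕ) : Finset (Edge n) :=
  Finset.univ.filter fun e => (e : ℕ) ∈ S

theorem card_compl_activeEdges {n : ℕ} {S : Finset ℕ} (hS : S ⊆ Finset.Icc 2 n) :
    (activeEdges n S)ᶜ.card = n - 1 - S.card := by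
  have h1 : (activeEdges n S).card = S.card := by
    refine Finset.card_bij (fun e _ => (e : ℕ)) (fun e he => ?_) (fun e _ e' _ h => Subtype.ext h)
      fun t ht => ⟨⟨t, hS ht⟩, ?_, rfl⟩
    · simpa [activeEdges] using he
    · simpa [activeEdges] using ht
  rw [Finset.card_compl, h1, Fintype.card_coe, Nat.card_Icc]
  omega

/-- The residual of the indicator of the part of its component that the edge `e` cuts off. -/
noncomputable def edgeResidual (n₁ n₂ : ℕ) {b : ℕ} (S : Finset ℕ) (hb : 1 ≤ b)
    (e : Edge (n₁ + n₂)) : Vertex (n₁ + n₂) → ℝ :=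
  residual (component n₁ n₂ S hb) (fun v => OnPath n₁ b S e v) (component n₁ n₂ S hb e.upper)

section Tree

variable {n₁ n₂ b : ℕ} {S : Finset ℕ}

theorem component_surjective (hb : 1 ≤ b) (hbn : b < n₁) (hS : S ⊆ Finset.Icc 2 (n₁ + n₂)) :
    Function.Surjective (component n₁ n₂ S hb) := by
  rintro ⟨k, hk⟩
  have hk' := Finset.mem_insert.mp hk
  have hk1 : 1 ≤ k ∧ k ≤ n₁ + n₂ := by
    rcases hk' with h | h
    · omega
    · have := Finset.mem_Icc.mp (hS h); omega
  exact ⟨⟨k, Finset.mem_Icc.mpr hk1⟩, Subtype.ext (top_of_mem hk' hk1.1)⟩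

theorem component_eq_of_onPath (hb : 1 ≤ b) (hbn : b < n₁) (e : Edge (n₁ + n₂))
    (v : Vertex (n₁ + n₂)) (h : OnPath n₁ b S e v) :
    component n₁ n₂ S hb v = component n₁ n₂ S hb e.upper :=
  Subtype.ext (top_eq_of_onPath hb hbn (Finset.mem_Icc.mp v.2).1 h)

/-- A pairing splits into the part seen by the projection on the components and the part carried by
the increments along the edges outside `S`. -/
theorem tree_decomposition (hb : 1 ≤ b) (hbn : b < n₁) (hS : S ⊆ Finset.Icc 2 (n₁ + n₂))
    (x g : Vertex (n₁ + n₂) → ℝ) :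
    ∑ v, x v * g v =
      ∑ l, (∑ v, cellVec (component n₁ n₂ S hb) l v * x v) *
        (∑ v, cellVec (component n₁ n₂ S hb) l v * g v) +
      ∑ e ∈ (activeEdges (n₁ + n₂) S)ᶜ,
        (∑ v, edgeResidual n₁ n₂ S hb e v * x v) * (D n₁ n₂ b *ᵥ g) e := by
  have hrep : ∀ k : ↥(insert 1 S), (k : ℕ) ∈ Finset.Icc 1 (n₁ + n₂) := by
    rintro ⟨k, hk⟩
    rcases Finset.mem_insert.mp hk with h | h
    · rw [Finset.mem_Icc]; simp only; omega
    · have := Finset.mem_Icc.mp (hS h); rw [Finset.mem_Icc]; simp only; omega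
  refine residual_decomposition (D n₁ n₂ b) (activeEdges (n₁ + n₂) S) (component n₁ n₂ S hb)
    (component_surjective hb hbn hS) (fun k => ⟨k, hrep k⟩)
    (fun e v => OnPath n₁ b S e v) (fun e => component n₁ n₂ S hb e.upper)
    (fun e _ v h => component_eq_of_onPath hb hbn e v h) (fun g v => ?_) x g
  have hv := Finset.mem_Icc.mp v.2
  have h1 : (∑ e ∈ (activeEdges (n₁ + n₂) S)ᶜ,
      if OnPath n₁ b S e v then (D n₁ n₂ b *ᵥ g) e else 0) =
      ∑ e : Edge (n₁ + n₂), if OnPath n₁ b S e v then (D n₁ n₂ b *ᵥ g) e else 0 := by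
    refine Finset.sum_subset (Finset.subset_univ _) fun e _ he => if_neg ?_
    refine not_onPath_of_mem ?_
    simpa [activeEdges] using he
  have h2 := sum_onPath (n₂ := n₂) (S := S) hb hbn (extend g) hv.1 hv.2
  rw [← sum_edge_eq] at h2
  rw [h1]
  simp_rw [D_mulVec hb hbn]
  rw [h2, extend_coe]
  congr 1
  exact (extend_coe g ⟨top n₁ b S v, hrep (component n₁ n₂ S hb v)⟩)

theorem edgeResidual_sq_pos (hb : 1 ≤ b) (hbn : b < n₁) (hS : S ⊆ Finset.Icc 2 (n₁ + n₂))
    (e : Edge (n₁ + n₂)) (he : (e : ℕ) ∉ S) : 0 < ∑ v, edgeResidual n₁ n₂ S hb e v ^ 2 := by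
  obtain ⟨v, hv⟩ := component_surjective hb hbn hS (component n₁ n₂ S hb e.upper)
  have he2 := Finset.mem_Icc.mp e.2
  set k := component n₁ n₂ S hb e.upper with hk
  have hkmem := top_mem n₁ S hb (by omega : 1 ≤ (e : ℕ))
  have hk1 : 1 ≤ top n₁ b S e ∧ top n₁ b S e ≤ n₁ + n₂ := by
    rcases hkmem with h | h
    · omega
    · have := Finset.mem_Icc.mp (hS h); omega
  -- the residual is negative at the top of the component
  set w : Vertex (n₁ + n₂) := ⟨top n₁ b S e, Finset.mem_Icc.mpr hk1⟩
  have hw : component n₁ n₂ S hb w = k := Subtype.ext (top_of_mem hkmem hk1.1)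
  have hcell : (0 : ℝ) < cellCard (component n₁ n₂ S hb) k := by
    exact_mod_cast hw ▸ cellCard_pos (component n₁ n₂ S hb) w
  have hα : (0 : ℝ) < (Finset.univ.filter fun v : Vertex (n₁ + n₂) => OnPath n₁ b S e v).card := by
    exact_mod_cast Finset.card_pos.mpr ⟨e.upper, by
      simpa [Edge.upper] using onPath_self (n₁ := n₁) (b := b) he2.1 he⟩
  have hres : edgeResidual n₁ n₂ S hb e w ≠ 0 := by
    unfold edgeResidual residual
    rw [if_neg (not_onPath_top hkmem hk1.1), if_pos hw, zero_sub]
    exact neg_ne_zero.mpr (div_pos hα hcell).ne'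
  exact lt_of_lt_of_le (by positivity) (Finset.single_le_sum (f := fun v =>
    edgeResidual n₁ n₂ S hb e v ^ 2) (fun v _ => sq_nonneg _) (Finset.mem_univ w))

theorem card_filter_vertex_le {n : ℕ} (p : Vertex n → Prop) [DecidablePred p] (T : Finset ℕ)
    (h : ∀ v : Vertex n, p v → (v : ℕ) ∈ T) : (Finset.univ.filter p).card ≤ T.card :=
  Finset.card_le_card_of_injOn (fun v => (v : ℕ)) (fun v hv => h v (by simpa using hv))
    fun _ _ _ _ h => Subtype.ext h

/-- The sizes of the two parts of the component of `e` may be replaced by upper bounds, the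
cardinalities of the supersets `X` and `Y`, because `x y / (x + y)` increases in `x` and in `y`. -/
theorem edgeResidual_sq_le (hb : 1 ≤ b) (hbn : b < n₁) (e : Edge (n₁ + n₂)) (X Y : Finset ℕ)
    (hX : ∀ v, 1 ≤ v → v ≤ n₁ + n₂ → OnPath n₁ b S e v → v ∈ X)
    (hY : ∀ v, 1 ≤ v → v ≤ n₁ + n₂ → top n₁ b S v = top n₁ b S e → ¬ OnPath n₁ b S e v → v ∈ Y)
    {B y : ℕ} (hc : X.card + Y.card = B) (hy : Y.card = y ∨ X.card = y) :
    ∑ v, edgeResidual n₁ n₂ S hb e v ^ 2 ≤ profile B y := by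
  have h := sum_residual_sq (component n₁ n₂ S hb) (fun v : Vertex (n₁ + n₂) => OnPath n₁ b S e v)
    (component n₁ n₂ S hb e.upper) (fun v hv => component_eq_of_onPath hb hbn e v hv)
    (cellCard_pos _ _) (x := X.card) (y := Y.card)
    (card_filter_vertex_le _ X fun v hv =>
      hX v (Finset.mem_Icc.mp v.2).1 (Finset.mem_Icc.mp v.2).2 hv)
    (card_filter_vertex_le _ Y fun v hv =>
      hY v (Finset.mem_Icc.mp v.2).1 (Finset.mem_Icc.mp v.2).2 (congrArg Subtype.val hv.1) hv.2)
  refine h.trans (le_of_eq ?_)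
  unfold profile
  rw [← hc]
  push_cast
  rcases hy with rfl | rfl <;> ring

variable {t₁ t₂ t₃ : ℕ}

theorem Frame.prevActive_b (F : Frame n₁ (n₁ + n₂) b S t₁ t₂ t₃) : prevActive S b = t₁ :=
  prevActive_eq (Or.inr F.mem₁) (by have := F.two_le _ F.mem₁; omega) F.t₁_le F.le_t₁

/-- An edge of a component other than that of the branching point, which is an interval. -/
theorem edgeResidual_sq_le_of_path (hb : 1 ≤ b) (hbn : b < n₁)
    (F : Frame n₁ (n₁ + n₂) b S t₁ t₂ t₃) (e : Edge (n₁ + n₂)) {x y : ℕ}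
    (hx : x = 1 ∨ x ∈ S) (hy : y ∈ S ∨ y = n₁ + 1 ∨ y = n₁ + n₂ + 1)
    (hno : ∀ t ∈ S, x < t → y ≤ t) (hxe : x < e) (hey : e < y)
    (hpos : y ≤ t₁ ∨ (t₂ ≤ x ∧ y ≤ n₁ + 1) ∨ t₃ ≤ x) :
    ∑ v, edgeResidual n₁ n₂ S hb e v ^ 2 ≤ profile (y - x) (e - x) := by
  have hPb := F.prevActive_b
  have f1 := F.t₁_le
  have f2 := F.lt_t₂
  have f3 := F.t₂_le
  have f4 := F.lt_t₃
  have he := Finset.mem_Icc.mp e.2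
  have hx1 : 1 ≤ x := by
    rcases hx with h | h
    · omega
    · have := F.two_le _ h; omega
  have hPe : prevActive S e = x := by
    refine prevActive_eq hx hx1 hxe.le fun t ht hte => ?_
    by_contra hcon
    have := hno t ht (by omega)
    omega
  have htope : top n₁ b S e = x := by
    unfold top
    rw [hPe, if_neg (by omega)]
  refine edgeResidual_sq_le hb hbn e (Finset.Ico e y) (Finset.Ico x e) (fun v hv hvn h => ?_)
    (fun v hv hvn htop h => ?_) (by simp only [Nat.card_Ico]; omega) (Or.inl (Nat.card_Ico _ _))
  · rw [Finset.mem_Ico]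
    unfold OnPath at h
    split_ifs at h with hang
    · exfalso
      rw [hPb] at h
      rcases h with h | h
      · omega
      · rcases hpos with h' | h' | h'
        · omega
        · omega
        · have := le_prevActive (v := v) (Or.inr F.mem₃) (by omega); omega
    · refine ⟨h.2, ?_⟩
      by_contra hcon
      rcases hy with h' | h' | h'
      · have := le_prevActive (v := v) (Or.inr h') (by omega); omega
      · omega
      · omega
  · rw [Finset.mem_Ico]
    rw [htope] at htop
    unfold OnPath at h
    unfold top at htop
    split_ifs at h htop with hang
    · omega
    · have := prevActive_le S v
      omega

theorem edgeResidual_sq_le_of_leg₁ (hb : 1 ≤ b) (hbn : b < n₁)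
    (F : Frame n₁ (n₁ + n₂) b S t₁ t₂ t₃) (e : Edge (n₁ + n₂)) (h1 : t₁ < e) (h2 : e ≤ b) {B : ℕ}
    (hB : B = (t₂ - t₁) + (t₃ - n₁ - 1)) :
    ∑ v, edgeResidual n₁ n₂ S hb e v ^ 2 ≤ profile B (e - t₁) := by
  have hPb := F.prevActive_b
  have f0 := F.two_le _ F.mem₁
  have f1 := F.t₁_le
  have f2 := F.lt_t₂
  have f3 := F.t₂_le
  have f4 := F.lt_t₃
  have hPe : prevActive S e = t₁ :=
    prevActive_eq (Or.inr F.mem₁) (by omega) h1.le fun t ht hte => F.le_t₁ t ht (by omega)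
  have htope : top n₁ b S e = t₁ := by
    unfold top
    rw [hPe, if_neg (by omega)]
  refine edgeResidual_sq_le hb hbn e (Finset.Ico e t₂ ∪ Finset.Ico (n₁ + 1) t₃) (Finset.Ico t₁ e)
    (fun v hv hvn h => ?_) (fun v hv hvn htop h => ?_) ?_ (Or.inl (Nat.card_Ico _ _))
  · rw [Finset.mem_union, Finset.mem_Ico, Finset.mem_Ico]
    unfold OnPath at h
    split_ifs at h with hang
    · right
      refine ⟨by omega, ?_⟩
      by_contra hcon
      have := le_prevActive (v := v) (Or.inr F.mem₃) (by omega); omega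
    · left
      refine ⟨h.2, ?_⟩
      by_contra hcon
      have := le_prevActive (v := v) (Or.inr F.mem₂) (by omega); omega
  · rw [Finset.mem_Ico]
    rw [htope] at htop
    unfold OnPath at h
    unfold top at htop
    split_ifs at h htop with hang
    · omega
    · have := prevActive_le S v
      omega
  · rw [Finset.card_union_of_disjoint (by
      rw [Finset.disjoint_left]; intro t; simp only [Finset.mem_Ico]; omega)]
    simp only [Nat.card_Ico]
    omega

theorem edgeResidual_sq_le_of_leg₂ (hb : 1 ≤ b) (hbn : b < n₁)
    (F : Frame n₁ (n₁ + n₂) b S t₁ t₂ t₃) (e : Edge (n₁ + n₂)) (h1 : b < e) (h2 : e < t₂) {B : ℕ}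
    (hB : B = (t₂ - t₁) + (t₃ - n₁ - 1)) :
    ∑ v, edgeResidual n₁ n₂ S hb e v ^ 2 ≤ profile B (t₂ - e) := by
  have hPb := F.prevActive_b
  have f0 := F.two_le _ F.mem₁
  have f1 := F.t₁_le
  have f2 := F.lt_t₂
  have f3 := F.t₂_le
  have f4 := F.lt_t₃
  have hPe : prevActive S e = t₁ :=
    prevActive_eq (Or.inr F.mem₁) (by omega) (by omega) fun t ht hte => by
      by_contra hcon
      have h3 : b < t := by
        by_contra h'
        have := F.le_t₁ t ht (by omega); omega
      have := F.t₂_min t ht h3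
      omega
  have htope : top n₁ b S e = t₁ := by
    unfold top
    rw [hPe, if_neg (by omega)]
  refine edgeResidual_sq_le hb hbn e (Finset.Ico e t₂) (Finset.Ico t₁ e ∪ Finset.Ico (n₁ + 1) t₃)
    (fun v hv hvn h => ?_) (fun v hv hvn htop h => ?_) ?_ (Or.inr (Nat.card_Ico _ _))
  · rw [Finset.mem_Ico]
    unfold OnPath at h
    split_ifs at h with hang
    · omega
    · refine ⟨h.2, ?_⟩
      by_contra hcon
      have := le_prevActive (v := v) (Or.inr F.mem₂) (by omega); omega
  · rw [Finset.mem_union, Finset.mem_Ico, Finset.mem_Ico]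
    rw [htope] at htop
    unfold OnPath at h
    unfold top at htop
    split_ifs at h htop with hang
    · right
      refine ⟨by omega, ?_⟩
      by_contra hcon
      have := le_prevActive (v := v) (Or.inr F.mem₃) (by omega); omega
    · left
      have := prevActive_le S v
      omega
  · rw [Finset.card_union_of_disjoint (by
      rw [Finset.disjoint_left]; intro t; simp only [Finset.mem_Ico]; omega)]
    simp only [Nat.card_Ico]
    omega

theorem edgeResidual_sq_le_of_leg₃ (hb : 1 ≤ b) (hbn : b < n₁)
    (F : Frame n₁ (n₁ + n₂) b S t₁ t₂ t₃) (e : Edge (n₁ + n₂)) (h1 : n₁ < e) (h2 : e < t₃) {B : ℕ}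
    (hB : B = (t₂ - t₁) + (t₃ - n₁ - 1)) :
    ∑ v, edgeResidual n₁ n₂ S hb e v ^ 2 ≤ profile B (t₃ - e) := by
  have hPb := F.prevActive_b
  have f0 := F.two_le _ F.mem₁
  have f1 := F.t₁_le
  have f2 := F.lt_t₂
  have f3 := F.t₂_le
  have f4 := F.lt_t₃
  have hPe : prevActive S e ≤ n₁ := by
    rcases prevActive_mem S (by omega : 1 ≤ (e : ℕ)) with h | h
    · omega
    · by_contra hcon
      have := F.t₃_min _ h (by omega)
      have := prevActive_le S e
      omega
  have htope : top n₁ b S e = t₁ := by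
    unfold top
    rw [if_pos ⟨h1, hPe⟩, hPb]
  refine edgeResidual_sq_le hb hbn e (Finset.Ico e t₃) (Finset.Ico t₁ t₂ ∪ Finset.Ico (n₁ + 1) e)
    (fun v hv hvn h => ?_) (fun v hv hvn htop h => ?_) ?_ (Or.inr (Nat.card_Ico _ _))
  · rw [Finset.mem_Ico]
    unfold OnPath at h
    split_ifs at h with hang
    · refine ⟨by omega, ?_⟩
      by_contra hcon
      have := le_prevActive (v := v) (Or.inr F.mem₃) (by omega); omega
    · refine ⟨h.2, ?_⟩
      by_contra hcon
      have := le_prevActive (v := v) (Or.inr F.mem₃) (by omega); omega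
  · rw [Finset.mem_union, Finset.mem_Ico, Finset.mem_Ico]
    rw [htope] at htop
    unfold OnPath at h
    unfold top at htop
    split_ifs at h htop with hang
    · right
      omega
    · left
      have := prevActive_le S v
      refine ⟨by omega, ?_⟩
      by_contra hcon
      have := le_prevActive (v := v) (Or.inr F.mem₂) (by omega); omega
  · rw [Finset.card_union_of_disjoint (by
      rw [Finset.disjoint_left]; intro t; simp only [Finset.mem_Ico]; omega)]
    simp only [Nat.card_Ico]
    omega

end Tree

end BranchedPath

/-! ### The interpolating vector -/

namespace BranchedPath

theorem sum_D_mul {n₁ n₂ b : ℕ} (hb : 1 ≤ b) (hbn : b < n₁) (hn₂ : 1 ≤ n₂) (q : ℕ → ℝ)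
    (hq1 : q 1 = 0) (hqn : q (n₁ + n₂ + 1) = 0) (v : Vertex (n₁ + n₂)) :
    ∑ e : Edge (n₁ + n₂), D n₁ n₂ b e v * q e =
      q v - (if (v : ℕ) = n₁ then 0 else q (v + 1)) - if (v : ℕ) = b then q (n₁ + 1) else 0 := by
  obtain ⟨v, hv⟩ := v
  rw [Finset.mem_Icc] at hv
  have h1 : ∀ e : Edge (n₁ + n₂), D n₁ n₂ b e ⟨v, Finset.mem_Icc.mpr hv⟩ * q e =
      (fun j : ℕ => (if j = v then q j else 0) -
        (if j = v + 1 then (if v = n₁ then 0 else q j) else 0) -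
        if j = n₁ + 1 then (if v = b then q j else 0) else 0) e := by
    intro e
    simp only [D, parent]
    split_ifs <;> first | omega | ring
  rw [Finset.sum_congr rfl fun e _ => h1 e]
  refine (sum_edge_eq (n := n₁ + n₂) (fun j : ℕ => (if j = v then q j else 0) -
        (if j = v + 1 then (if v = n₁ then 0 else q j) else 0) -
        if j = n₁ + 1 then (if v = b then q j else 0) else 0)).trans ?_
  rw [Finset.sum_sub_distrib, Finset.sum_sub_distrib, Finset.sum_ite_eq', Finset.sum_ite_eq',
    Finset.sum_ite_eq']
  simp only [Finset.mem_Icc]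
  congr 1
  · congr 1
    · split_ifs with h
      · rfl
      · have : v = 1 := by omega
        rw [this, hq1]
    · split_ifs with h h' h'
      · rfl
      · rfl
      · rfl
      · have : v = n₁ + n₂ := by omega
        rw [this, hqn]
  · rw [if_pos (by omega)]

/-- The breakpoints of the parts of the tree outside the component of the branching point: the
active edges of each of the three parts in increasing order, together with a fictitious edge `1`,
`n₁ + 1` or `n + 1` at the free end. -/
structure Breakpoints (n₁ n b : ℕ) (S : Finset ℕ) (t₁ t₂ t₃ : ℕ) (M₁ M₂ M₃ : List ℕ) : Prop where
  sorted₁ : (1 :: M₁).Pairwise (· < ·)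
  sorted₂ : (t₂ :: M₂).Pairwise (· < ·)
  sorted₃ : (t₃ :: M₃).Pairwise (· < ·)
  mem₁ : ∀ t, t ∈ 1 :: M₁ ↔ t = 1 ∨ (t ∈ S ∧ t ≤ b)
  mem₂ : ∀ t, t ∈ t₂ :: M₂ ↔ (t ∈ S ∧ b < t ∧ t ≤ n₁) ∨ t = n₁ + 1
  mem₃ : ∀ t, t ∈ t₃ :: M₃ ↔ (t ∈ S ∧ n₁ < t) ∨ t = n + 1
  last₁ : (1 :: M₁).getLast (by simp) = t₁
  last₂ : (t₂ :: M₂).getLast (by simp) = n₁ + 1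
  last₃ : (t₃ :: M₃).getLast (by simp) = n + 1

/-- The signs on the main branch, with the value `0` at the fictitious edges. -/
noncomputable def signMain (n₁ : ℕ) (z : ℕ → ℝ) (t : ℕ) : ℝ :=
  if t = 1 ∨ t = n₁ + 1 then 0 else z t

/-- The signs on the side branch, with the value `0` at the fictitious edge. -/
noncomputable def signSide (n : ℕ) (z : ℕ → ℝ) (t : ℕ) : ℝ := if t = n + 1 then 0 else z t

theorem abs_signMain_le {n₁ : ℕ} {z : ℕ → ℝ} (hz : ∀ t, |z t| = 1) (t : ℕ) :
    |signMain n₁ z t| ≤ 1 := by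
  unfold signMain
  split_ifs
  · simp
  · exact (hz t).le

theorem abs_signSide_le {n : ℕ} {z : ℕ → ℝ} (hz : ∀ t, |z t| = 1) (t : ℕ) :
    |signSide n z t| ≤ 1 := by
  unfold signSide
  split_ifs
  · simp
  · exact (hz t).le

/-- The interpolating vector: truncated linear interpolation between consecutive breakpoints, and
along each of the three legs from the sign of the active edge to the value `p` at the branching
point, where values on the second and third leg are counted towards the branching point. -/
noncomputable def interp (n₁ n b t₁ t₂ t₃ : ℕ) (γ : ℝ) (M₁ M₂ M₃ : List ℕ) (z : ℕ → ℝ)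
    (p : Fin 3 → ℝ) (v : ℕ) : ℝ :=
  if v ≤ t₁ then chain n γ (1 :: M₁) (signMain n₁ z) v
  else if v ≤ b then
    seg n γ ((t₂ - t₁) + (t₃ - n₁ - 1)) (b - t₁) (z t₁) (p 0) (v - t₁)
  else if v < t₂ then
    -seg n γ ((t₂ - t₁) + (t₃ - n₁ - 1)) (t₂ - b - 1) (-z t₂) (p 1) (t₂ - v)
  else if v ≤ n₁ then chain n γ (t₂ :: M₂) (signMain n₁ z) v
  else if v < t₃ then
    -seg n γ ((t₂ - t₁) + (t₃ - n₁ - 1)) (t₃ - n₁ - 1) (-z t₃) (p 2) (t₃ - v)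
  else chain n γ (t₃ :: M₃) (signSide n z) v

theorem exists_consecutive {l : List ℕ} {v x₀ y₀ : ℕ} (hv : v ∉ l) (hx₀ : x₀ ∈ l) (hxv : x₀ < v)
    (hy₀ : y₀ ∈ l) (hvy : v < y₀) :
    ∃ x ∈ l, ∃ y ∈ l, x < v ∧ v < y ∧ ∀ t ∈ l, x < t → y ≤ t := by
  have h1 : (l.toFinset.filter (· < v)).Nonempty := ⟨x₀, by simp [hx₀, hxv]⟩
  have h2 : (l.toFinset.filter (v < ·)).Nonempty := ⟨y₀, by simp [hy₀, hvy]⟩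
  have hx := Finset.max'_mem _ h1
  have hy := Finset.min'_mem _ h2
  simp only [Finset.mem_filter, List.mem_toFinset] at hx hy
  refine ⟨_, hx.1, _, hy.1, hx.2, hy.2, fun t ht hxt => ?_⟩
  refine Finset.min'_le _ _ ?_
  simp only [Finset.mem_filter, List.mem_toFinset]
  refine ⟨ht, lt_of_le_of_ne ?_ fun h => hv (h ▸ ht)⟩
  by_contra hcon
  have := Finset.le_max' (l.toFinset.filter (· < v)) t (by simp [ht]; omega)
  omega

section Interp

variable {n₁ n b t₁ t₂ t₃ : ℕ} {S : Finset ℕ} {M₁ M₂ M₃ : List ℕ} {γ : ℝ} {z : ℕ → ℝ}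
  {p : Fin 3 → ℝ}

theorem interp_of_le_t₁ {v : ℕ} (hv : v ≤ t₁) :
    interp n₁ n b t₁ t₂ t₃ γ M₁ M₂ M₃ z p v = chain n γ (1 :: M₁) (signMain n₁ z) v := by
  rw [interp, if_pos hv]

theorem interp_leg₁ (F : Frame n₁ n b S t₁ t₂ t₃) (T : Breakpoints n₁ n b S t₁ t₂ t₃ M₁ M₂ M₃)
    (hbn : b < n₁) (hz : ∀ t, |z t| = 1) {v : ℕ} (h1 : t₁ ≤ v) (h2 : v ≤ b) :
    interp n₁ n b t₁ t₂ t₃ γ M₁ M₂ M₃ z p v =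
      seg n γ ((t₂ - t₁) + (t₃ - n₁ - 1)) (b - t₁) (z t₁) (p 0) (v - t₁) := by
  rcases h1.eq_or_lt with rfl | h
  · have := F.two_le _ F.mem₁
    rw [interp_of_le_t₁ le_rfl, chain_eq_of_mem T.sorted₁ (fun t _ => abs_signMain_le hz t)
      ((T.mem₁ _).mpr (Or.inr ⟨F.mem₁, F.t₁_le⟩)), signMain, if_neg (by omega), Nat.sub_self,
      seg_zero (hz _).le]
  · rw [interp, if_neg (by omega), if_pos h2]

theorem interp_of_t₂_le (F : Frame n₁ n b S t₁ t₂ t₃) {v : ℕ} (h1 : t₂ ≤ v) (h2 : v ≤ n₁) :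
    interp n₁ n b t₁ t₂ t₃ γ M₁ M₂ M₃ z p v = chain n γ (t₂ :: M₂) (signMain n₁ z) v := by
  have f1 := F.t₁_le
  have f2 := F.lt_t₂
  rw [interp, if_neg (by omega), if_neg (by omega), if_neg (by omega), if_pos h2]

theorem interp_leg₂ (F : Frame n₁ n b S t₁ t₂ t₃) (T : Breakpoints n₁ n b S t₁ t₂ t₃ M₁ M₂ M₃)
    (hz : ∀ t, |z t| = 1) {v : ℕ} (h1 : b < v) (h2 : v ≤ t₂) :
    interp n₁ n b t₁ t₂ t₃ γ M₁ M₂ M₃ z p v =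
      -seg n γ ((t₂ - t₁) + (t₃ - n₁ - 1)) (t₂ - b - 1) (-z t₂) (p 1) (t₂ - v) := by
  have f0 := F.two_le _ F.mem₂
  have f1 := F.t₁_le
  have f2 := F.lt_t₂
  have f3 := F.t₂_le
  rcases h2.eq_or_lt with rfl | h
  · rw [interp_of_t₂_le F le_rfl f3, chain_eq_of_mem T.sorted₂
      (fun t _ => abs_signMain_le hz t) (by simp), signMain, if_neg (by omega), Nat.sub_self,
      seg_zero (by rw [abs_neg]; exact (hz _).le), neg_neg]
  · rw [interp, if_neg (by omega), if_neg (by omega), if_pos h]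

theorem interp_of_t₃_le (F : Frame n₁ n b S t₁ t₂ t₃) {v : ℕ} (h1 : t₃ ≤ v) :
    interp n₁ n b t₁ t₂ t₃ γ M₁ M₂ M₃ z p v = chain n γ (t₃ :: M₃) (signSide n z) v := by
  have f1 := F.t₁_le
  have f2 := F.lt_t₂
  have f3 := F.t₂_le
  have f4 := F.lt_t₃
  rw [interp, if_neg (by omega), if_neg (by omega), if_neg (by omega), if_neg (by omega),
    if_neg (by omega)]

theorem interp_leg₃ (F : Frame n₁ n b S t₁ t₂ t₃) (T : Breakpoints n₁ n b S t₁ t₂ t₃ M₁ M₂ M₃)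
    (hz : ∀ t, |z t| = 1) {v : ℕ} (h1 : n₁ < v) (h2 : v ≤ t₃) :
    interp n₁ n b t₁ t₂ t₃ γ M₁ M₂ M₃ z p v =
      -seg n γ ((t₂ - t₁) + (t₃ - n₁ - 1)) (t₃ - n₁ - 1) (-z t₃) (p 2) (t₃ - v) := by
  have f0 := F.le_n _ F.mem₃
  have f1 := F.t₁_le
  have f2 := F.lt_t₂
  have f3 := F.t₂_le
  rcases h2.eq_or_lt with rfl | h
  · rw [interp_of_t₃_le F le_rfl, chain_eq_of_mem T.sorted₃
      (fun t _ => abs_signSide_le hz t) (by simp), signSide, if_neg (by omega), Nat.sub_self,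
      seg_zero (by rw [abs_neg]; exact (hz _).le), neg_neg]
  · rw [interp, if_neg (by omega), if_neg (by omega), if_neg (by omega), if_neg (by omega),
      if_pos h]

theorem interp_of_mem (F : Frame n₁ n b S t₁ t₂ t₃)
    (T : Breakpoints n₁ n b S t₁ t₂ t₃ M₁ M₂ M₃) (hbn : b < n₁) (hz : ∀ t, |z t| = 1) {t : ℕ}
    (ht : t ∈ S) : interp n₁ n b t₁ t₂ t₃ γ M₁ M₂ M₃ z p t = z t := by
  have h2 := F.two_le t ht
  have hn := F.le_n t ht
  rcases le_or_gt t b with h | h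
  · rw [interp_of_le_t₁ (F.le_t₁ t ht h), chain_eq_of_mem T.sorted₁
      (fun t _ => abs_signMain_le hz t) ((T.mem₁ t).mpr (Or.inr ⟨ht, h⟩)), signMain,
      if_neg (by omega)]
  · rcases le_or_gt t n₁ with h' | h'
    · rw [interp_of_t₂_le F (F.t₂_min t ht h) h', chain_eq_of_mem T.sorted₂
        (fun t _ => abs_signMain_le hz t) ((T.mem₂ t).mpr (Or.inl ⟨ht, h, h'⟩)), signMain,
        if_neg (by omega)]
    · rw [interp_of_t₃_le F (F.t₃_min t ht h'), chain_eq_of_mem T.sorted₃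
        (fun t _ => abs_signSide_le hz t) ((T.mem₃ t).mpr (Or.inl ⟨ht, h'⟩)), signSide,
        if_neg (by omega)]

theorem interp_one (F : Frame n₁ n b S t₁ t₂ t₃) (T : Breakpoints n₁ n b S t₁ t₂ t₃ M₁ M₂ M₃)
    (hz : ∀ t, |z t| = 1) : interp n₁ n b t₁ t₂ t₃ γ M₁ M₂ M₃ z p 1 = 0 := by
  have := F.two_le _ F.mem₁
  rw [interp_of_le_t₁ (by omega), chain_eq_of_mem T.sorted₁
      (fun t _ => abs_signMain_le hz t) (by simp), signMain, if_pos (Or.inl rfl)]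

theorem interp_n_add_one (F : Frame n₁ n b S t₁ t₂ t₃)
    (T : Breakpoints n₁ n b S t₁ t₂ t₃ M₁ M₂ M₃) (hz : ∀ t, |z t| = 1) :
    interp n₁ n b t₁ t₂ t₃ γ M₁ M₂ M₃ z p (n + 1) = 0 := by
  have := F.le_n _ F.mem₃
  rw [interp_of_t₃_le F (by omega), chain_eq_of_mem T.sorted₃
      (fun t _ => abs_signSide_le hz t) ((T.mem₃ _).mpr (Or.inr rfl)), signSide, if_pos rfl]

/-- The divergence of the interpolating vector at the vertices. -/
theorem sum_sq_divergence_le (F : Frame n₁ n b S t₁ t₂ t₃)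
    (T : Breakpoints n₁ n b S t₁ t₂ t₃ M₁ M₂ M₃) (hbn : b < n₁)
    (hz : ∀ t, |z t| = 1) (hγ : 1 < γ) {a : ℝ} (ha : 0 < a) {B : ℕ}
    (hB : B = (t₂ - t₁) + (t₃ - n₁ - 1))
    (hp1 : b - t₁ = 0 → p 0 = z t₁) (hp2 : t₂ - b - 1 = 0 → p 1 = -z t₂)
    (hp3 : t₃ - n₁ - 1 = 0 → p 2 = -z t₃)
    (q : ℕ → ℝ) (hq : q = interp n₁ n b t₁ t₂ t₃ γ M₁ M₂ M₃ z p) :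
    ∑ v ∈ Finset.Icc 1 n,
      (q v - (if v = n₁ then 0 else q (v + 1)) - if v = b then q (n₁ + 1) else 0) ^ 2 ≤
      chainEnergy (1 :: M₁) (signMain n₁ z) + chainEnergy (t₂ :: M₂) (signMain n₁ z) +
      chainEnergy (t₃ :: M₃) (signSide n z) +
      ((p 0 - z t₁) ^ 2 / ((b - t₁ : ℕ) : ℝ) + (p 1 - -z t₂) ^ 2 / ((t₂ - b - 1 : ℕ) : ℝ) +
        (p 2 - -z t₃) ^ 2 / ((t₃ - n₁ - 1 : ℕ) : ℝ) +
        (clip (margin n γ B (b - t₁)) (p 0) + clip (margin n γ B (t₂ - b - 1)) (p 1) +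
          clip (margin n γ B (t₃ - n₁ - 1)) (p 2)) ^ 2) +
      ((M₁.length + M₂.length + M₃.length + 3) * (2 + Real.log a / 2) +
        (n + 2 * B) / (2 * a)) / (n * γ ^ 2) := by
  have f0 := F.two_le _ F.mem₁
  have f1 := F.t₁_le
  have f2 := F.lt_t₂
  have f3 := F.t₂_le
  have f4 := F.lt_t₃
  have f5 := F.le_n _ F.mem₃
  set dv : ℕ → ℝ := fun v =>
    (q v - (if v = n₁ then 0 else q (v + 1)) - if v = b then q (n₁ + 1) else 0) ^ 2 with hdv
  have hq1 : ∀ v, v ≤ t₁ → q v = chain n γ (1 :: M₁) (signMain n₁ z) v := by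
    intro v hv; rw [hq]; exact interp_of_le_t₁ hv
  have hql1 : ∀ v, t₁ ≤ v → v ≤ b → q v = seg n γ B (b - t₁) (z t₁) (p 0) (v - t₁) := by
    intro v h h'; rw [hq, hB]; exact interp_leg₁ F T hbn hz h h'
  have hql2 : ∀ v, b < v → v ≤ t₂ → q v = -seg n γ B (t₂ - b - 1) (-z t₂) (p 1) (t₂ - v) := by
    intro v h h'; rw [hq, hB]; exact interp_leg₂ F T hz h h'
  have hq2 : ∀ v, t₂ ≤ v → v ≤ n₁ → q v = chain n γ (t₂ :: M₂) (signMain n₁ z) v := by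
    intro v h h'; rw [hq]; exact interp_of_t₂_le F h h'
  have hql3 : ∀ v, n₁ < v → v ≤ t₃ → q v = -seg n γ B (t₃ - n₁ - 1) (-z t₃) (p 2) (t₃ - v) := by
    intro v h h'; rw [hq, hB]; exact interp_leg₃ F T hz h h'
  have hq3 : ∀ v, t₃ ≤ v → q v = chain n γ (t₃ :: M₃) (signSide n z) v := by
    intro v h; rw [hq]; exact interp_of_t₃_le F h
  have hend : chain n γ (t₂ :: M₂) (signMain n₁ z) (n₁ + 1) = 0 := by
    rw [chain_eq_of_mem T.sorted₂ (fun t _ => abs_signMain_le hz t)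
      ((T.mem₂ _).mpr (Or.inr rfl)), signMain, if_pos (Or.inr rfl)]
  have hsplit : ∑ v ∈ Finset.Icc 1 n, dv v = ∑ v ∈ Finset.Ico 1 t₁, dv v +
      ∑ v ∈ Finset.Ico t₁ b, dv v + dv b + ∑ v ∈ Finset.Ico (b + 1) t₂, dv v +
      ∑ v ∈ Finset.Ico t₂ (n₁ + 1), dv v + ∑ v ∈ Finset.Ico (n₁ + 1) t₃, dv v +
      ∑ v ∈ Finset.Ico t₃ (n + 1), dv v := by
    have hIcc : Finset.Icc 1 n = Finset.Ico 1 (n + 1) := by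
      ext v; simp only [Finset.mem_Icc, Finset.mem_Ico]; omega
    rw [hIcc, Finset.sum_Ico_consecutive dv (by omega : 1 ≤ t₁) f1,
      ← Finset.sum_Ico_succ_top (by omega : 1 ≤ b),
      Finset.sum_Ico_consecutive dv (by omega : 1 ≤ b + 1) (by omega : b + 1 ≤ t₂),
      Finset.sum_Ico_consecutive dv (by omega : 1 ≤ t₂) (by omega : t₂ ≤ n₁ + 1),
      Finset.sum_Ico_consecutive dv (by omega : 1 ≤ n₁ + 1) (by omega : n₁ + 1 ≤ t₃),
      Finset.sum_Ico_consecutive dv (by omega : 1 ≤ t₃) (by omega : t₃ ≤ n + 1)]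
  have c1 := sum_sq_chain_le (n := n) hγ ha T.sorted₁ (fun t _ => abs_signMain_le (n₁ := n₁) hz t)
  have c2 := sum_sq_chain_le (n := n) hγ ha T.sorted₂ (fun t _ => abs_signMain_le (n₁ := n₁) hz t)
  have c3 := sum_sq_chain_le (n := n) hγ ha T.sorted₃ (fun t _ => abs_signSide_le (n := n) hz t)
  rw [T.last₁] at c1
  rw [T.last₂] at c2
  rw [T.last₃] at c3
  have e1 : ∑ v ∈ Finset.Ico 1 t₁, dv v = ∑ v ∈ Finset.Ico 1 t₁,
      (chain n γ (1 :: M₁) (signMain n₁ z) v -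
        chain n γ (1 :: M₁) (signMain n₁ z) (v + 1)) ^ 2 := by
    refine Finset.sum_congr rfl fun v hv => ?_
    have := Finset.mem_Ico.mp hv
    simp only [hdv]
    rw [if_neg (by omega), if_neg (by omega), hq1 v (by omega), hq1 (v + 1) (by omega), sub_zero]
  have e2 : ∑ v ∈ Finset.Ico t₂ (n₁ + 1), dv v = ∑ v ∈ Finset.Ico t₂ (n₁ + 1),
      (chain n γ (t₂ :: M₂) (signMain n₁ z) v -
        chain n γ (t₂ :: M₂) (signMain n₁ z) (v + 1)) ^ 2 := by
    refine Finset.sum_congr rfl fun v hv => ?_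
    have := Finset.mem_Ico.mp hv
    simp only [hdv]
    rw [if_neg (by omega : ¬ v = b), hq2 v (by omega) (by omega), sub_zero]
    split_ifs with h
    · rw [h, hend]
    · rw [hq2 (v + 1) (by omega) (by omega)]
  have e3 : ∑ v ∈ Finset.Ico t₃ (n + 1), dv v = ∑ v ∈ Finset.Ico t₃ (n + 1),
      (chain n γ (t₃ :: M₃) (signSide n z) v -
        chain n γ (t₃ :: M₃) (signSide n z) (v + 1)) ^ 2 := by
    refine Finset.sum_congr rfl fun v hv => ?_
    have := Finset.mem_Ico.mp hv
    simp only [hdv]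
    rw [if_neg (by omega), if_neg (by omega), hq3 v (by omega), hq3 (v + 1) (by omega), sub_zero]
  have s1 := sum_sq_seg_le (n := n) (B := B) (m := b - t₁) hγ (by omega) (by omega) ha (z t₁) (p 0)
  have s2 := sum_sq_seg_le (n := n) (B := B) (m := t₂ - b - 1) hγ (by omega) (by omega) ha
    (-z t₂) (p 1)
  have s3 := sum_sq_seg_le (n := n) (B := B) (m := t₃ - n₁ - 1) hγ (by omega) (by omega) ha
    (-z t₃) (p 2)
  have l1 : ∑ v ∈ Finset.Ico t₁ b, dv v = ∑ y ∈ Finset.range (b - t₁),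
      (seg n γ B (b - t₁) (z t₁) (p 0) (y + 1) - seg n γ B (b - t₁) (z t₁) (p 0) y) ^ 2 := by
    rw [Finset.sum_Ico_eq_sum_range]
    refine Finset.sum_congr rfl fun y hy => ?_
    have := Finset.mem_range.mp hy
    simp only [hdv]
    rw [if_neg (by omega), if_neg (by omega), hql1 (t₁ + y) (by omega) (by omega),
      hql1 (t₁ + y + 1) (by omega) (by omega), Nat.add_sub_cancel_left,
      (by omega : t₁ + y + 1 - t₁ = y + 1)]
    ring
  have l2 : ∑ v ∈ Finset.Ico (b + 1) t₂, dv v = ∑ y ∈ Finset.range (t₂ - b - 1),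
      (seg n γ B (t₂ - b - 1) (-z t₂) (p 1) (y + 1) -
        seg n γ B (t₂ - b - 1) (-z t₂) (p 1) y) ^ 2 := by
    rw [Finset.sum_Ico_eq_sum_range, ← Nat.sub_sub, ← Finset.sum_range_reflect]
    refine Finset.sum_congr rfl fun y hy => ?_
    have := Finset.mem_range.mp hy
    simp only [hdv]
    rw [if_neg (by omega), if_neg (by omega), hql2 _ (by omega) (by omega),
      hql2 _ (by omega) (by omega),
      (by omega : t₂ - (b + 1 + (t₂ - b - 1 - 1 - y)) = y + 1),
      (by omega : t₂ - (b + 1 + (t₂ - b - 1 - 1 - y) + 1) = y)]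
    ring
  have l3 : ∑ v ∈ Finset.Ico (n₁ + 1) t₃, dv v = ∑ y ∈ Finset.range (t₃ - n₁ - 1),
      (seg n γ B (t₃ - n₁ - 1) (-z t₃) (p 2) (y + 1) -
        seg n γ B (t₃ - n₁ - 1) (-z t₃) (p 2) y) ^ 2 := by
    rw [Finset.sum_Ico_eq_sum_range, ← Nat.sub_sub, ← Finset.sum_range_reflect]
    refine Finset.sum_congr rfl fun y hy => ?_
    have := Finset.mem_range.mp hy
    simp only [hdv]
    rw [if_neg (by omega), if_neg (by omega), hql3 _ (by omega) (by omega),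
      hql3 _ (by omega) (by omega),
      (by omega : t₃ - (n₁ + 1 + (t₃ - n₁ - 1 - 1 - y)) = y + 1),
      (by omega : t₃ - (n₁ + 1 + (t₃ - n₁ - 1 - 1 - y) + 1) = y)]
    ring
  have hbv : dv b = (clip (margin n γ B (b - t₁)) (p 0) + clip (margin n γ B (t₂ - b - 1)) (p 1) +
          clip (margin n γ B (t₃ - n₁ - 1)) (p 2)) ^ 2 := by
    simp only [hdv]
    rw [if_neg (by omega), if_pos trivial, hql1 b f1 le_rfl, hql2 (b + 1) (by omega) (by omega),
      hql3 (n₁ + 1) (by omega) (by omega), ← Nat.sub_sub, ← Nat.sub_sub, seg_end hp1, seg_end hp2,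
      seg_end hp3]
    ring
  rw [hsplit, e1, e2, e3, l1, l2, l3, hbv]
  have hBR : (B : ℝ) = (t₂ - t₁) + (t₃ - n₁ - 1) := by
    rw [hB, Nat.cast_add, Nat.cast_sub (by omega), Nat.cast_sub (by omega),
      Nat.cast_sub (by omega)]
    push_cast; ring
  have hlog : ((M₁.length + M₂.length + M₃.length + 3 : ℝ) * (2 + Real.log a / 2) +
        (n + 2 * B) / (2 * a)) / (n * γ ^ 2) =
      (M₁.length * (2 + Real.log a / 2) + (t₁ - (1 : ℕ) : ℝ) / (2 * a)) / (n * γ ^ 2) +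
      (M₂.length * (2 + Real.log a / 2) + (((n₁ + 1 : ℕ) : ℝ) - t₂) / (2 * a)) / (n * γ ^ 2) +
      (M₃.length * (2 + Real.log a / 2) + (((n + 1 : ℕ) : ℝ) - t₃) / (2 * a)) / (n * γ ^ 2) +
      3 * ((2 + Real.log a / 2 + B / (2 * a)) / (n * γ ^ 2)) := by
    rw [hBR]
    push_cast
    ring
  rw [hlog]
  linarith

end Interp

/-- The interpolating vector is admissible outside the active edges. -/
theorem abs_interp_le {n₁ n₂ b t₁ t₂ t₃ : ℕ} {S : Finset ℕ} {M₁ M₂ M₃ : List ℕ} {γ : ℝ}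
    {z : ℕ → ℝ} {p : Fin 3 → ℝ} (hb : 1 ≤ b) (hbn : b < n₁)
    (F : Frame n₁ (n₁ + n₂) b S t₁ t₂ t₃)
    (T : Breakpoints n₁ (n₁ + n₂) b S t₁ t₂ t₃ M₁ M₂ M₃) (hγ : 1 < γ)
    (e : Edge (n₁ + n₂)) (he : (e : ℕ) ∉ S) :
    |interp n₁ (n₁ + n₂) b t₁ t₂ t₃ γ M₁ M₂ M₃ z p e| ≤
      1 - √((∑ v, edgeResidual n₁ n₂ S hb e v ^ 2) / ((n₁ + n₂ : ℕ) : ℝ)) / γ := by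
  have f1 := F.t₁_le
  have f2 := F.lt_t₂
  have f3 := F.t₂_le
  have f4 := F.lt_t₃
  have f5 := F.le_n _ F.mem₃
  have f6 := F.two_le _ F.mem₁
  have hee := Finset.mem_Icc.mp e.2
  have hn0 : 0 < n₁ + n₂ := by omega
  have hmargin : ∀ B y : ℕ, ∑ v, edgeResidual n₁ n₂ S hb e v ^ 2 ≤ profile B y →
      margin (n₁ + n₂) γ B y ≤
        1 - √((∑ v, edgeResidual n₁ n₂ S hb e v ^ 2) / ((n₁ + n₂ : ℕ) : ℝ)) / γ := by
    intro B y h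
    unfold margin
    refine sub_le_sub_left (div_le_div_of_nonneg_right (Real.sqrt_le_sqrt ?_) (by linarith)) _
    exact div_le_div_of_nonneg_right h (by positivity)
  set B := (t₂ - t₁) + (t₃ - n₁ - 1) with hB
  rcases le_or_gt (e : ℕ) t₁ with h1 | h1
  · have hmem : (e : ℕ) ∉ 1 :: M₁ := fun h => by
      rcases (T.mem₁ _).mp h with h' | h'
      · omega
      · exact he h'.1
    have hlt : (e : ℕ) < t₁ := lt_of_le_of_ne h1 fun h => he (h ▸ F.mem₁)
    obtain ⟨x, hx, y, hy, hxe, hey, hno⟩ := exists_consecutive hmem (by simp) (by omega : 1 < (e : ℕ))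
      ((T.mem₁ t₁).mpr (Or.inr ⟨F.mem₁, f1⟩)) hlt
    have hx' := (T.mem₁ x).mp hx
    have hy' := (T.mem₁ y).mp hy
    have hyt : y ≤ t₁ := by
      rcases hy' with h | h
      · omega
      · exact F.le_t₁ y h.1 h.2
    rw [interp_of_le_t₁ h1, chain_eq_seg T.sorted₁ hx hy hxe.le hey hno]
    refine (abs_seg_le hγ hn0 (by omega) _ _ _ _).trans (hmargin _ _
      (edgeResidual_sq_le_of_path hb hbn F e (by tauto) (Or.inl ?_) (fun t ht hxt => ?_) hxe hey
        (Or.inl hyt)))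
    · rcases hy' with h | h
      · omega
      · exact h.1
    · rcases le_or_gt t b with h | h
      · exact hno t ((T.mem₁ t).mpr (Or.inr ⟨ht, h⟩)) hxt
      · omega
  rcases le_or_gt (e : ℕ) b with h2 | h2
  · rw [interp, if_neg (by omega), if_pos h2]
    exact (abs_seg_le hγ hn0 (by omega) _ _ _ _).trans (hmargin _ _
      (edgeResidual_sq_le_of_leg₁ hb hbn F e h1 h2 hB))
  rcases lt_or_ge (e : ℕ) t₂ with h3 | h3
  · rw [interp, if_neg (by omega), if_neg (by omega), if_pos h3, abs_neg]
    exact (abs_seg_le hγ hn0 (by omega) _ _ _ _).trans (hmargin _ _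
      (edgeResidual_sq_le_of_leg₂ hb hbn F e h2 h3 hB))
  rcases le_or_gt (e : ℕ) n₁ with h4 | h4
  · have hmem : (e : ℕ) ∉ t₂ :: M₂ := fun h => by
      rcases (T.mem₂ _).mp h with h' | h'
      · exact he h'.1
      · omega
    have hlt : t₂ < (e : ℕ) := lt_of_le_of_ne h3 fun h => he (h ▸ F.mem₂)
    obtain ⟨x, hx, y, hy, hxe, hey, hno⟩ := exists_consecutive hmem (by simp) hlt
      ((T.mem₂ (n₁ + 1)).mpr (Or.inr rfl)) (by omega)
    have hx' := (T.mem₂ x).mp hx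
    have hy' := (T.mem₂ y).mp hy
    have hxt : t₂ ≤ x := by
      rcases hx' with h | h
      · exact F.t₂_min x h.1 h.2.1
      · omega
    rw [interp_of_t₂_le F h3 h4, chain_eq_seg T.sorted₂ hx hy hxe.le hey hno]
    refine (abs_seg_le hγ hn0 (by omega) _ _ _ _).trans (hmargin _ _
      (edgeResidual_sq_le_of_path hb hbn F e (Or.inr ?_) (by tauto) (fun t ht hxt => ?_) hxe hey
        (Or.inr (Or.inl ⟨hxt, by omega⟩))))
    · rcases hx' with h | h
      · exact h.1
      · omega
    · rcases le_or_gt t n₁ with h | h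
      · exact hno t ((T.mem₂ t).mpr (Or.inl ⟨ht, by omega, h⟩)) hxt
      · omega
  rcases lt_or_ge (e : ℕ) t₃ with h5 | h5
  · rw [interp, if_neg (by omega), if_neg (by omega), if_neg (by omega), if_neg (by omega),
      if_pos h5, abs_neg]
    exact (abs_seg_le hγ hn0 (by omega) _ _ _ _).trans (hmargin _ _
      (edgeResidual_sq_le_of_leg₃ hb hbn F e h4 h5 hB))
  · have hmem : (e : ℕ) ∉ t₃ :: M₃ := fun h => by
      rcases (T.mem₃ _).mp h with h' | h'
      · exact he h'.1
      · omega
    have hlt : t₃ < (e : ℕ) := lt_of_le_of_ne h5 fun h => he (h ▸ F.mem₃)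
    obtain ⟨x, hx, y, hy, hxe, hey, hno⟩ := exists_consecutive hmem (by simp) hlt
      ((T.mem₃ (n₁ + n₂ + 1)).mpr (Or.inr rfl)) (by omega)
    have hx' := (T.mem₃ x).mp hx
    have hy' := (T.mem₃ y).mp hy
    have hyn : y ≤ n₁ + n₂ + 1 := by
      rcases hy' with h | h
      · have := F.le_n y h.1; omega
      · omega
    have hxt : t₃ ≤ x := by
      rcases hx' with h | h
      · exact F.t₃_min x h.1 h.2
      · omega
    rw [interp_of_t₃_le F h5, chain_eq_seg T.sorted₃ hx hy hxe.le hey hno]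
    refine (abs_seg_le hγ hn0 (by omega) _ _ _ _).trans (hmargin _ _
      (edgeResidual_sq_le_of_path hb hbn F e (Or.inr ?_) (by tauto) (fun t ht hxt => ?_) hxe hey
        (Or.inr (Or.inr hxt))))
    · rcases hx' with h | h
      · exact h.1
      · omega
    · exact hno t ((T.mem₃ t).mpr (Or.inl ⟨ht, by omega⟩)) hxt

end BranchedPath

/-! ### The oracle inequality for the branched path -/

namespace BranchedPath

theorem card_parts {n₁ b : ℕ} (hbn : b < n₁) (S : Finset ℕ) :
    (S₁ b S).card + (S₂ n₁ b S).card + (S₃ n₁ S).card = S.card := by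
  have h1 : S₂ n₁ b S ∪ S₃ n₁ S = S.filter fun t => ¬ t ≤ b := by
    ext t; simp only [S₂, S₃, Finset.mem_union, Finset.mem_filter]
    constructor
    · rintro (h | h)
      · exact ⟨h.1, by omega⟩
      · exact ⟨h.1, by omega⟩
    · rintro ⟨h, h'⟩
      by_cases hn : t ≤ n₁
      · exact Or.inl ⟨h, by omega, hn⟩
      · exact Or.inr ⟨h, by omega⟩
  have h2 : Disjoint (S₂ n₁ b S) (S₃ n₁ S) := by
    rw [Finset.disjoint_left]
    intro t
    simp only [S₂, S₃, Finset.mem_filter]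
    omega
  rw [add_assoc, ← Finset.card_union_of_disjoint h2, h1, S₁]
  exact Finset.card_filter_add_card_filter_not _

theorem four_mul_card_le {T : Finset ℕ} (hT : T.Nonempty) (hg : ∀ g ∈ gaps T, 4 ≤ g) :
    first T + 4 * T.card ≤ last T + 4 ∧ 0 < T.card ∧ (gaps T).length + 1 = T.card := by
  obtain ⟨x, l, -, hpw, -, hf, hla, hga, hlen⟩ := exists_sort_eq_cons hT
  have h1 := sum_listGaps hpw
  have h2 : (listGaps (x :: l)).length * 4 ≤ (listGaps (x :: l)).sum := by
    simpa using List.card_nsmul_le_sum (listGaps (x :: l)) 4 (hga ▸ hg)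
  have h3 := length_listGaps x l
  rw [hf, hla, hga]
  omega

/-- The breakpoints of a branched path with `n` vertices, and the energy of the interpolation of
signs between them. -/
theorem exists_breakpoints {n₁ n₂ b : ℕ} {S : Finset ℕ} {d : Fin 3 → ℕ}
    (h : Setting n₁ n₂ b S d) :
    ∃ M₁ M₂ M₃ : List ℕ, Breakpoints n₁ (n₁ + n₂) b S (last (S₁ b S)) (first (S₂ n₁ b S))
      (first (S₃ n₁ S)) M₁ M₂ M₃ ∧ M₁.length + M₂.length + M₃.length = S.card ∧
      ∀ z : ℕ → ℝ, (∀ t, |z t| = 1) →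
        chainEnergy (1 :: M₁) (signMain n₁ z) +
          chainEnergy (first (S₂ n₁ b S) :: M₂) (signMain n₁ z) +
          chainEnergy (first (S₃ n₁ S) :: M₃) (signSide (n₁ + n₂) z) ≤
        1 / (dStart b S : ℝ) + 1 / (dEnd₂ n₁ b S : ℝ) + 1 / (dEnd₃ n₁ n₂ S : ℝ) +
        2 * (recipSum (halves (gaps (S₁ b S))) + recipSum (halves (gaps (S₂ n₁ b S))) +
          recipSum (halves (gaps (S₃ n₁ S)))) := by
  have hbn := h.b_lt
  have F := h.frame
  have hcard := card_parts hbn S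
  obtain ⟨x₁, l₁, -, hp1, hm1, hf1, hl1, hg1, hc1⟩ := exists_sort_eq_cons h.nonempty₁
  obtain ⟨x₂, l₂, -, hp2, hm2, hf2, hl2, hg2, hc2⟩ := exists_sort_eq_cons h.nonempty₂
  obtain ⟨x₃, l₃, -, hp3, hm3, hf3, hl3, hg3, hc3⟩ := exists_sort_eq_cons h.nonempty₃
  have hb1 : ∀ t ∈ x₁ :: l₁, 2 ≤ t ∧ t ≤ b := fun t ht => by
    have := (hm1 t).mp ht
    simp only [S₁, Finset.mem_filter] at this
    exact ⟨F.two_le t this.1, this.2⟩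
  have hb2 : ∀ t ∈ x₂ :: l₂, 2 ≤ t ∧ b < t ∧ t ≤ n₁ := fun t ht => by
    have := (hm2 t).mp ht
    simp only [S₂, Finset.mem_filter] at this
    exact ⟨F.two_le t this.1, this.2⟩
  have hb3 : ∀ t ∈ x₃ :: l₃, 2 ≤ t ∧ n₁ < t ∧ t ≤ n₁ + n₂ := fun t ht => by
    have := (hm3 t).mp ht
    simp only [S₃, Finset.mem_filter] at this
    exact ⟨F.two_le t this.1, this.2, F.le_n t this.1⟩
  rw [hl1, hf2, hf3]
  refine ⟨x₁ :: l₁, l₂ ++ [n₁ + 1], l₃ ++ [n₁ + n₂ + 1], ⟨?_, ?_, ?_, ?_, ?_, ?_, ?_, ?_, ?_⟩,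
    ?_, ?_⟩
  · exact List.pairwise_cons.mpr ⟨fun t ht => (hb1 t ht).1, hp1⟩
  · rw [← List.cons_append, List.pairwise_append]
    refine ⟨hp2, by simp, fun t ht u hu => ?_⟩
    have := hb2 t ht
    simp only [List.mem_singleton] at hu
    omega
  · rw [← List.cons_append, List.pairwise_append]
    refine ⟨hp3, by simp, fun t ht u hu => ?_⟩
    have := hb3 t ht
    simp only [List.mem_singleton] at hu
    omega
  · intro t
    rw [List.mem_cons, hm1]
    simp [S₁]
  · intro t
    rw [← List.cons_append, List.mem_append, hm2]
    simp [S₂]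
  · intro t
    rw [← List.cons_append, List.mem_append, hm3]
    simp [S₃]
  · rw [List.getLast_cons (by simp)]
  · simp only [← List.cons_append, List.getLast_append_singleton]
  · simp only [← List.cons_append, List.getLast_append_singleton]
  · simp only [List.length_cons, List.length_append, List.length_nil]
    omega
  · intro z hz
    have z1 : ∀ t ∈ x₁ :: l₁, |signMain n₁ z t| = 1 := fun t ht => by
      have := hb1 t ht
      rw [signMain, if_neg (by omega), hz]
    have z2 : ∀ t ∈ x₂ :: l₂, |signMain n₁ z t| = 1 := fun t ht => by
      have := hb2 t ht
      rw [signMain, if_neg (by omega), hz]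
    have z3 : ∀ t ∈ x₃ :: l₃, |signSide (n₁ + n₂) z t| = 1 := fun t ht => by
      have := hb3 t ht
      rw [signSide, if_neg (by omega), hz]
    have e1 := chainEnergy_le z1 (hg1 ▸ h.gaps₁)
    have e2 := chainEnergy_le z2 (hg2 ▸ h.gaps₂)
    have e3 := chainEnergy_le z3 (hg3 ▸ h.gaps₃)
    rw [chainEnergy_cons_cons_of_zero l₁ (by simp [signMain]) (z1 x₁ (by simp)),
      ← List.cons_append, chainEnergy_append_of_zero l₂ (by simp [signMain]) z2,
      ← List.cons_append, chainEnergy_append_of_zero l₃ (by simp [signSide]) z3]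
    have d1 : x₁ - 1 = dStart b S := by rw [dStart, hf1]
    have d2 : n₁ + 1 - (x₂ :: l₂).getLast (by simp) = dEnd₂ n₁ b S := by
      have := hb2 _ (List.getLast_mem (l := x₂ :: l₂) (by simp))
      rw [dEnd₂, hl2]; omega
    have d3 : n₁ + n₂ + 1 - (x₃ :: l₃).getLast (by simp) = dEnd₃ n₁ n₂ S := by
      have := hb3 _ (List.getLast_mem (l := x₃ :: l₃) (by simp))
      rw [dEnd₃, hl3]; omega
    rw [d1, d2, d3, hg1, hg2, hg3]
    linarith

theorem recipSum_Δ (n₁ n₂ b : ℕ) (S : Finset ℕ) (d : Fin 3 → ℕ) :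
    recipSum (Δ n₁ n₂ b S d) =
      1 / (dStart b S : ℝ) + 1 / (dEnd₂ n₁ b S : ℝ) + 1 / (dEnd₃ n₁ n₂ S : ℝ) +
      (recipSum (halves (gaps (S₁ b S))) + recipSum (halves (gaps (S₂ n₁ b S))) +
        recipSum (halves (gaps (S₃ n₁ S)))) + ∑ m, 1 / (d m : ℝ) := by
  rw [Fin.sum_univ_three]
  simp only [Δ, recipSum_append, recipSum_cons, recipSum_nil]
  ring

theorem length_Δ {n₁ n₂ b : ℕ} {S : Finset ℕ} {d : Fin 3 → ℕ} (h : Setting n₁ n₂ b S d) :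
    (Δ n₁ n₂ b S d).length = 2 * S.card := by
  have hcard := card_parts h.b_lt S
  have h1 := (four_mul_card_le h.nonempty₁ h.gaps₁).2.2
  have h2 := (four_mul_card_le h.nonempty₂ h.gaps₂).2.2
  have h3 := (four_mul_card_le h.nonempty₃ h.gaps₃).2.2
  simp only [Δ, List.length_append, List.length_cons, List.length_nil, length_halves]
  omega

theorem harmonicMean_Δ {n₁ n₂ b : ℕ} {S : Finset ℕ} {d : Fin 3 → ℕ} (h : Setting n₁ n₂ b S d) :
    harmonicMean (Δ n₁ n₂ b S d) = 2 * S.card / recipSum (Δ n₁ n₂ b S d) := by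
  rw [harmonicMean, length_Δ h]
  push_cast
  rfl

/-- The assumptions force many vertices per active edge. -/
theorem Setting.card_bounds {n₁ n₂ b : ℕ} {S : Finset ℕ} {d : Fin 3 → ℕ}
    (h : Setting n₁ n₂ b S d) (h1 : 4 ≤ dStart b S) (h2 : 4 ≤ dEnd₂ n₁ b S)
    (h3 : 4 ≤ dEnd₃ n₁ n₂ S) : 3 ≤ S.card ∧ 4 * S.card + 6 ≤ n₁ + n₂ := by
  have F := h.frame
  have hcard := card_parts h.b_lt S
  obtain ⟨g1, c1, -⟩ := four_mul_card_le h.nonempty₁ h.gaps₁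
  obtain ⟨g2, c2, -⟩ := four_mul_card_le h.nonempty₂ h.gaps₂
  obtain ⟨g3, c3, -⟩ := four_mul_card_le h.nonempty₃ h.gaps₃
  obtain ⟨hd, i, j, l, hij, hil, hjl, k, hk, hdi, hdj, hdl⟩ := h.split
  have hsum := sum_fin_three_of_ne (fun m => (leg n₁ b S m : ℝ)) hij hil hjl
  rw [Fin.sum_univ_three] at hsum
  have hsum' : leg n₁ b S 0 + leg n₁ b S 1 + leg n₁ b S 2 =
      leg n₁ b S i + leg n₁ b S j + leg n₁ b S l := by exact_mod_cast hsum
  have hleg : leg n₁ b S 0 + leg n₁ b S 1 + leg n₁ b S 2 =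
      (b - last (S₁ b S) + 1 - 1) + (first (S₂ n₁ b S) - b - 1) + (first (S₃ n₁ S) - n₁ - 1) := by
    simp [leg, β₁, β₂, β₃]
  have := hd i
  have := hd j
  have := hd l
  have f1 := F.t₁_le
  have f2 := F.lt_t₂
  have f3 := F.t₂_le
  have f4 := F.lt_t₃
  unfold dStart at h1
  unfold dEnd₂ at h2
  unfold dEnd₃ at h3
  omega

/-- The energies of the profiles, linearised at the mean size `a` of a piece, stay below the
logarithmic term of the oracle inequality. -/
theorem log_budget {n s : ℕ} (hs : 3 ≤ s) (hn : 4 * s + 6 ≤ n) {B : ℕ} (hB : B ≤ n) :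
    ((s : ℝ) + 3) * (2 + Real.log (((n : ℝ) + 1) / (2 * s + 3)) / 2) +
        (n + 2 * B) / (2 * (((n : ℝ) + 1) / (2 * s + 3))) ≤
      5 * (2 * s + 3) * Real.log (((n : ℝ) + 1) / (2 * s + 3)) := by
  have hsR : (3 : ℝ) ≤ s := by exact_mod_cast hs
  have hnR : 4 * (s : ℝ) + 6 ≤ n := by exact_mod_cast hn
  have hBR : (B : ℝ) ≤ n := by exact_mod_cast hB
  set a : ℝ := ((n : ℝ) + 1) / (2 * s + 3) with ha
  have ha2 : 2 ≤ a := by rw [ha, le_div_iff₀ (by positivity)]; linarith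
  have hlog : 0.69 ≤ Real.log a :=
    le_trans (by linarith [Real.log_two_gt_d9]) (Real.log_le_log (by norm_num) ha2)
  have h1 : ((n : ℝ) + 2 * B) / (2 * a) ≤ 3 / 2 * (2 * s + 3) := by
    rw [div_le_iff₀ (by linarith)]
    have : a * (2 * s + 3) = n + 1 := by rw [ha]; field_simp
    nlinarith
  nlinarith

/-- Every choice of signs on the active edges extends to an admissible vector on the edges whose
divergence has small energy. -/
theorem exists_interpolating_vector {n₁ n₂ b : ℕ} {S : Finset ℕ} {d : Fin 3 → ℕ}
    (h : Setting n₁ n₂ b S d) (h1 : 4 ≤ dStart b S) (h2 : 4 ≤ dEnd₂ n₁ b S)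
    (h3 : 4 ≤ dEnd₃ n₁ n₂ S) {γ : ℝ} (hγ : 1 < γ) {n : ℕ} (hn : n = n₁ + n₂)
    (z : Edge (n₁ + n₂) → ℝ) (hz : ∀ e, |z e| = 1) :
    ∃ q : Edge (n₁ + n₂) → ℝ, (∀ e ∈ activeEdges (n₁ + n₂) S, q e = z e) ∧
      (∀ e ∉ activeEdges (n₁ + n₂) S,
        |q e| ≤ 1 - √((∑ v, edgeResidual n₁ n₂ S h.b_pos e v ^ 2) / n) / γ) ∧
      ∑ v, (∑ e, D n₁ n₂ b e v * q e) ^ 2 ≤ 2 * recipSum (Δ n₁ n₂ b S d) +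
        5 * (2 * S.card + 3) * Real.log (((n : ℝ) + 1) / (2 * S.card + 3)) / (n * γ ^ 2) := by
  obtain ⟨hs3, hns⟩ := h.card_bounds h1 h2 h3
  rw [← hn] at hns
  have hb := h.b_pos
  have hbn := h.b_lt
  have F := h.frame
  obtain ⟨M₁, M₂, M₃, T, hlen, hE⟩ := exists_breakpoints h
  set t₁ := last (S₁ b S)
  set t₂ := first (S₂ n₁ b S)
  set t₃ := first (S₃ n₁ S)
  have f1 := F.t₁_le
  have f2 := F.lt_t₂
  have f3 := F.t₂_le
  have f4 := F.lt_t₃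
  have f5 := F.le_n _ F.mem₃
  have f6 := F.two_le _ F.mem₁
  set zz : ℕ → ℝ := fun t => if ht : t ∈ Finset.Icc 2 (n₁ + n₂) then z ⟨t, ht⟩ else 1 with hzz
  have hzz1 : ∀ t, |zz t| = 1 := by
    intro t
    simp only [hzz]
    split_ifs
    · exact hz _
    · simp
  set B := (t₂ - t₁) + (t₃ - n₁ - 1) with hB
  have hBn : B ≤ n := by omega
  have l0 : leg n₁ b S 0 = b - t₁ := by
    change b - t₁ + 1 - 1 = b - t₁
    omega
  have l1 : leg n₁ b S 1 = t₂ - b - 1 := rfl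
  have l2 : leg n₁ b S 2 = t₃ - n₁ - 1 := rfl
  obtain ⟨p, -, hp0, hpc⟩ := exists_star_values (n := n) (B := B) (a := leg n₁ b S) (d := d) hγ
    (by omega) (by rw [l0, l1, l2]; omega) hBn h.split.1 h.split.2 ![zz t₁, -zz t₂, -zz t₃]
    (by intro m; fin_cases m <;> simp [hzz1])
  set a : ℝ := ((n : ℝ) + 1) / (2 * S.card + 3) with ha
  have ha0 : 0 < a := by positivity
  set q : ℕ → ℝ := interp n₁ (n₁ + n₂) b t₁ t₂ t₃ γ M₁ M₂ M₃ zz p with hq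
  refine ⟨fun e => q e, fun e he => ?_, fun e he => ?_, ?_⟩
  · have heS : (e : ℕ) ∈ S := by simpa [activeEdges] using he
    simp only [hq]
    rw [interp_of_mem F T hbn hzz1 heS]
    simp only [hzz]
    rw [dif_pos e.2]
  · have heS : (e : ℕ) ∉ S := by simpa [activeEdges] using he
    rw [hn]
    exact abs_interp_le hb hbn F T hγ e heS
  · have hp00 := hp0 0
    have hp01 := hp0 1
    have hp02 := hp0 2
    rw [l0] at hp00
    rw [l1] at hp01
    rw [l2] at hp02
    have hdiv := sum_sq_divergence_le F T hbn hzz1 hγ ha0 hB (p := p) hp00 hp01 hp02 q hq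
    rw [Fin.sum_univ_three, Fin.sum_univ_three, l0, l1, l2] at hpc
    have hpc' : (p 0 - zz t₁) ^ 2 / ((b - t₁ : ℕ) : ℝ) +
        (p 1 - -zz t₂) ^ 2 / ((t₂ - b - 1 : ℕ) : ℝ) +
        (p 2 - -zz t₃) ^ 2 / ((t₃ - n₁ - 1 : ℕ) : ℝ) +
        (clip (margin n γ B (b - t₁)) (p 0) + clip (margin n γ B (t₂ - b - 1)) (p 1) +
          clip (margin n γ B (t₃ - n₁ - 1)) (p 2)) ^ 2 ≤ 2 * ∑ m, 1 / (d m : ℝ) := hpc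
    have hsum : ∑ v : Vertex (n₁ + n₂), (∑ e : Edge (n₁ + n₂), D n₁ n₂ b e v * q e) ^ 2 =
        ∑ v ∈ Finset.Icc 1 (n₁ + n₂),
          (q v - (if v = n₁ then 0 else q (v + 1)) - if v = b then q (n₁ + 1) else 0) ^ 2 := by
      rw [Finset.sum_congr rfl fun v _ => by
        rw [sum_D_mul hb hbn h.n₂_pos q (interp_one F T hzz1) (interp_n_add_one F T hzz1) v]]
      exact sum_vertex_eq (n := n₁ + n₂) (fun v : ℕ =>
        (q v - (if v = n₁ then 0 else q (v + 1)) - if v = b then q (n₁ + 1) else 0) ^ 2)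
    have hlenR : (M₁.length : ℝ) + M₂.length + M₃.length = S.card := by exact_mod_cast hlen
    rw [hsum]
    rw [← hn, hlenR] at hdiv
    rw [← hn]
    have hbud := div_le_div_of_nonneg_right (log_budget hs3 hns hBn)
      (by positivity : (0 : ℝ) ≤ n * γ ^ 2)
    have hEz := hE zz hzz1
    rw [← hn] at hEz
    rw [recipSum_Δ]
    have hpos : 0 ≤ 1 / (dStart b S : ℝ) + 1 / (dEnd₂ n₁ b S : ℝ) + 1 / (dEnd₃ n₁ n₂ S : ℝ) := by
      positivity
    linarith

theorem normSq_sub {n : ℕ} (f g : Vertex n → ℝ) :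
    normSq (f - g) = (1 / (n : ℝ)) * ∑ v, (f v - g v) ^ 2 := rfl

theorem tvOff_eq (n₁ n₂ b : ℕ) (S : Finset ℕ) (f : Vertex (n₁ + n₂) → ℝ) :
    tvOff n₁ n₂ b S f = ∑ e ∈ (activeEdges (n₁ + n₂) S)ᶜ, |(D n₁ n₂ b *ᵥ f) e| := by
  unfold tvOff
  congr 1
  ext e
  simp [activeEdges]

/-- The oracle inequality, simultaneously for all oracles `f`, and without the term in `ζ`. -/
theorem oracle_inequality_prob {σ γ δ : ℝ} (hσ : 0 < σ) (hγ : 1 < γ) (hδ₀ : 0 < δ) (hδ₁ : δ < 1)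
    {n₁ n₂ b : ℕ} {S : Finset ℕ} {d : Fin 3 → ℕ} (h : Setting n₁ n₂ b S d)
    (h1 : 4 ≤ dStart b S) (h2 : 4 ≤ dEnd₂ n₁ b S) (h3 : 4 ≤ dEnd₃ n₁ n₂ S)
    {n s : ℕ} {lam : ℝ} (hn : n = n₁ + n₂) (hs : s = S.card) (hlam : lam = tuning n s σ γ δ)
    {Ω : Type*} [MeasurableSpace Ω] (P : Measure Ω)
    (f₀ : Vertex (n₁ + n₂) → ℝ) (ε fhat : Ω → Vertex (n₁ + n₂) → ℝ)
    (hε : HasLaw ε (noiseLaw (n₁ + n₂) σ) P)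
    (hfhat : ∀ ω, IsTVEstimator n₁ n₂ b lam (f₀ + ε ω) (fhat ω)) :
    ENNReal.ofReal (1 - δ) ≤ P {ω | ∀ f : Vertex (n₁ + n₂) → ℝ,
      normSq (fhat ω - f₀) ≤ normSq (f - f₀) + 4 * lam * tvOff n₁ n₂ b S f
        + 8 * Real.log (2 / δ) * σ ^ 2 / n + 4 * σ ^ 2 * ((s + 1) / n)
        + 8 * σ ^ 2 * Real.log (4 * ((n : ℝ) - s - 1) / δ) *
          (2 * γ ^ 2 * s / harmonicMean (Δ n₁ n₂ b S d)
            + 5 * (2 * s + 3) / (2 * n) * Real.log ((n + 1) / (2 * s + 3)))} := by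
  obtain ⟨hs3, hns⟩ := h.card_bounds h1 h2 h3
  rw [← hn, ← hs] at hns
  rw [← hs] at hs3
  have hb := h.b_pos
  have hbn := h.b_lt
  have hnR : 4 * (s : ℝ) + 6 ≤ n := by exact_mod_cast hns
  have hsR : (3 : ℝ) ≤ s := by exact_mod_cast hs3
  have hn0 : (0 : ℝ) < n := by linarith
  set L := Real.log (4 * ((n : ℝ) - s - 1) / δ) with hL
  have hm : 1 ≤ (n : ℝ) - s - 1 := by linarith
  have hL0 : 0 ≤ L := by
    refine Real.log_nonneg ?_
    rw [le_div_iff₀ hδ₀]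
    linarith
  set c := component n₁ n₂ S hb with hc
  set r := edgeResidual n₁ n₂ S hb with hr
  set A := activeEdges (n₁ + n₂) S with hA
  have horth := cellVec_orthonormal c (component_surjective hb hbn h.subset)
  have hcardK : Fintype.card ↥(insert 1 S) = s + 1 := by
    rw [Fintype.card_coe, Finset.card_insert_of_notMem, hs]
    intro h1S
    have := Finset.mem_Icc.mp (h.subset h1S)
    omega
  have hcardA : 4 * ((Aᶜ.card : ℕ) : ℝ) * Real.exp (-L) ≤ δ := by
    rw [hA, card_compl_activeEdges h.subset, ← hn, ← hs, hL, Real.exp_neg,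
      Real.exp_log (by positivity), inv_div, Nat.cast_sub (by omega), Nat.cast_sub (by omega)]
    push_cast
    refine le_of_eq ?_
    have h5 : (n : ℝ) - s - 1 ≠ 0 := by linarith
    have h6 : (n : ℝ) - 1 - s = n - s - 1 := by ring
    rw [h6]
    field_simp
  have hnotA : ∀ e, e ∈ Aᶜ → (e : ℕ) ∉ S := fun e he => by
    simpa [hA, activeEdges] using he
  have hgood := gaussian_good_event hσ hL0 hδ₀ (cellVec c) horth Aᶜ hcardA r
    (fun e => √(∑ v, r e v ^ 2))
    (fun e he => Real.sqrt_pos.mpr (edgeResidual_sq_pos hb hbn h.subset e (hnotA e he)))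
    (fun e _ => (Real.sq_sqrt (Finset.sum_nonneg fun v _ => sq_nonneg _)).ge)
  set G := {x : Vertex (n₁ + n₂) → ℝ | ∑ k, (∑ i, cellVec c k i * x i) ^ 2 ≤
          σ ^ 2 * (2 * Fintype.card ↥(insert 1 S) + 4 * Real.log (2 / δ)) ∧
        ∀ e ∈ Aᶜ, |∑ i, r e i * x i| ≤ σ * √(∑ v, r e v ^ 2) * √(2 * L)} with hG
  have hmap : P.map ε G ≤ P (ε ⁻¹' G) := by
    have hGm : MeasurableSet G := by
      have hset : G = {x | ∑ k, (∑ i, cellVec c k i * x i) ^ 2 ≤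
          σ ^ 2 * (2 * Fintype.card ↥(insert 1 S) + 4 * Real.log (2 / δ))} ∩
          ⋂ e ∈ Aᶜ, {x | |∑ i, r e i * x i| ≤ σ * √(∑ v, r e v ^ 2) * √(2 * L)} := by
        ext x; simp [hG]
      rw [hset]
      refine (measurableSet_le (by fun_prop) measurable_const).inter
        (Finset.measurableSet_biInter _ fun e _ => measurableSet_le ?_ measurable_const)
      have hlin : Measurable fun x : Vertex (n₁ + n₂) → ℝ => ∑ i, r e i * x i := by fun_prop
      exact hlin.abs
    rw [Measure.map_apply_of_aemeasurable hε.aemeasurable hGm]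
  refine (hgood.trans ?_).trans (measure_mono (μ := P) (s := ε ⁻¹' G) fun ω hω f => ?_)
  · rw [hε.map_eq] at hmap
    exact hmap
  obtain ⟨hω1, hω2⟩ := hω
  have hnc : ((n₁ + n₂ : ℕ) : ℝ) = n := by rw [hn]
  have hlam0 : 0 ≤ lam := by rw [hlam, tuning]; positivity
  have hmin : ∀ f : Vertex (n₁ + n₂) → ℝ, ∑ v, (f₀ v + ε ω v - fhat ω v) ^ 2 +
      2 * (n * lam) * ∑ e, |(D n₁ n₂ b *ᵥ fhat ω) e| ≤
      ∑ v, (f₀ v + ε ω v - f v) ^ 2 + 2 * (n * lam) * ∑ e, |(D n₁ n₂ b *ᵥ f) e| := by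
    intro f
    have h5 := mul_le_mul_of_nonneg_left (hfhat ω f) hn0.le
    rw [normSq_sub, normSq_sub, tv, tv, hnc] at h5
    have h6 : ∀ x y : ℝ, (n : ℝ) * (1 / n * x + 2 * lam * y) = x + 2 * (n * lam) * y := by
      intro x y; field_simp
    rw [h6, h6] at h5
    exact h5
  have hΛw : ∀ R : ℝ, n * lam * (√(R / n) / γ) = σ * √R * √(2 * L) := by
    intro R
    rw [hlam, tuning, Real.sqrt_div' _ hn0.le, Real.sqrt_div' _ hn0.le]
    have h5 : √(n : ℝ) ≠ 0 := (Real.sqrt_pos.mpr hn0).ne'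
    have h6 : √(n : ℝ) ^ 2 = n := Real.sq_sqrt hn0.le
    have h7 : γ ≠ 0 := by linarith
    field_simp
    rw [h6, ← hL]
    ring
  have horacle := oracle_inequality (D n₁ n₂ b) (Λ := n * lam) (by positivity) A (cellVec c)
    (bessel horth) r (tree_decomposition hb hbn h.subset)
    (fun e => √((∑ v, r e v ^ 2) / n) / γ)
    (exists_interpolating_vector h h1 h2 h3 hγ hn) f₀ (ε ω) (fhat ω) hmin hω1
    (fun e he => by rw [hΛw]; exact hω2 e (Finset.mem_compl.mpr he)) f
  have hlam2 : lam ^ 2 = γ ^ 2 * σ ^ 2 * (2 * L / n) := by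
    rw [hlam, tuning, mul_pow, mul_pow, Real.sq_sqrt (by positivity)]
  rw [normSq_sub, normSq_sub, tvOff_eq, harmonicMean_Δ h, ← hs, hnc]
  have hdiv := mul_le_mul_of_nonneg_left horacle (by positivity : (0 : ℝ) ≤ 1 / n)
  refine hdiv.trans (le_of_eq ?_)
  rw [hcardK, ← hs, mul_pow, hlam2]
  have hs0 : (s : ℝ) ≠ 0 := by linarith
  have h7 : γ ≠ 0 := by linarith
  rw [div_div_eq_mul_div]
  push_cast
  field_simp
  ring

theorem ζ_nonneg (n₁ b : ℕ) (S : Finset ℕ) : 0 ≤ ζ n₁ b S := by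
  unfold ζ
  split_ifs <;> positivity

end BranchedPath

/-! ### The rate -/

namespace BranchedPath

/-- The remainder of the oracle inequality is of the order of the rate. -/
theorem remainder_le_rate {σ γ δ : ℝ} (hσ : 0 < σ) (hδ₀ : 0 < δ) (hδ₁ : δ < 1)
    {n s : ℕ} (hs : 3 ≤ s) (hn : 4 * s + 6 ≤ n) {H : ℝ} (hH : 0 ≤ H) :
    8 * Real.log (2 / δ) * σ ^ 2 / n + 4 * σ ^ 2 * (((s : ℝ) + 1) / n)
        + 8 * σ ^ 2 * Real.log (4 * ((n : ℝ) - s - 1) / δ) *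
          (2 * γ ^ 2 * s / H
            + 5 * (2 * s + 3) / (2 * n) * Real.log ((n + 1) / (2 * s + 3))) ≤
      (8 * Real.log (2 / δ) * σ ^ 2 + 8 * σ ^ 2 + 60 * σ ^ 2 * (Real.log (4 / δ) + 1) +
        16 * σ ^ 2 * γ ^ 2 * (Real.log (4 / δ) + 1)) *
      (Real.log n * s / H + Real.log n * Real.log ((n : ℝ) / s) * s / n) := by
  have hnR : 4 * (s : ℝ) + 6 ≤ n := by exact_mod_cast hn
  have hsR : (3 : ℝ) ≤ s := by exact_mod_cast hs
  have hs0 : (0 : ℝ) < s := by linarith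
  have hn0 : (0 : ℝ) < n := by linarith
  have hlog4 : 1 ≤ Real.log 4 := by
    have h1 : Real.log 4 = 2 * Real.log 2 := by
      rw [show (4 : ℝ) = 2 ^ 2 by norm_num, Real.log_pow]; push_cast; ring
    rw [h1]
    linarith [Real.log_two_gt_d9]
  have hlogn : 1 ≤ Real.log n := hlog4.trans (Real.log_le_log (by norm_num) (by linarith))
  have hlogns : 1 ≤ Real.log ((n : ℝ) / s) :=
    hlog4.trans (Real.log_le_log (by norm_num) (by rw [le_div_iff₀ hs0]; linarith))
  have h2δ : 0 ≤ Real.log (2 / δ) := Real.log_nonneg (by rw [le_div_iff₀ hδ₀]; linarith)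
  have h4δ : 0 ≤ Real.log (4 / δ) := Real.log_nonneg (by rw [le_div_iff₀ hδ₀]; linarith)
  set c := Real.log (4 / δ) + 1 with hc
  set L := Real.log (4 * ((n : ℝ) - s - 1) / δ) with hL
  have hL0 : 0 ≤ L := Real.log_nonneg (by rw [le_div_iff₀ hδ₀]; linarith)
  have hLc : L ≤ c * Real.log n := by
    have h1 : L ≤ Real.log (4 / δ * n) := by
      refine Real.log_le_log (div_pos (by linarith) hδ₀) ?_
      rw [div_mul_eq_mul_div]
      exact div_le_div_of_nonneg_right (by linarith) hδ₀.le
    rw [Real.log_mul (by positivity) hn0.ne'] at h1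
    nlinarith
  have hl : Real.log (((n : ℝ) + 1) / (2 * s + 3)) ≤ Real.log ((n : ℝ) / s) := by
    refine Real.log_le_log (by positivity) ?_
    rw [div_le_div_iff₀ (by positivity) hs0]
    nlinarith
  have hl0 : 0 ≤ Real.log (((n : ℝ) + 1) / (2 * s + 3)) := by
    refine Real.log_nonneg ?_
    rw [le_div_iff₀ (by positivity)]
    linarith
  set X := (s : ℝ) / H with hX
  set Y := Real.log ((n : ℝ) / s) * s / n with hY
  have hX0 : 0 ≤ X := by positivity
  have hsY : (s : ℝ) / n ≤ Y := by
    rw [hY]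
    exact div_le_div_of_nonneg_right (by nlinarith) hn0.le
  have hYl : Y ≤ Real.log n * Y := by
    have : 0 ≤ Y := le_trans (by positivity) hsY
    nlinarith
  have h1n : 1 / (n : ℝ) ≤ s / n := div_le_div_of_nonneg_right (by linarith) hn0.le
  have t1 : 8 * Real.log (2 / δ) * σ ^ 2 / n ≤
      8 * Real.log (2 / δ) * σ ^ 2 * (Real.log n * Y) := by
    rw [div_eq_mul_one_div]
    exact mul_le_mul_of_nonneg_left (by linarith) (by positivity)
  have t2 : 4 * σ ^ 2 * (((s : ℝ) + 1) / n) ≤ 8 * σ ^ 2 * (Real.log n * Y) := by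
    have h1 : ((s : ℝ) + 1) / n ≤ 2 * (s / n) := by rw [add_div]; linarith
    have h2 : ((s : ℝ) + 1) / n ≤ 2 * (Real.log n * Y) := by linarith
    nlinarith [sq_nonneg σ]
  have t3 : 5 * (2 * (s : ℝ) + 3) / (2 * n) * Real.log (((n : ℝ) + 1) / (2 * s + 3)) ≤
      15 / 2 * Y := by
    have h1 : 5 * (2 * (s : ℝ) + 3) / (2 * n) ≤ 15 / 2 * (s / n) := by
      rw [mul_div_assoc', div_le_div_iff₀ (by positivity) hn0]
      nlinarith
    calc _ ≤ 15 / 2 * (s / n) * Real.log ((n : ℝ) / s) := by gcongr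
      _ = 15 / 2 * Y := by rw [hY]; ring
  have t4 : 8 * σ ^ 2 * L * (2 * γ ^ 2 * s / H +
      5 * (2 * s + 3) / (2 * n) * Real.log ((n + 1) / (2 * s + 3))) ≤
      8 * σ ^ 2 * (c * Real.log n) * (2 * γ ^ 2 * X + 15 / 2 * Y) := by
    have h1 : 2 * γ ^ 2 * s / H = 2 * γ ^ 2 * X := by rw [hX]; ring
    rw [h1]
    have h2 : 0 ≤ 5 * (2 * (s : ℝ) + 3) / (2 * n) *
        Real.log (((n : ℝ) + 1) / (2 * s + 3)) := mul_nonneg (by positivity) hl0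
    have h3 : 0 ≤ c * Real.log n := hL0.trans hLc
    refine mul_le_mul (by gcongr) (by linarith) (by positivity) (by positivity)
  have hXl : 0 ≤ Real.log n * X := mul_nonneg (by linarith) hX0
  have hYl0 : 0 ≤ Real.log n * Y :=
    mul_nonneg (by linarith) (le_trans (by positivity) hsY)
  have e1 : Real.log n * s / H = Real.log n * X := by rw [hX]; ring
  have e2 : Real.log n * Real.log ((n : ℝ) / s) * s / n = Real.log n * Y := by rw [hY]; ring
  have hc0 : 0 ≤ c := by rw [hc]; linarith
  have k1 : 0 ≤ 8 * Real.log (2 / δ) * σ ^ 2 * (Real.log n * X) := by positivity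
  have k2 : 0 ≤ 8 * σ ^ 2 * (Real.log n * X) := by positivity
  have k3 : 0 ≤ 60 * σ ^ 2 * c * (Real.log n * X) := by positivity
  have k4 : 0 ≤ 16 * σ ^ 2 * γ ^ 2 * c * (Real.log n * Y) := by positivity
  rw [e1, e2]
  have e3 : 8 * σ ^ 2 * (c * Real.log n) * (2 * γ ^ 2 * X + 15 / 2 * Y) =
      16 * σ ^ 2 * γ ^ 2 * c * (Real.log n * X) + 60 * σ ^ 2 * c * (Real.log n * Y) := by ring
  rw [e3] at t4
  refine (add_le_add (add_le_add t1 t2) t4).trans ?_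
  clear_value c X Y
  linarith

end BranchedPath

theorem corollary5p4 (σ γ δ : ℝ) (hσ : 0 < σ) (hγ : 1 < γ) (hδ₀ : 0 < δ) (hδ₁ : δ < 1) :
    -- the sharp oracle inequality
    (∀ (n₁ n₂ b : ℕ) (S : Finset ℕ) (d : Fin 3 → ℕ),
      BranchedPath.Setting n₁ n₂ b S d →
      4 ≤ BranchedPath.dStart b S → 4 ≤ BranchedPath.dEnd₂ n₁ b S →
      4 ≤ BranchedPath.dEnd₃ n₁ n₂ S →
      ∀ (n s : ℕ) (lam : ℝ), n = n₁ + n₂ → s = S.card →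
      lam = BranchedPath.tuning n s σ γ δ →
      ∀ (Ω : Type*) [MeasurableSpace Ω] (P : Measure Ω) [IsProbabilityMeasure P]
        (f₀ : BranchedPath.Vertex (n₁ + n₂) → ℝ)
        (ε fhat : Ω → BranchedPath.Vertex (n₁ + n₂) → ℝ),
      HasLaw ε (BranchedPath.noiseLaw (n₁ + n₂) σ) P →
      (∀ ω, BranchedPath.IsTVEstimator n₁ n₂ b lam (f₀ + ε ω) (fhat ω)) →
      ENNReal.ofReal (1 - δ) ≤ P {ω |
        BranchedPath.normSq (fhat ω - f₀) ≤
          (⨅ f : BranchedPath.Vertex (n₁ + n₂) → ℝ,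
            (BranchedPath.normSq (f - f₀) + 4 * lam * BranchedPath.tvOff n₁ n₂ b S f))
          + 8 * Real.log (2 / δ) * σ ^ 2 / n + 4 * σ ^ 2 * ((s + 1) / n)
          + 8 * σ ^ 2 * Real.log (4 * ((n : ℝ) - s - 1) / δ) *
            (2 * γ ^ 2 * s / BranchedPath.harmonicMean (BranchedPath.Δ n₁ n₂ b S d)
              + 5 * (2 * s + 3) / (2 * n) * Real.log ((n + 1) / (2 * s + 3))
              + BranchedPath.ζ n₁ b S / n)}) ∧
    -- the rate for `S = S₀`, the set of the jumps of `f₀`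
    ∃ C : ℝ, 0 < C ∧ ∀ (n₁ n₂ b : ℕ) (S : Finset ℕ) (d : Fin 3 → ℕ),
      BranchedPath.Setting n₁ n₂ b S d →
      4 ≤ BranchedPath.dStart b S → 4 ≤ BranchedPath.dEnd₂ n₁ b S →
      4 ≤ BranchedPath.dEnd₃ n₁ n₂ S →
      ∀ (n s : ℕ) (lam : ℝ), n = n₁ + n₂ → s = S.card →
      lam = BranchedPath.tuning n s σ γ δ →
      ∀ (Ω : Type*) [MeasurableSpace Ω] (P : Measure Ω) [IsProbabilityMeasure P]
        (f₀ : BranchedPath.Vertex (n₁ + n₂) → ℝ)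
        (ε fhat : Ω → BranchedPath.Vertex (n₁ + n₂) → ℝ),
      (∀ e : BranchedPath.Edge (n₁ + n₂), (e : ℕ) ∈ S ↔ (BranchedPath.D n₁ n₂ b *ᵥ f₀) e ≠ 0) →
      HasLaw ε (BranchedPath.noiseLaw (n₁ + n₂) σ) P →
      (∀ ω, BranchedPath.IsTVEstimator n₁ n₂ b lam (f₀ + ε ω) (fhat ω)) →
      ENNReal.ofReal (1 - δ) ≤ P {ω |
        BranchedPath.normSq (fhat ω - f₀) ≤
          C * (Real.log n * s / BranchedPath.harmonicMean (BranchedPath.Δ n₁ n₂ b S d)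
            + Real.log n * Real.log ((n : ℝ) / s) * s / n
            + Real.log n * BranchedPath.ζ n₁ b S / n)} := by
  classical
  constructor
  · intro n₁ n₂ b S d h h1 h2 h3 n s lam hn hs hlam Ω _ P _ f₀ ε fhat hε hfhat
    refine (BranchedPath.oracle_inequality_prob hσ hγ hδ₀ hδ₁ h h1 h2 h3 hn hs hlam P f₀ ε fhat hε
      hfhat).trans (measure_mono fun ω hω => ?_)
    obtain ⟨hs3, hns⟩ := h.card_bounds h1 h2 h3
    rw [← hn, ← hs] at hns
    rw [← hs] at hs3
    have hnR : 4 * (s : ℝ) + 6 ≤ n := by exact_mod_cast hns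
    have hL0 : 0 ≤ Real.log (4 * ((n : ℝ) - s - 1) / δ) := by
      refine Real.log_nonneg ?_
      rw [le_div_iff₀ hδ₀]
      have : (3 : ℝ) ≤ s := by exact_mod_cast hs3
      linarith
    have hζ : 0 ≤ 8 * σ ^ 2 * Real.log (4 * ((n : ℝ) - s - 1) / δ) *
        (BranchedPath.ζ n₁ b S / n) := by
      have := BranchedPath.ζ_nonneg n₁ b S
      positivity
    have hinf := le_ciInf (f := fun f : BranchedPath.Vertex (n₁ + n₂) → ℝ =>
      BranchedPath.normSq (f - f₀) + 4 * lam * BranchedPath.tvOff n₁ n₂ b S f)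
      (fun f => sub_le_iff_le_add.mpr (((hω f).trans_eq (by ring)).trans (le_refl
        (BranchedPath.normSq (f - f₀) + 4 * lam * BranchedPath.tvOff n₁ n₂ b S f +
        (8 * Real.log (2 / δ) * σ ^ 2 / n + 4 * σ ^ 2 * ((s + 1) / n)
          + 8 * σ ^ 2 * Real.log (4 * ((n : ℝ) - s - 1) / δ) *
            (2 * γ ^ 2 * s / BranchedPath.harmonicMean (BranchedPath.Δ n₁ n₂ b S d)
              + 5 * (2 * s + 3) / (2 * n) * Real.log ((n + 1) / (2 * s + 3))))))))
    simp only [Set.mem_ofPred_eq]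
    linarith
  · refine ⟨8 * Real.log (2 / δ) * σ ^ 2 + 8 * σ ^ 2 + 60 * σ ^ 2 * (Real.log (4 / δ) + 1) +
        16 * σ ^ 2 * γ ^ 2 * (Real.log (4 / δ) + 1), ?_, ?_⟩
    · have h2δ : 0 ≤ Real.log (2 / δ) := Real.log_nonneg (by rw [le_div_iff₀ hδ₀]; linarith)
      have h4δ : 0 ≤ Real.log (4 / δ) := Real.log_nonneg (by rw [le_div_iff₀ hδ₀]; linarith)
      positivity
    · intro n₁ n₂ b S d h h1 h2 h3 n s lam hn hs hlam Ω _ P _ f₀ ε fhat hS₀ hε hfhat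
      refine (BranchedPath.oracle_inequality_prob hσ hγ hδ₀ hδ₁ h h1 h2 h3 hn hs hlam P f₀ ε fhat hε
        hfhat).trans (measure_mono fun ω hω => ?_)
      obtain ⟨hs3, hns⟩ := h.card_bounds h1 h2 h3
      rw [← hn, ← hs] at hns
      rw [← hs] at hs3
      -- the oracle is the signal itself, which has no increments outside `S`
      have htv : BranchedPath.tvOff n₁ n₂ b S f₀ = 0 := by
        refine Finset.sum_eq_zero fun e he => ?_
        have he' := (Finset.mem_filter.mp he).2
        rw [hS₀ e, not_not] at he'
        rw [he', abs_zero]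
      have hnorm : BranchedPath.normSq (f₀ - f₀) = 0 := by simp [BranchedPath.normSq]
      have hω₀ := hω f₀
      rw [htv, hnorm] at hω₀
      have hH : 0 ≤ BranchedPath.harmonicMean (BranchedPath.Δ n₁ n₂ b S d) :=
        div_nonneg (Nat.cast_nonneg _) (BranchedPath.recipSum_nonneg _)
      have hrate := BranchedPath.remainder_le_rate (γ := γ) hσ hδ₀ hδ₁ hs3 hns hH
      have h2δ : 0 ≤ Real.log (2 / δ) := Real.log_nonneg (by rw [le_div_iff₀ hδ₀]; linarith)
      have h4δ : 0 ≤ Real.log (4 / δ) := Real.log_nonneg (by rw [le_div_iff₀ hδ₀]; linarith)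
      have hlogn : 0 ≤ Real.log n := Real.log_natCast_nonneg n
      have hζ : 0 ≤ (8 * Real.log (2 / δ) * σ ^ 2 + 8 * σ ^ 2 +
          60 * σ ^ 2 * (Real.log (4 / δ) + 1) + 16 * σ ^ 2 * γ ^ 2 * (Real.log (4 / δ) + 1)) *
          (Real.log n * BranchedPath.ζ n₁ b S / n) := by
        have := BranchedPath.ζ_nonneg n₁ b S
        positivity
      simp only [Set.mem_ofPred_eq]
      rw [mul_add _ (_ + _)]
      linarith
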